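/- Let $\mathrm{Sym}_0(3)$ be the space of real symmetric traceless $3\times 3$ matrices with the Frobenius norm $|\cdot|$. Fix $\delta>0$ and $a,b,c>0$ with $b^2>27ac$. Consider the equation $$\partial_t Q=\Delta Q-aQ+b\left(Q^2-\tfrac13\mathrm{tr}(Q^2)I\right)-c\,\mathrm{tr}(Q^2)\,Q\qquad\text{on }\mathbb{R}^3\times(0,\infty).\tag{1}$$ Let $H=L^2(\mathbb{R}^3,\mathrm{Sym}_0(3))\cap L^6(\mathbb{R}^3,\mathrm{Sym}_0(3))$. A solution of (1) with initial datum $Q_0$ is a $C^\infty$ map $Q:\mathbb{R}^3\times(0,\infty)\to\mathrm{Sym}_0(3)$ which satisfies (1) pointwise, with $Q(\cdot,t)\in H$ for all $t>0$ and $Q(\cdot,t)\to Q_0$ in $H$ as $t\to0^+$. Let $\mathcal{A}$ be the space of all $Q_0\in L^\infty(\mathbb{R}^3,\mathrm{Sym}_0(3))$ with $$\|Q_0\|_{\mathcal{A}}:=\operatorname*{ess\,sup}_{x}\,(1+|x|)^{8+\delta}|Q_0(x)|<\infty,$$ and for $k>0$ let $X^{(k)}$ be the space of all continuous maps $U:\mathbb{R}^3\times(0,\infty)\to\mathrm{Sym}_0(3)$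 with $$\|U\|:=\sup_{x\in\mathbb{R}^3,\,t>0}\left(1+\tfrac{|x|}{\sqrt{t+1}}\right)^{4+\delta/2}(t+1)^{k}|U(x,t)|<\infty.$$ Put $\mathcal{X}=X^{(3/2)}$, $X_0=X^{(2)}$ and $\Phi_1(x,t)=(4\pi(t+1))^{-3/2}e^{-|x|^2/4(t+1)}$. Theorem. There exists $\eta>0$, depending only on $\delta,a,b,c$, such that the following holds with $\mathcal{A}^\circ:=\{Q_0\in\mathcal{A}:\|Q_0\|_{\mathcal{A}}<\eta\}$. (i) For every $Q_0\in\mathcal{A}^\circ$ equation (1) has a unique solution $Q$ with initial datum $Q_0$. Both $Q$ and $R(x,t):=e^{at}Q(x,t)$ belong to $\mathcal{X}$, and there is exactly one $A\in\mathrm{Sym}_0(3)$ such that $$Q(x,t)=A\,e^{-at}\Phi_1(x,t)+e^{-at}V(x,t)\qquad(x\in\mathbb{R}^3,\ t>0)$$ for some $V\in X_0$. (ii) The solution maps $Q_0\mapsto Q$ and $Q_0\mapsto R$ from $\mathcal{A}^\circ$ to $\mathcal{X}$ are real-analytic. (iii) The map $Q_0\mapsto A$ from $\mathcal{A}^\circ$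 to $\mathrm{Sym}_0(3)$ is real-analytic, and its zero set $\{Q_0\in\mathcal{A}^\circ: A=0\}$ is closed in $\mathcal{A}^\circ$ and has empty interior. -/

import Mathlib

open MeasureTheory Filter Topology Set
open scoped ENNReal ContDiff

noncomputable section

namespace QTensor

-- Matrices carry the Frobenius norm.
attribute [local instance] Matrix.frobeniusNormedAddCommGroup Matrix.frobeniusNormedSpace

/-- Physical space `ℝ³` with its Euclidean norm and Lebesgue measure. -/
abbrev E : Type := EuclideanSpace ℝ (Fin 3)

/-- The space of symmetric traceless real `3 × 3` matrices, as a subspace of all matrices. -/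
def symTraceless : Submodule ℝ (Matrix (Fin 3) (Fin 3) ℝ) where
  carrier := {Q | Q.transpose = Q ∧ Q.trace = 0}
  add_mem' := by
    rintro P Q ⟨hP, hP'⟩ ⟨hQ, hQ'⟩
    exact ⟨by rw [Matrix.transpose_add, hP, hQ], by rw [Matrix.trace_add, hP', hQ', add_zero]⟩
  zero_mem' := ⟨Matrix.transpose_zero, Matrix.trace_zero _ _⟩
  smul_mem' := by
    rintro r Q ⟨hQ, hQ'⟩
    exact ⟨by rw [Matrix.transpose_smul, hQ], by rw [Matrix.trace_smul, hQ', smul_zero]⟩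

/-- `Sym₀(3)`, with the Frobenius norm. -/
def Sym0 : Type := symTraceless

instance : NormedAddCommGroup Sym0 := inferInstanceAs (NormedAddCommGroup symTraceless)

instance : NormedSpace ℝ Sym0 := inferInstanceAs (NormedSpace ℝ symTraceless)

/-- The matrix underlying an element of `Sym₀(3)`. -/
def Sym0.mat (Q : Sym0) : Matrix (Fin 3) (Fin 3) ℝ := Q.1

lemma Sym0.mat_transpose (Q : Sym0) : Q.mat.transpose = Q.mat := Q.2.1

/-- The Frobenius norm `|Q| = (Q : Q)^{1/2}`. -/
lemma Sym0.norm_eq (Q : Sym0) : ‖Q‖ = Real.sqrt (∑ i, ∑ j, Q.mat i j * Q.mat j i) := by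
  have h : ∀ i j, Q.mat j i = Q.mat i j := fun i j => congrFun (congrFun Q.mat_transpose i) j
  have h2 : ‖Q‖ = ‖Q.mat‖ := rfl
  rw [h2, Matrix.frobenius_norm_def, Real.sqrt_eq_rpow]
  congr 1
  refine Finset.sum_congr rfl fun i _ => Finset.sum_congr rfl fun j _ => ?_
  rw [h i j, Real.norm_eq_abs]
  norm_num
  ring

/-- `Q² - (1/3) tr(Q²) I`, again symmetric and traceless. -/
def devSq (Q : Sym0) : Sym0 :=
  ⟨Q.mat * Q.mat - ((1 / 3 : ℝ) * (Q.mat * Q.mat).trace) • (1 : Matrix (Fin 3) (Fin 3) ℝ), by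
    constructor
    · rw [Matrix.transpose_sub, Matrix.transpose_mul, Q.mat_transpose, Matrix.transpose_smul,
        Matrix.transpose_one]
    · rw [Matrix.trace_sub, Matrix.trace_smul, Matrix.trace_one]
      simp
      ring⟩

/-- The weight `(1 + |x|)^{8+δ}`. -/
def spaceWeight (δ : ℝ) (x : E) : ℝ := (1 + ‖x‖) ^ (8 + δ)

lemma spaceWeight_pos (δ : ℝ) (x : E) : 0 < spaceWeight δ x :=
  Real.rpow_pos_of_pos (by positivity) _

/-- The maps `Q ∈ L^∞(ℝ³, Sym₀(3))` with `ess sup (1 + |x|)^{8+δ} |Q(x)| < ∞`. -/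
def dataSubmodule (δ : ℝ) : Submodule ℝ (Lp Sym0 ∞ (volume : Measure E)) where
  carrier := {Q | MemLp (fun x => spaceWeight δ x • Q x) ∞ (volume : Measure E)}
  add_mem' := by
    intro P Q hP hQ
    refine (MemLp.add hP hQ).ae_eq ?_
    filter_upwards [Lp.coeFn_add P Q] with x hx
    exact ((congrArg (spaceWeight δ x • ·) hx).trans (smul_add _ _ _)).symm
  zero_mem' := by
    refine (MemLp.zero (p := ∞) (ε := Sym0)).ae_eq ?_
    filter_upwards [Lp.coeFn_zero Sym0 ∞ (volume : Measure E)] with x hx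
    exact ((congrArg (spaceWeight δ x • ·) hx).trans (smul_zero _)).symm
  smul_mem' := by
    intro r Q hQ
    refine (MemLp.const_smul hQ r).ae_eq ?_
    filter_upwards [Lp.coeFn_smul r Q] with x hx
    exact ((congrArg (spaceWeight δ x • ·) hx).trans (smul_comm _ r (Q x))).symm

/-- The space `𝒜` of initial data. It is a copy of `dataSubmodule δ`, so that it carries the
weighted norm below and not the norm of `L^∞`. -/
def Data (δ : ℝ) : Type := dataSubmodule δ

instance (δ : ℝ) : AddCommGroup (Data δ) := inferInstanceAs (AddCommGroup (dataSubmodule δ))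

instance (δ : ℝ) : Module ℝ (Data δ) := inferInstanceAs (Module ℝ (dataSubmodule δ))

/-- A representative of a datum (well defined up to null sets). -/
instance (δ : ℝ) : CoeFun (Data δ) (fun _ => E → Sym0) := ⟨fun Q => Q.1⟩

lemma memLp_weighted {δ : ℝ} (Q : dataSubmodule δ) :
    MemLp (fun x => spaceWeight δ x • Q.1 x) ∞ (volume : Measure E) := Q.2

/-- Multiplication by the weight, from `𝒜` to `L^∞`. -/
def weightedData (δ : ℝ) : dataSubmodule δ →ₗ[ℝ] Lp Sym0 ∞ (volume : Measure E) where
  toFun Q := MemLp.toLp (fun x => spaceWeight δ x • Q.1 x) (memLp_weighted Q)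
  map_add' P Q := by
    refine Eq.trans (MemLp.toLp_congr _ ((memLp_weighted P).add (memLp_weighted Q)) ?_)
      (MemLp.toLp_add _ _)
    filter_upwards [Lp.coeFn_add P.1 Q.1] with x hx
    exact (congrArg (spaceWeight δ x • ·) hx).trans (smul_add _ _ _)
  map_smul' r Q := by
    refine Eq.trans (MemLp.toLp_congr _ ((memLp_weighted Q).const_smul r) ?_)
      (MemLp.toLp_const_smul _ _)
    filter_upwards [Lp.coeFn_smul r Q.1] with x hx
    exact (congrArg (spaceWeight δ x • ·) hx).trans (smul_comm _ r (Q.1 x))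

/-- The same map on the type `Data δ`. -/
def Data.weighted (δ : ℝ) : Data δ →ₗ[ℝ] Lp Sym0 ∞ (volume : Measure E) := weightedData δ

lemma Data.weighted_injective (δ : ℝ) : Function.Injective (Data.weighted δ) := by
  intro P Q h
  have h1 := (MemLp.toLp_eq_toLp_iff P.2 Q.2).1 h
  refine Subtype.ext (Lp.ext ?_)
  filter_upwards [h1] with x hx
  exact smul_right_injective Sym0 (spaceWeight_pos δ x).ne' hx

/-- The norm `‖Q‖_𝒜 = ess sup (1 + |x|)^{8+δ} |Q(x)|`. -/
instance (δ : ℝ) : NormedAddCommGroup (Data δ) :=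
  NormedAddCommGroup.induced _ _ (Data.weighted δ) (Data.weighted_injective δ)

instance (δ : ℝ) : NormedSpace ℝ (Data δ) := NormedSpace.induced ℝ _ _ (Data.weighted δ)

lemma Data.norm_eq (δ : ℝ) (Q : Data δ) :
    ‖Q‖ = (eLpNorm (fun x => spaceWeight δ x • Q x) ∞ (volume : Measure E)).toReal :=
  Lp.norm_toLp (fun x => spaceWeight δ x • Q x) Q.2

/-- The open half space `ℝ³ × (0, ∞)`. -/
abbrev SpaceTime : Type := E × Ioi (0 : ℝ)

/-- The weight `(1 + |x| / √(t+1))^{4+δ/2} (t+1)^k`. -/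
def timeWeight (δ k : ℝ) (x : E) (t : ℝ) : ℝ :=
  (1 + ‖x‖ / Real.sqrt (t + 1)) ^ (4 + δ / 2) * (t + 1) ^ k

lemma timeWeight_pos (δ k : ℝ) (p : SpaceTime) : 0 < timeWeight δ k p.1 p.2 := by
  have h : (0 : ℝ) < p.2 + 1 := by have := p.2.2; rw [mem_Ioi] at this; linarith
  exact mul_pos (Real.rpow_pos_of_pos (by positivity) _) (Real.rpow_pos_of_pos h _)

lemma timeWeight_continuous (δ k : ℝ) :
    Continuous fun p : SpaceTime => timeWeight δ k p.1 p.2 := by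
  have h : ∀ p : SpaceTime, (0 : ℝ) < p.2 + 1 := fun p => by
    have := p.2.2; rw [mem_Ioi] at this; linarith
  refine Continuous.mul (Continuous.rpow_const ?_ fun p => Or.inl ?_)
    (Continuous.rpow_const (by fun_prop) fun p => Or.inl (h p).ne')
  · exact continuous_const.add (Continuous.div (by fun_prop) (by fun_prop)
      fun p => (Real.sqrt_pos.2 (h p)).ne')
  · positivity

/-- The continuous maps `U : ℝ³ × (0, ∞) → Sym₀(3)` for which the weight times `|U|` is bounded. -/
def weightedSubmodule (δ k : ℝ) : Submodule ℝ C(SpaceTime, Sym0) where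
  carrier := {U | ∃ C : ℝ, ∀ p : SpaceTime, timeWeight δ k p.1 p.2 * ‖U p‖ ≤ C}
  add_mem' := by
    rintro U V ⟨C, hC⟩ ⟨D, hD⟩
    refine ⟨C + D, fun p => ?_⟩
    calc timeWeight δ k p.1 p.2 * ‖(U + V) p‖
        ≤ timeWeight δ k p.1 p.2 * (‖U p‖ + ‖V p‖) :=
          mul_le_mul_of_nonneg_left (norm_add_le _ _) (timeWeight_pos δ k p).le
      _ ≤ C + D := by rw [mul_add]; exact add_le_add (hC p) (hD p)
  zero_mem' := ⟨0, fun p => by simp⟩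
  smul_mem' := by
    rintro r U ⟨C, hC⟩
    refine ⟨‖r‖ * C, fun p => ?_⟩
    rw [ContinuousMap.smul_apply, norm_smul, mul_left_comm]
    exact mul_le_mul_of_nonneg_left (hC p) (norm_nonneg r)

/-- The Banach space of continuous maps `U : ℝ³ × (0, ∞) → Sym₀(3)` with finite norm
`sup (1 + |x| / √(t+1))^{4+δ/2} (t+1)^k |U(x,t)|`. -/
def Weighted (δ k : ℝ) : Type := weightedSubmodule δ k

instance (δ k : ℝ) : AddCommGroup (Weighted δ k) :=
  inferInstanceAs (AddCommGroup (weightedSubmodule δ k))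

instance (δ k : ℝ) : Module ℝ (Weighted δ k) :=
  inferInstanceAs (Module ℝ (weightedSubmodule δ k))

instance (δ k : ℝ) : CoeFun (Weighted δ k) (fun _ => SpaceTime → Sym0) := ⟨fun U => U.1⟩

/-- Multiplication by the weight, into the bounded continuous functions. -/
def Weighted.toBCF (δ k : ℝ) : Weighted δ k →ₗ[ℝ] BoundedContinuousFunction SpaceTime Sym0 where
  toFun U := BoundedContinuousFunction.ofNormedAddCommGroup
    (fun p : SpaceTime => timeWeight δ k p.1 p.2 • U p)
    ((timeWeight_continuous δ k).smul U.1.continuous) U.2.choose (fun p => by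
      rw [norm_smul, Real.norm_of_nonneg (timeWeight_pos δ k p).le]
      exact U.2.choose_spec p)
  map_add' U V := by
    ext1 p
    exact smul_add _ (U p) (V p)
  map_smul' r U := by
    ext1 p
    exact smul_comm _ r (U p)

lemma Weighted.toBCF_injective (δ k : ℝ) : Function.Injective (Weighted.toBCF δ k) := by
  intro U V h
  refine Subtype.ext (ContinuousMap.ext fun p => ?_)
  exact smul_right_injective Sym0 (timeWeight_pos δ k p).ne' (DFunLike.congr_fun h p)

instance (δ k : ℝ) : NormedAddCommGroup (Weighted δ k) :=
  NormedAddCommGroup.induced _ _ (Weighted.toBCF δ k) (Weighted.toBCF_injective δ k)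

instance (δ k : ℝ) : NormedSpace ℝ (Weighted δ k) :=
  NormedSpace.induced ℝ _ _ (Weighted.toBCF δ k)

lemma Weighted.norm_eq (δ k : ℝ) (U : Weighted δ k) :
    ‖U‖ = ⨆ p : SpaceTime, timeWeight δ k p.1 p.2 * ‖U p‖ := by
  have h : ‖U‖ = ‖Weighted.toBCF δ k U‖ := rfl
  rw [h, BoundedContinuousFunction.norm_eq_iSup_norm]
  refine iSup_congr fun p => ?_
  rw [← Real.norm_of_nonneg (timeWeight_pos δ k p).le, ← norm_smul]
  rfl

/-- The solution space `𝒳`, with time weight `(t+1)^{3/2}`. -/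
abbrev XSpace (δ : ℝ) : Type := Weighted δ (3 / 2)

/-- The remainder space `X₀`, with time weight `(t+1)²`. -/
abbrev RemainderSpace (δ : ℝ) : Type := Weighted δ 2

/-- A map on `ℝ³ × (0, ∞)` as a function of `x` and `t`; its values for `t ≤ 0` are irrelevant. -/
def Weighted.eval {δ k : ℝ} (U : Weighted δ k) (x : E) (t : ℝ) : Sym0 :=
  if h : 0 < t then U (x, ⟨t, h⟩) else 0

/-- The time-shifted heat kernel `Φ₁(x,t) = (4π(t+1))^{-3/2} exp(-|x|²/(4(t+1)))`. -/
def heatKernelShifted (x : E) (t : ℝ) : ℝ :=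
  Real.exp (-‖x‖ ^ 2 / (4 * (t + 1))) / (4 * Real.pi * (t + 1)) ^ (3 / 2 : ℝ)

/-- `Q` is a global classically smooth solution of
`∂ₜQ = ΔQ - aQ + b(Q² - (1/3) tr(Q²) I) - c tr(Q²) Q` on `ℝ³ × (0, ∞)` with `Q(·,t)` in the phase
space `H = L² ∩ L⁶` for all `t > 0`, and `Q(·,t) → Q₀` in `H` as `t → 0⁺`. -/
structure IsSolution (a b c : ℝ) (Q₀ : E → Sym0) (Q : E → ℝ → Sym0) : Prop where
  smooth : ContDiffOn ℝ ∞ (fun p : E × ℝ => Q p.1 p.2) (univ ×ˢ Ioi 0)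
  equation : ∀ (x : E) (t : ℝ), 0 < t →
    deriv (fun s => Q x s) t = Laplacian.laplacian (fun y => Q y t) x - a • Q x t
      + b • devSq (Q x t) - (c * ((Q x t).mat * (Q x t).mat).trace) • Q x t
  memLp_two : ∀ t : ℝ, 0 < t → MemLp (fun x => Q x t) 2 (volume : Measure E)
  memLp_six : ∀ t : ℝ, 0 < t → MemLp (fun x => Q x t) 6 (volume : Measure E)
  initial_two : Tendsto (fun t : ℝ => eLpNorm (fun x => Q x t - Q₀ x) 2 (volume : Measure E))
    (𝓝[>] 0) (𝓝 0)
  initial_six : Tendsto (fun t : ℝ => eLpNorm (fun x => Q x t - Q₀ x) 6 (volume : Measure E))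
    (𝓝[>] 0) (𝓝 0)

/-- `A` is a coefficient matrix of `Q`: there is `V ∈ X₀` with
`Q(x,t) = A e^{-at} Φ₁(x,t) + e^{-at} V(x,t)` on `ℝ³ × (0, ∞)`. -/
def HasCoefficient (a δ : ℝ) (Q : E → ℝ → Sym0) (A : Sym0) : Prop :=
  ∃ V : RemainderSpace δ, ∀ (x : E) (t : ℝ), 0 < t →
    Q x t = (Real.exp (-a * t) * heatKernelShifted x t) • A + Real.exp (-a * t) • V.eval x t

end QTensor

end

/-! ### Algebra of `Sym0`: inner product, polarised square, one-sided Lipschitz bound for the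
reaction. -/

noncomputable section

namespace QTensor

/-! Put `R = e^{at} Q`. Then `R` solves a heat equation with source `e^{-at} N(t, R)`, where `N(t,
R) = b devSq R - c e^{-at} |R|² R`, so that `R(t) = e^{tΔ} Q₀ + ∫₀ᵗ e^{-as} e^{(t-s)Δ} N(s, R(s))
ds`. With `m = 4 + δ/2` the data decay like `|x|^{-2m}` and elements of `𝒳` like `|x|^{-m}`. Since
`N` is at least quadratic, the source again decays like `|x|^{-2m}`, up to a power of `s + 1` which
`e^{-as}` absorbs. Hence one linear estimate for the heat flow of `|x|^{-2m}` data
(`exists_heatFlow_decay`) controls both terms. The Duhamel term is an analytic, quadratically small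
map of `𝒳`, so the identity minus this term is inverted analytically near `0`
(`exists_analytic_inverse`). Composing with the linear flow of the data gives the analytic map `Q₀ ↦
R` (`exists_solution_map`), and multiplication by `e^{-at}` gives `Q₀ ↦ Q`.

Smoothness comes from a parameter trick instead of derivative estimates. With `θ(t) = 1 - e^{-t}`,
the function `R(x + θ(t) μ, t + λ θ(t))` solves an integral equation of the same shape, whose kernel
and coefficients are analytic in `(λ, μ)` as bounded functions (`exists_kernel_family`,
`exists_coeff_family`, `distortMap_eq`). The analytic inverse then shows that the whole distorted
function is analytic in `(λ, μ)`. Its value at a fixed point, as `(λ, μ)` moves, is `R` on a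
neighbourhood of that point (`contDiffAt_of_distortion`). Once `R` is smooth, restarting the
integral equation at time `t` identifies its right time derivative, and so the equation holds
pointwise (`tendsto_mild_quotient`). The datum is attained in `L¹`, and uniform bounds raise this to
`L²` and `L⁶`.

Uniqueness is proved among all solutions, without passing through the integral equation. For the
difference `W` of two solutions, `u = |W|²` satisfies `∂ₜu ≤ Δu + K u - (c/2) u²`, because the cubic
term is uniformly monotone. After multiplication by a cutoff at scale `R`, the quadratic absorption
pays for the cutoff error with a remainder of order `R⁻⁴ · R³`, which vanishes as `R → ∞`
(`exists_cutoff_estimate`, `IsSolution.eq`).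

The coefficient is the total mass `A = ∫ Q₀ + ∫₀^∞ e^{-as} ∫ N dx ds`. Each contribution minus its
mass times a Gaussian has mean zero, and the heat flow of a mean-zero datum gains a factor `(t +
1)^{-1/2}` (`exists_heatFlow_remainder`, `exists_duhamel_remainder`); this puts the remainder into
`X₀`. Comparing decay rates at `x = 0` makes `A` unique. Finally `A` is analytic in `Q₀` with
derivative `Q₀ ↦ ∫ Q₀` at the origin, which is not zero. If `A` vanished on an open set, it would
vanish on the whole ball by the identity theorem, and so would this derivative. -/

instance : FiniteDimensional ℝ Sym0 := inferInstanceAs (FiniteDimensional ℝ symTraceless)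

instance : CompleteSpace Sym0 := FiniteDimensional.complete ℝ Sym0

lemma Sym0.trace_mul_self (Q : Sym0) : (Q.mat * Q.mat).trace = ‖Q‖ ^ 2 := by
  have h : (Q.mat * Q.mat).trace = ∑ i, ∑ j, Q.mat i j * Q.mat j i := by
    simp [Matrix.trace, Matrix.mul_apply]
  rw [Sym0.norm_eq, Real.sq_sqrt, h]
  refine Finset.sum_nonneg fun i _ => Finset.sum_nonneg fun j _ => ?_
  have := congrFun (congrFun Q.mat_transpose i) j
  rw [Matrix.transpose_apply] at this
  rw [this]
  exact mul_self_nonneg _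

lemma Sym0.ext_mat {P Q : Sym0} (h : P.mat = Q.mat) : P = Q := Subtype.ext h

lemma Sym0.mat_add (P Q : Sym0) : (P + Q).mat = P.mat + Q.mat := rfl

lemma Sym0.mat_smul (r : ℝ) (Q : Sym0) : (r • Q).mat = r • Q.mat := rfl

/-- The Frobenius inner product on `Sym₀(3)`. -/
instance : InnerProductSpace ℝ Sym0 where
  inner P Q := (P.mat * Q.mat).trace
  norm_sq_eq_re_inner Q := (Q.trace_mul_self).symm
  conj_inner_symm P Q := (conj_trivial _).trans (Matrix.trace_mul_comm _ _)
  add_left P Q R := by simp [Sym0.mat_add, add_mul]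
  smul_left P Q r := by simp [Sym0.mat_smul]

/-- The symmetric product `½(PQ + QP) - ⅓ tr(PQ) I`. -/
def devMul (P Q : Sym0) : Sym0 :=
  ⟨(1 / 2 : ℝ) • (P.mat * Q.mat + Q.mat * P.mat) -
      ((1 / 3 : ℝ) * (P.mat * Q.mat).trace) • (1 : Matrix (Fin 3) (Fin 3) ℝ), by
    constructor
    · simp only [Matrix.transpose_sub, Matrix.transpose_smul, Matrix.transpose_add,
        Matrix.transpose_mul, P.mat_transpose, Q.mat_transpose, Matrix.transpose_one]
      rw [add_comm]
    · simp only [Matrix.trace_sub, Matrix.trace_smul, Matrix.trace_add, Matrix.trace_one,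
        Matrix.trace_mul_comm Q.mat P.mat]
      simp
      ring⟩

lemma devMul_mat (P Q : Sym0) : (devMul P Q).mat =
    (1 / 2 : ℝ) • (P.mat * Q.mat + Q.mat * P.mat) -
      ((1 / 3 : ℝ) * (P.mat * Q.mat).trace) • (1 : Matrix (Fin 3) (Fin 3) ℝ) := rfl

lemma devMul_comm (P Q : Sym0) : devMul P Q = devMul Q P := by
  refine Sym0.ext_mat ?_
  rw [devMul_mat, devMul_mat, add_comm, Matrix.trace_mul_comm]

lemma devMul_add_left (P P' Q : Sym0) : devMul (P + P') Q = devMul P Q + devMul P' Q := by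
  refine Sym0.ext_mat ?_
  simp only [Sym0.mat_add, devMul_mat, add_mul, mul_add, Matrix.trace_add]
  module

lemma devMul_smul_left (r : ℝ) (P Q : Sym0) : devMul (r • P) Q = r • devMul P Q := by
  refine Sym0.ext_mat ?_
  simp only [Sym0.mat_smul, devMul_mat, Matrix.smul_mul, Matrix.mul_smul, Matrix.trace_smul,
    smul_eq_mul]
  module

/-- The polarisation of `devSq` as a continuous bilinear map. -/
def devBilin : Sym0 →L[ℝ] Sym0 →L[ℝ] Sym0 := LinearMap.toContinuousBilinearMap <|
  LinearMap.mk₂ ℝ devMul devMul_add_left devMul_smul_left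
    (fun P Q Q' => by simp only [devMul_comm P, devMul_add_left])
    (fun r P Q => by simp only [devMul_comm P, devMul_smul_left])

lemma devBilin_apply (P Q : Sym0) : devBilin P Q = devMul P Q := rfl

lemma devBilin_self (Q : Sym0) : devBilin Q Q = devSq Q := by
  refine Sym0.ext_mat ?_
  rw [devBilin_apply, devMul_mat]
  change _ = Q.mat * Q.mat - ((1 / 3 : ℝ) * (Q.mat * Q.mat).trace) • (1 : Matrix (Fin 3) (Fin 3) ℝ)
  rw [← two_smul ℝ (Q.mat * Q.mat), smul_smul]
  norm_num

lemma devSq_sub (P Q : Sym0) : devSq Q - devSq P = devBilin (Q + P) (Q - P) := by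
  rw [← devBilin_self, ← devBilin_self]
  have h : devBilin P Q = devBilin Q P := devMul_comm P Q
  simp only [map_add, map_sub, add_apply]
  rw [h]
  abel

/-- The nonlinear part of the equation is one-sided Lipschitz, with a quartic gain. -/
lemma inner_reaction_sub_le {b c : ℝ} (hb : 0 < b) (hc : 0 < c) (P Q : Sym0) :
    inner ℝ (Q - P) ((b • devSq Q - (c * ‖Q‖ ^ 2) • Q) - (b • devSq P - (c * ‖P‖ ^ 2) • P)) ≤
      b ^ 2 * ‖devBilin‖ ^ 2 / c * ‖Q - P‖ ^ 2 - c / 4 * (‖Q - P‖ ^ 2) ^ 2 := by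
  set W := Q - P with hW
  set S := Q + P with hS
  have hQ : Q = (1 / 2 : ℝ) • (S + W) := by rw [hS, hW]; module
  have hP : P = (1 / 2 : ℝ) • (S - W) := by rw [hS, hW]; module
  have h1 : (b • devSq Q - (c * ‖Q‖ ^ 2) • Q) - (b • devSq P - (c * ‖P‖ ^ 2) • P) =
      b • devBilin S W - c • (‖Q‖ ^ 2 • Q - ‖P‖ ^ 2 • P) := by
    rw [hS, hW, ← devSq_sub]; module
  have h2 : inner ℝ W (devBilin S W) ≤ ‖devBilin‖ * ‖S‖ * ‖W‖ ^ 2 := by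
    calc inner ℝ W (devBilin S W) ≤ ‖W‖ * ‖devBilin S W‖ := real_inner_le_norm _ _
      _ ≤ ‖W‖ * (‖devBilin‖ * ‖S‖ * ‖W‖) := by gcongr; exact devBilin.le_opNorm₂ S W
      _ = _ := by ring
  -- Uniform monotonicity of `P ↦ |P|² P`. In the coordinates `S`, `W` the product equals the right
  -- side plus `½ ⟨S, W⟩²`. The part `¼ |W|⁴` is the quartic gain, and `¼ |S|² |W|²` will absorb the
  -- quadratic reaction.
  have h3 : inner ℝ W (‖Q‖ ^ 2 • Q - ‖P‖ ^ 2 • P) ≥ 1 / 4 * (‖S‖ ^ 2 + ‖W‖ ^ 2) * ‖W‖ ^ 2 := by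
    have e1 : ‖Q‖ ^ 2 = 1 / 4 * (‖S‖ ^ 2 + ‖W‖ ^ 2) + 1 / 2 * inner ℝ S W := by
      rw [hQ, norm_smul, mul_pow, norm_add_sq_real]; norm_num; ring
    have e2 : ‖P‖ ^ 2 = 1 / 4 * (‖S‖ ^ 2 + ‖W‖ ^ 2) - 1 / 2 * inner ℝ S W := by
      rw [hP, norm_smul, mul_pow, norm_sub_sq_real]; norm_num; ring
    have e3 : ‖Q‖ ^ 2 • Q - ‖P‖ ^ 2 • P =
        (1 / 4 * (‖S‖ ^ 2 + ‖W‖ ^ 2)) • W + (1 / 2 * inner ℝ S W) • S := by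
      rw [e1, e2, hQ, hP]; module
    rw [e3, inner_add_right, inner_smul_right, inner_smul_right, real_inner_self_eq_norm_sq,
      real_inner_comm]
    nlinarith [sq_nonneg (inner ℝ W S)]
  rw [h1, inner_sub_right, inner_smul_right, inner_smul_right]
  -- Young's inequality, balanced so that `c/4 · |S|²` is exactly what `h3` offers; no size of `P`
  -- and `Q` remains in the constant.
  have h4 : b * (‖devBilin‖ * ‖S‖) ≤ b ^ 2 * ‖devBilin‖ ^ 2 / c + c / 4 * ‖S‖ ^ 2 := by
    have : b ^ 2 * ‖devBilin‖ ^ 2 / c + c / 4 * ‖S‖ ^ 2 - b * (‖devBilin‖ * ‖S‖) =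
        (b * ‖devBilin‖ - c / 2 * ‖S‖) ^ 2 / c := by field_simp; ring
    have h5 : 0 ≤ (b * ‖devBilin‖ - c / 2 * ‖S‖) ^ 2 / c := by positivity
    linarith
  nlinarith [mul_le_mul_of_nonneg_left h2 hb.le, mul_le_mul_of_nonneg_left h3 hc.le,
    mul_le_mul_of_nonneg_right h4 (sq_nonneg ‖W‖)]

end QTensor

end

/-! ### Laplacian identities, cutoff functions, and differentiation under the integral. -/

noncomputable section

namespace QTensor

/-- The standard basis of `ℝ³`. -/
abbrev stdE : OrthonormalBasis (Fin 3) ℝ E := EuclideanSpace.basisFun (Fin 3) ℝ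

section Laplacian

variable {F : Type*} [NormedAddCommGroup F]

lemma fderiv_fderiv_apply [NormedSpace ℝ F] {f : E → F} (hf : ContDiff ℝ 2 f) (x v w : E) :
    fderiv ℝ (fun y => fderiv ℝ f y v) x w = fderiv ℝ (fderiv ℝ f) x w v := by
  have h : DifferentiableAt ℝ (fderiv ℝ f) x :=
    ((hf.fderiv_right (m := 1) le_rfl).differentiable one_ne_zero) x
  rw [fderiv_clm_apply h (differentiableAt_const v)]
  simp

lemma laplacian_eq_sum [NormedSpace ℝ F] {f : E → F} (hf : ContDiff ℝ 2 f) (x : E) :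
    Laplacian.laplacian f x = ∑ i, fderiv ℝ (fun y => fderiv ℝ f y (stdE i)) x (stdE i) := by
  rw [InnerProductSpace.laplacian_eq_iteratedFDeriv_orthonormalBasis f stdE]
  refine Finset.sum_congr rfl fun i _ => ?_
  rw [iteratedFDeriv_two_apply, fderiv_fderiv_apply hf]
  rfl

lemma contDiff_fderiv_apply [NormedSpace ℝ F] {f : E → F} {n m : WithTop ℕ∞} (hf : ContDiff ℝ n f)
    (h : m + 1 ≤ n) (v : E) : ContDiff ℝ m (fun y => fderiv ℝ f y v) :=
  (hf.fderiv_right h).clm_apply contDiff_const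

/-- `Δ|f|² = 2 ⟨f, Δf⟩ + 2 |∇f|²`, and the gradient term is dropped. -/
lemma two_mul_inner_laplacian_le [InnerProductSpace ℝ F] {f : E → F} (hf : ContDiff ℝ 2 f) (x : E) :
    2 * inner ℝ (f x) (Laplacian.laplacian f x) ≤
      Laplacian.laplacian (fun y => ‖f y‖ ^ 2) x := by
  have hd : Differentiable ℝ f := hf.differentiable two_ne_zero
  rw [laplacian_eq_sum hf, laplacian_eq_sum (hf.norm_sq ℝ), inner_sum, Finset.mul_sum]
  refine Finset.sum_le_sum fun i _ => ?_
  have h1 : (fun y => fderiv ℝ (fun y => ‖f y‖ ^ 2) y (stdE i)) =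
      fun y => 2 * inner ℝ (f y) (fderiv ℝ f y (stdE i)) := by
    funext y
    rw [((hd y).hasFDerivAt.norm_sq).fderiv]
    simp
  have hd2 : DifferentiableAt ℝ (fun y => fderiv ℝ f y (stdE i)) x :=
    (contDiff_fderiv_apply hf (m := 1) le_rfl _).differentiable one_ne_zero x
  rw [h1, fderiv_const_mul ((hd x).inner ℝ hd2), _root_.smul_apply,
    fderiv_inner_apply ℝ (hd x) hd2, smul_eq_mul, real_inner_self_eq_norm_sq]
  nlinarith [sq_nonneg ‖fderiv ℝ f x (stdE i)‖]

/-- Two integrations by parts in every coordinate; compact support of `φ` alone makes all products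
integrable, so `u` may grow. -/
lemma integral_mul_laplacian {φ u : E → ℝ} (hφ : ContDiff ℝ 2 φ) (hc : HasCompactSupport φ)
    (hu : ContDiff ℝ 2 u) :
    ∫ x, φ x * Laplacian.laplacian u x = ∫ x, Laplacian.laplacian φ x * u x := by
  have int : ∀ {f g : E → ℝ}, Continuous f → HasCompactSupport f → Continuous g →
      Integrable (fun x => f x * g x) := fun hf hcf hg =>
    (hf.mul hg).integrable_of_hasCompactSupport hcf.mul_right
  have cφ1 : ∀ i, ContDiff ℝ 1 (fun y => fderiv ℝ φ y (stdE i)) :=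
    fun i => contDiff_fderiv_apply hφ le_rfl _
  have cu1 : ∀ i, ContDiff ℝ 1 (fun y => fderiv ℝ u y (stdE i)) :=
    fun i => contDiff_fderiv_apply hu le_rfl _
  have cφ2 : ∀ i, Continuous (fun y => fderiv ℝ (fun y => fderiv ℝ φ y (stdE i)) y (stdE i)) :=
    fun i => (contDiff_fderiv_apply (cφ1 i) (m := 0) (by simp) _).continuous
  have cu2 : ∀ i, Continuous (fun y => fderiv ℝ (fun y => fderiv ℝ u y (stdE i)) y (stdE i)) :=
    fun i => (contDiff_fderiv_apply (cu1 i) (m := 0) (by simp) _).continuous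
  have s1 : ∀ i, HasCompactSupport (fun y => fderiv ℝ φ y (stdE i)) := fun i => hc.fderiv_apply ℝ _
  have s2 : ∀ i, HasCompactSupport
      (fun y => fderiv ℝ (fun y => fderiv ℝ φ y (stdE i)) y (stdE i)) :=
    fun i => (s1 i).fderiv_apply ℝ _
  simp only [laplacian_eq_sum hφ, laplacian_eq_sum hu, Finset.mul_sum, Finset.sum_mul]
  rw [integral_finsetSum _ fun i _ => int hφ.continuous hc (cu2 i),
    integral_finsetSum _ fun i _ => int (cφ2 i) (s2 i) hu.continuous]
  refine Finset.sum_congr rfl fun i _ => ?_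
  rw [integral_mul_fderiv_eq_neg_fderiv_mul_of_integrable
      (int (cφ1 i).continuous (s1 i) (cu1 i).continuous) (int hφ.continuous hc (cu2 i))
      (int hφ.continuous hc (cu1 i).continuous)
      (fun x _ => hφ.differentiable two_ne_zero x)
      (fun x _ => (cu1 i).differentiable one_ne_zero x),
    integral_mul_fderiv_eq_neg_fderiv_mul_of_integrable
      (int (cφ2 i) (s2 i) hu.continuous) (int (cφ1 i).continuous (s1 i) (cu1 i).continuous)
      (int (cφ1 i).continuous (s1 i) hu.continuous)
      (fun x _ => (cφ1 i).differentiable one_ne_zero x)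
      (fun x _ => hu.differentiable two_ne_zero x), neg_neg]

end Laplacian

/-- Cutoff functions at scale `R` whose Laplacian is controlled by the square root of the cutoff. -/
lemma exists_cutoff : ∃ C : ℝ, ∀ R : ℝ, 1 ≤ R → ∃ φ : E → ℝ, ContDiff ℝ ∞ φ ∧
    HasCompactSupport φ ∧ (∀ x, 0 ≤ φ x) ∧ (∀ x, φ x ≤ 1) ∧ (∀ x, ‖x‖ ≤ R → φ x = 1) ∧
    (∀ x, 2 * R < ‖x‖ → φ x = 0) ∧
    ∀ x, |Laplacian.laplacian φ x| ≤ C / R ^ 2 * Real.sqrt (φ x) := by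
  let ψ : ContDiffBump (0 : E) := ⟨1, 2, one_pos, one_lt_two⟩
  have hψ : ContDiff ℝ ∞ ψ := ψ.contDiff
  have cψ1 : ∀ i, ContDiff ℝ ∞ (fun y => fderiv ℝ ψ y (stdE i)) :=
    fun i => contDiff_fderiv_apply hψ le_rfl _
  -- The cutoff will be `ψ⁴` and not `ψ`: a second derivative of `ψ⁴` is `ψ²` times the expression
  -- bounded here, and `ψ²` is the square root of the cutoff.
  have bd : ∀ i, ∃ A, ∀ x, |4 * ψ x * fderiv ℝ (fun y => fderiv ℝ ψ y (stdE i)) x (stdE i) +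
      12 * (fderiv ℝ ψ x (stdE i)) ^ 2| ≤ A := by
    intro i
    have hcont : Continuous fun x => 4 * ψ x *
        fderiv ℝ (fun y => fderiv ℝ ψ y (stdE i)) x (stdE i) + 12 * (fderiv ℝ ψ x (stdE i)) ^ 2 := by
      have h2 : ContDiff ℝ ∞ (fun y => fderiv ℝ (fun y => fderiv ℝ ψ y (stdE i)) y (stdE i)) :=
        contDiff_fderiv_apply (cψ1 i) le_rfl _
      exact ((continuous_const.mul hψ.continuous).mul h2.continuous).add
        (continuous_const.mul ((cψ1 i).continuous.pow 2))
    have hs : HasCompactSupport fun x => 4 * ψ x *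
        fderiv ℝ (fun y => fderiv ℝ ψ y (stdE i)) x (stdE i) +
          12 * (fderiv ℝ ψ x (stdE i)) ^ 2 := by
      refine HasCompactSupport.add ?_ ?_
      · exact (HasCompactSupport.mul_left (f := fun _ => (4 : ℝ)) ψ.hasCompactSupport).mul_right
      · simp only [pow_two]
        exact HasCompactSupport.mul_left (f := fun _ => (12 : ℝ))
          ((ψ.hasCompactSupport.fderiv_apply ℝ (stdE i)).mul_right)
    exact hcont.bounded_above_of_compact_support hs
  choose A hA using bd
  refine ⟨∑ i, A i, fun R hR => ⟨fun x => ψ (R⁻¹ • x) ^ 4, ?_, ?_, fun x => by positivity,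
    fun x => pow_le_one₀ ψ.nonneg ψ.le_one, ?_, ?_, ?_⟩⟩
  · exact (hψ.comp (contDiff_const_smul _)).pow 4
  · have h := ψ.hasCompactSupport.comp_smul (inv_ne_zero (by positivity : R ≠ 0))
    simp only [pow_succ _ 3]
    exact h.mul_left
  · intro x hx
    have : ψ (R⁻¹ • x) = 1 := ψ.one_of_mem_closedBall (by
      rw [mem_closedBall_zero_iff, norm_smul, norm_inv, Real.norm_of_nonneg (by positivity)]
      change R⁻¹ * ‖x‖ ≤ 1
      rw [inv_mul_le_iff₀ (by positivity)]; linarith)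
    simp only [this, one_pow]
  · intro x hx
    have : ψ (R⁻¹ • x) = 0 := ψ.zero_of_le_dist (by
      rw [dist_zero_right, norm_smul, norm_inv, Real.norm_of_nonneg (by positivity)]
      change 2 ≤ R⁻¹ * ‖x‖
      rw [le_inv_mul_iff₀ (by positivity)]; linarith)
    simp only [this]; norm_num
  · intro x
    have hφ : ContDiff ℝ ∞ (fun x => ψ (R⁻¹ • x) ^ 4) := (hψ.comp (contDiff_const_smul _)).pow 4
    have hg : ContDiff ℝ ∞ (fun x => ψ x ^ 4) := hψ.pow 4
    have e1 : ∀ i, (fun y => fderiv ℝ (fun x => ψ (R⁻¹ • x) ^ 4) y (stdE i)) =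
        fun y => R⁻¹ * fderiv ℝ (fun x => ψ x ^ 4) (R⁻¹ • y) (stdE i) := by
      intro i; funext y
      rw [fderiv_comp_smul (f := fun x => ψ x ^ 4) R⁻¹]; rfl
    have e2 : ∀ i y, fderiv ℝ (fun x => ψ x ^ 4) y (stdE i) =
        4 * ψ y ^ 3 * fderiv ℝ ψ y (stdE i) := by
      intro i y
      rw [fderiv_fun_pow 4 (hψ.differentiable (by simp) y)]
      simp
    have e3 : ∀ i y, fderiv ℝ (fun y => 4 * ψ y ^ 3 * fderiv ℝ ψ y (stdE i)) y (stdE i) =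
        ψ y ^ 2 * (4 * ψ y * fderiv ℝ (fun y => fderiv ℝ ψ y (stdE i)) y (stdE i) +
          12 * (fderiv ℝ ψ y (stdE i)) ^ 2) := by
      intro i y
      have d1 := (hψ.differentiable (by simp) y)
      have d3 : DifferentiableAt ℝ (fun y => 4 * ψ y ^ 3) y := (d1.fun_pow 3).const_mul 4
      rw [fderiv_fun_mul d3 ((cψ1 i).differentiable (by simp) y),
        fderiv_const_mul (d1.fun_pow 3), fderiv_fun_pow 3 d1]
      simp
      ring
    have e4 : ∀ i, fderiv ℝ (fun y => fderiv ℝ (fun x => ψ (R⁻¹ • x) ^ 4) y (stdE i)) x (stdE i) =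
        (R ^ 2)⁻¹ * (ψ (R⁻¹ • x) ^ 2 * (4 * ψ (R⁻¹ • x) *
          fderiv ℝ (fun y => fderiv ℝ ψ y (stdE i)) (R⁻¹ • x) (stdE i) +
          12 * (fderiv ℝ ψ (R⁻¹ • x) (stdE i)) ^ 2)) := by
      intro i
      rw [e1, ← e3]
      simp only [e2]
      have d1 := (hψ.differentiable (by simp))
      have hd : Differentiable ℝ (fun y => 4 * ψ y ^ 3 * fderiv ℝ ψ y (stdE i)) :=
        ((d1.fun_pow 3).const_mul 4).fun_mul ((cψ1 i).differentiable (by simp))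
      have e6 : ∀ h : E → ℝ, Differentiable ℝ h → fderiv ℝ (fun y => R⁻¹ * h (R⁻¹ • y)) x =
          R⁻¹ • R⁻¹ • fderiv ℝ h (R⁻¹ • x) := fun h hh => by
        have hh' : DifferentiableAt ℝ (fun y => h (R⁻¹ • y)) x :=
          (hh _).comp x (differentiableAt_id.const_smul R⁻¹)
        rw [fderiv_const_mul hh', fderiv_comp_smul]
      rw [e6 _ hd]
      simp only [_root_.smul_apply, smul_eq_mul]
      ring
    rw [laplacian_eq_sum (contDiff_infty.1 hφ 2)]
    simp only [e4]
    have e5 : Real.sqrt (ψ (R⁻¹ • x) ^ 4) = ψ (R⁻¹ • x) ^ 2 := by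
      rw [show ψ (R⁻¹ • x) ^ 4 = (ψ (R⁻¹ • x) ^ 2) ^ 2 by ring, Real.sqrt_sq (by positivity)]
    rw [e5, div_mul_eq_mul_div, Finset.sum_mul, Finset.sum_div]
    refine (Finset.abs_sum_le_sum_abs _ _).trans (Finset.sum_le_sum fun i _ => ?_)
    rw [abs_mul, abs_mul, abs_of_nonneg (by positivity : 0 ≤ (R ^ 2)⁻¹),
      abs_of_nonneg (by positivity : 0 ≤ ψ (R⁻¹ • x) ^ 2), inv_mul_eq_div, mul_comm (A i)]
    gcongr
    exact hA i _

/-- The support of `φ` times `[t/2, 2t]` is compact in the open half space, so the time derivative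
is bounded there and dominated convergence applies. -/
lemma hasDerivAt_integral_mul {u : E → ℝ → ℝ}
    (hu : ContDiffOn ℝ ∞ (fun p : E × ℝ => u p.1 p.2) (univ ×ˢ Ioi 0)) {φ : E → ℝ}
    (hφ : Continuous φ) (hc : HasCompactSupport φ) {t : ℝ} (ht : 0 < t) :
    HasDerivAt (fun s => ∫ x, φ x * u x s) (∫ x, φ x * deriv (fun s => u x s) t) t := by
  have hop : IsOpen ((univ : Set E) ×ˢ Ioi (0 : ℝ)) := isOpen_univ.prod isOpen_Ioi
  have hdiff : ∀ x, ∀ s : ℝ, 0 < s →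
      HasDerivAt (fun r => u x r) (fderiv ℝ (fun p : E × ℝ => u p.1 p.2) (x, s) (0, 1)) s := by
    intro x s hs
    have h1 : HasFDerivAt (fun p : E × ℝ => u p.1 p.2) _ (x, s) :=
      ((hu.contDiffAt (hop.mem_nhds (mk_mem_prod (mem_univ x) (mem_Ioi.2 hs)))).differentiableAt (by simp)).hasFDerivAt
    exact h1.comp_hasDerivAt s ((hasDerivAt_const s x).prodMk (hasDerivAt_id s))
  have hcf : ContinuousOn (fun p : E × ℝ =>
      fderiv ℝ (fun p : E × ℝ => u p.1 p.2) p (0, 1)) (univ ×ˢ Ioi 0) :=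
    (hu.continuousOn_fderiv_of_isOpen hop (by simp)).clm_apply continuousOn_const
  have hmaps : ∀ s : ℝ, 0 < s → MapsTo (fun x : E => (x, s)) univ (univ ×ˢ Ioi (0 : ℝ)) :=
    fun s hs x _ => ⟨mem_univ _, hs⟩
  have hcu : ∀ s : ℝ, 0 < s → Continuous (fun x => u x s) := fun s hs =>
    continuousOn_univ.1 (hu.continuousOn.comp (f := fun x : E => (x, s)) (by fun_prop)
      (hmaps s hs))
  have hcd : ∀ s : ℝ, 0 < s → Continuous (fun x =>
      fderiv ℝ (fun p : E × ℝ => u p.1 p.2) (x, s) (0, 1)) := fun s hs =>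
    continuousOn_univ.1 (hcf.comp (f := fun x : E => (x, s)) (by fun_prop)
      (hmaps s hs))
  obtain ⟨M, hM⟩ := (hc.isCompact.prod (isCompact_Icc (a := t / 2) (b := 2 * t))).exists_bound_of_continuousOn
    (hcf.mono (prod_mono (subset_univ _) fun s hs => (half_pos ht).trans_le hs.1))
  have key := hasDerivAt_integral_of_dominated_loc_of_deriv_le (μ := (volume : Measure E))
    (F := fun s x => φ x * u x s)
    (F' := fun s x => φ x * fderiv ℝ (fun p : E × ℝ => u p.1 p.2) (x, s) (0, 1))
    (x₀ := t) (s := Icc (t / 2) (2 * t)) (bound := fun x => |φ x| * M)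
    (Icc_mem_nhds (by linarith) (by linarith))
    ((lt_mem_nhds ht).mono fun s hs => (hφ.mul (hcu s hs)).aestronglyMeasurable)
    ((hφ.mul (hcu t ht)).integrable_of_hasCompactSupport hc.mul_right)
    (hφ.mul (hcd t ht)).aestronglyMeasurable
    (Eventually.of_forall fun x s hs => by
      rw [norm_mul, Real.norm_eq_abs]
      by_cases hx : x ∈ tsupport φ
      · gcongr
        exact hM (x, s) ⟨hx, hs⟩
      · simp [image_eq_zero_of_notMem_tsupport hx])
    (((hφ.abs.integrable_of_hasCompactSupport hc.abs)).mul_const M)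
    (Eventually.of_forall fun x s hs =>
      (hdiff x s ((half_pos ht).trans_le hs.1)).const_mul (φ x))
  have e : (fun x => φ x * deriv (fun s => u x s) t) =
      fun x => φ x * fderiv ℝ (fun p : E × ℝ => u p.1 p.2) (x, t) (0, 1) := by
    funext x; rw [(hdiff x t ht).deriv]
  rw [e]
  exact key.2

end QTensor

end

/-! ### Uniqueness by a localised energy estimate with absorption. -/

noncomputable section

namespace QTensor

section Uniqueness

variable {a b c : ℝ} {Q₀ : E → Sym0} {P Q : E → ℝ → Sym0}

lemma contDiff_slice {F : Type*} [NormedAddCommGroup F] [NormedSpace ℝ F] {u : E → ℝ → F}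
    (hu : ContDiffOn ℝ ∞ (fun p : E × ℝ => u p.1 p.2) (univ ×ˢ Ioi 0)) {t : ℝ} (ht : 0 < t) :
    ContDiff ℝ ∞ (fun x => u x t) :=
  contDiffOn_univ.1 (hu.comp (f := fun x : E => (x, t)) (by fun_prop)
    fun x _ => ⟨mem_univ x, mem_Ioi.2 ht⟩)

lemma differentiableAt_slice {F : Type*} [NormedAddCommGroup F] [NormedSpace ℝ F] {u : E → ℝ → F}
    (hu : ContDiffOn ℝ ∞ (fun p : E × ℝ => u p.1 p.2) (univ ×ˢ Ioi 0)) (x : E) {t : ℝ}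
    (ht : 0 < t) : DifferentiableAt ℝ (fun s => u x s) t := by
  have h : ContDiffAt ℝ ∞ (fun p : E × ℝ => u p.1 p.2) (x, t) :=
    hu.contDiffAt ((isOpen_univ.prod isOpen_Ioi).mem_nhds
      (mk_mem_prod (mem_univ x) (mem_Ioi.2 ht)))
  exact (h.differentiableAt (by simp)).comp t
    ((differentiableAt_const x).prodMk differentiableAt_id)

/-- The squared distance of two solutions satisfies a heat inequality with quadratic absorption. -/
lemma deriv_norm_sub_sq_le (ha : 0 < a) (hb : 0 < b) (hc : 0 < c) (hP : IsSolution a b c Q₀ P)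
    (hQ : IsSolution a b c Q₀ Q) (x : E) {t : ℝ} (ht : 0 < t) :
    deriv (fun s => ‖Q x s - P x s‖ ^ 2) t ≤
      Laplacian.laplacian (fun y => ‖Q y t - P y t‖ ^ 2) x +
        2 * (b ^ 2 * ‖devBilin‖ ^ 2 / c) * ‖Q x t - P x t‖ ^ 2 -
          c / 2 * (‖Q x t - P x t‖ ^ 2) ^ 2 := by
  have hd := ((differentiableAt_slice hQ.smooth x ht).sub
    (differentiableAt_slice hP.smooth x ht)).hasDerivAt
  have h1 := hd.norm_sq.deriv
  have cQ := contDiff_infty.1 (contDiff_slice hQ.smooth ht) 2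
  have cP := contDiff_infty.1 (contDiff_slice hP.smooth ht) 2
  have h2 := two_mul_inner_laplacian_le (cQ.sub cP) x
  have h3 : Laplacian.laplacian ((fun y => Q y t) - fun y => P y t) x =
      Laplacian.laplacian (fun y => Q y t) x - Laplacian.laplacian (fun y => P y t) x :=
    cQ.contDiffAt.laplacian_sub cP.contDiffAt
  change 2 * inner ℝ (Q x t - P x t) (Laplacian.laplacian ((fun y => Q y t) - fun y => P y t) x) ≤
    Laplacian.laplacian (fun y => ‖Q y t - P y t‖ ^ 2) x at h2
  have h4 := inner_reaction_sub_le hb hc (P x t) (Q x t)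
  change deriv (fun s => ‖Q x s - P x s‖ ^ 2) t = _ at h1
  have h5 : deriv ((fun s => Q x s) - fun s => P x s) t =
      (Laplacian.laplacian (fun y => Q y t) x - Laplacian.laplacian (fun y => P y t) x) -
        a • (Q x t - P x t) +
      ((b • devSq (Q x t) - (c * ‖Q x t‖ ^ 2) • Q x t) -
        (b • devSq (P x t) - (c * ‖P x t‖ ^ 2) • P x t)) := by
    rw [deriv_sub (differentiableAt_slice hQ.smooth x ht) (differentiableAt_slice hP.smooth x ht),
      hQ.equation x t ht, hP.equation x t ht, Sym0.trace_mul_self, Sym0.trace_mul_self]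
    module
  rw [h1, h5]
  rw [h3] at h2
  simp only [Pi.sub_apply, inner_add_right, inner_sub_right (Q x t - P x t) (_ - _) (a • _),
    inner_smul_right, real_inner_self_eq_norm_sq]
  nlinarith [mul_nonneg ha.le (sq_nonneg ‖Q x t - P x t‖)]

lemma contDiffOn_norm_sub_sq (hP : IsSolution a b c Q₀ P) (hQ : IsSolution a b c Q₀ Q) :
    ContDiffOn ℝ ∞ (fun p : E × ℝ => ‖Q p.1 p.2 - P p.1 p.2‖ ^ 2) (univ ×ˢ Ioi 0) :=
  (hQ.smooth.sub hP.smooth).norm_sq ℝ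

/-- Local `L²` estimate for the difference of two solutions; the constant does not see the size
of the solutions. -/
lemma exists_cutoff_estimate (ha : 0 < a) (hb : 0 < b) (hc : 0 < c) (hP : IsSolution a b c Q₀ P)
    (hQ : IsSolution a b c Q₀ Q) : ∃ K D : ℝ, 0 ≤ D ∧ ∀ R : ℝ, 1 ≤ R → ∃ φ : E → ℝ,
      Continuous φ ∧ HasCompactSupport φ ∧ (∀ x, 0 ≤ φ x) ∧ (∀ x, φ x ≤ 1) ∧
      (∀ x, ‖x‖ ≤ R → φ x = 1) ∧
      ∀ s t : ℝ, 0 < s → s ≤ t → ∫ x, φ x * ‖Q x t - P x t‖ ^ 2 ≤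
        Real.exp (K * (t - s)) * ((∫ x, φ x * ‖Q x s - P x s‖ ^ 2) + D / R * (t - s)) := by
  obtain ⟨C, hC⟩ := exists_cutoff
  set K := 2 * (b ^ 2 * ‖devBilin‖ ^ 2 / c) with hK
  have hK0 : 0 ≤ K := by positivity
  -- The remainder of Young's inequality is `C²/(2c R⁴)` on a ball of radius `2R`, whose volume is
  -- `8 R³` times that of the unit ball; the product is `D / R`.
  set D := C ^ 2 / (2 * c) * (8 * volume.real (Metric.ball (0 : E) 1)) with hD
  refine ⟨K, D, by positivity, fun R hR => ?_⟩
  obtain ⟨φ, hφ, hφc, hφ0, hφ1, hφR, hφR2, hΔ⟩ := hC R hR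
  refine ⟨φ, hφ.continuous, hφc, hφ0, hφ1, hφR, fun s t hs hst => ?_⟩
  have hu := contDiffOn_norm_sub_sq hP hQ
  set u : E → ℝ → ℝ := fun x t => ‖Q x t - P x t‖ ^ 2 with hudef
  set m : ℝ → ℝ := fun t => ∫ x, φ x * u x t with hm
  have hder : ∀ r : ℝ, 0 < r → HasDerivAt m (∫ x, φ x * deriv (fun s => u x s) r) r :=
    fun r hr => hasDerivAt_integral_mul hu hφ.continuous hφc hr
  have hbound : ∀ r : ℝ, 0 < r → ∫ x, φ x * deriv (fun s => u x s) r ≤ K * m r + D / R := by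
    intro r hr
    have hur := contDiff_slice (u := u) hu hr
    have hint : ∀ {f : E → ℝ}, Continuous f → Integrable (fun x => φ x * f x) := fun hf =>
      (hφ.continuous.mul hf).integrable_of_hasCompactSupport hφc.mul_right
    have hu2 := contDiff_infty.1 hur 2
    have cΔ : ∀ {f : E → ℝ}, ContDiff ℝ ∞ f → Continuous (Laplacian.laplacian f) := by
      intro f hf
      rw [show Laplacian.laplacian f = _ from
        funext fun x => laplacian_eq_sum (contDiff_infty.1 hf 2) x]
      refine continuous_finsetSum _ fun i _ => ?_
      exact (contDiff_fderiv_apply (contDiff_fderiv_apply hf (m := ∞) le_rfl _)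
        (m := ∞) le_rfl _).continuous
    have cder : Continuous fun x => deriv (fun s => u x s) r := by
      have hop : IsOpen ((univ : Set E) ×ˢ Ioi (0 : ℝ)) := isOpen_univ.prod isOpen_Ioi
      have e : (fun x => deriv (fun s => u x s) r) = fun x =>
          fderiv ℝ (fun p : E × ℝ => u p.1 p.2) (x, r) (0, 1) := by
        funext x
        have h1 : HasFDerivAt (fun p : E × ℝ => u p.1 p.2) _ (x, r) :=
          ((hu.contDiffAt (hop.mem_nhds (mk_mem_prod (mem_univ x)
            (mem_Ioi.2 hr)))).differentiableAt (by simp)).hasFDerivAt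
        exact (h1.comp_hasDerivAt r ((hasDerivAt_const r x).prodMk (hasDerivAt_id r))).deriv
      rw [e]
      exact continuousOn_univ.1 (((hu.continuousOn_fderiv_of_isOpen hop (by simp)).clm_apply
        continuousOn_const).comp (f := fun x : E => (x, r)) (by fun_prop)
        fun x _ => ⟨mem_univ x, mem_Ioi.2 hr⟩)
    have hball : Integrable
        ((Metric.closedBall (0 : E) (2 * R)).indicator fun _ => C ^ 2 / (2 * c) / R ^ 4) :=
      (integrable_indicator_iff Metric.isClosed_closedBall.measurableSet).2
        (integrableOn_const (measure_closedBall_lt_top.ne))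
    have hΔint : Integrable (fun x => Laplacian.laplacian φ x * u x r) := by
      refine ((cΔ hφ).mul hur.continuous).integrable_of_hasCompactSupport ?_
      refine HasCompactSupport.mul_right (hφc.mono' fun x hx => ?_)
      by_contra hx'
      refine hx ?_
      have h0 := hΔ x
      rw [image_eq_zero_of_notMem_tsupport hx', Real.sqrt_zero, mul_zero] at h0
      exact abs_nonpos_iff.1 h0
    have hKint : Integrable (fun x => K * (φ x * u x r)) := (hint hur.continuous).const_mul K
    have hqint : Integrable (fun x => c / 2 * (φ x * u x r ^ 2)) :=
      (hint (hur.continuous.pow 2)).const_mul _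
    have hsub : Integrable (fun x => K * (φ x * u x r) - c / 2 * (φ x * u x r ^ 2)) :=
      hKint.sub hqint
    calc ∫ x, φ x * deriv (fun s => u x s) r
        ≤ ∫ x, (φ x * Laplacian.laplacian (fun y => u y r) x +
            (K * (φ x * u x r) - c / 2 * (φ x * u x r ^ 2))) := by
          refine integral_mono (hint cder) ((hint (cΔ hur)).add hsub) fun x => ?_
          have h1 := mul_le_mul_of_nonneg_left (deriv_norm_sub_sq_le ha hb hc hP hQ x hr) (hφ0 x)
          refine h1.trans (le_of_eq ?_)
          simp only [hudef, hK]; ring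
      _ = (∫ x, Laplacian.laplacian φ x * u x r) +
            ∫ x, (K * (φ x * u x r) - c / 2 * (φ x * u x r ^ 2)) := by
          rw [integral_add (hint (cΔ hur)) hsub,
            integral_mul_laplacian (contDiff_infty.1 hφ 2) hφc hu2]
      _ = ∫ x, (Laplacian.laplacian φ x * u x r +
            (K * (φ x * u x r) - c / 2 * (φ x * u x r ^ 2))) :=
          (integral_add hΔint hsub).symm
      _ ≤ ∫ x, (K * (φ x * u x r) +
            (Metric.closedBall (0 : E) (2 * R)).indicator (fun _ => C ^ 2 / (2 * c) / R ^ 4) x) := by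
          refine integral_mono (hΔint.add hsub) (hKint.add hball) fun x => ?_
          have hu0 : 0 ≤ u x r := sq_nonneg _
          have h1 : Laplacian.laplacian φ x * u x r ≤ C / R ^ 2 * Real.sqrt (φ x) * u x r :=
            mul_le_mul_of_nonneg_right ((le_abs_self _).trans (hΔ x)) hu0
          by_cases hx : x ∈ Metric.closedBall (0 : E) (2 * R)
          · rw [indicator_of_mem hx]
            -- Completing the square: the cutoff error is linear in `√φ · u`, while the absorption
            -- term is `(c/2) (√φ · u)²`.
            have h2 : C / R ^ 2 * Real.sqrt (φ x) * u x r ≤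
                c / 2 * (φ x * u x r ^ 2) + C ^ 2 / (2 * c) / R ^ 4 := by
              have h3 : c / 2 * (Real.sqrt (φ x) ^ 2 * u x r ^ 2) + C ^ 2 / (2 * c) / R ^ 4 -
                  C / R ^ 2 * Real.sqrt (φ x) * u x r =
                  1 / (2 * c) * (c * Real.sqrt (φ x) * u x r - C / R ^ 2) ^ 2 := by
                field_simp; ring
              have h4 : 0 ≤ 1 / (2 * c) * (c * Real.sqrt (φ x) * u x r - C / R ^ 2) ^ 2 := by
                positivity
              rw [Real.sq_sqrt (hφ0 x)] at h3
              linarith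
            linarith
          · rw [indicator_of_notMem hx]
            have h0 : φ x = 0 := hφR2 x (by simpa using hx)
            rw [h0] at h1 ⊢
            simp at h1 ⊢
            exact h1
      _ = K * m r + D / R := by
          rw [integral_add hKint hball, integral_const_mul, integral_indicator
            Metric.isClosed_closedBall.measurableSet, setIntegral_const, smul_eq_mul]
          congr 1
          rw [Measure.real, Measure.addHaar_closedBall _ _ (by positivity), ENNReal.toReal_mul,
            ENNReal.toReal_ofReal (by positivity), hD, finrank_euclideanSpace_fin, Measure.real]
          field_simp
          ring
  -- Gronwall's argument: the differential inequality `m' ≤ K m + D/R` makes this quantity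
  -- nonincreasing, with `e^{-K(r-s)} ≤ 1` used on the constant term.
  have hanti : AntitoneOn (fun r => Real.exp (-K * (r - s)) * m r - D / R * (r - s)) (Icc s t) := by
    have hda : ∀ r ∈ Icc s t, HasDerivAt
        (fun r => Real.exp (-K * (r - s)) * m r - D / R * (r - s))
        ((Real.exp (-K * (r - s)) * (-K * 1)) * m r + Real.exp (-K * (r - s)) *
          (∫ x, φ x * deriv (fun s => u x s) r) - D / R * 1) r := by
      intro r hr
      have hlin : HasDerivAt (fun r => r - s) 1 r := (hasDerivAt_id r).sub_const s
      exact (((hlin.const_mul (-K)).exp).mul (hder r (hs.trans_le hr.1))).sub (hlin.const_mul _)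
    refine antitoneOn_of_deriv_nonpos (convex_Icc s t)
      (fun r hr => (hda r hr).continuousAt.continuousWithinAt)
      (fun r hr => (hda r (interior_subset hr)).differentiableAt.differentiableWithinAt)
      fun r hr => ?_
    have hr' := interior_subset hr
    rw [(hda r hr').deriv]
    have h1 := hbound r (hs.trans_le hr'.1)
    have h2 : Real.exp (-K * (r - s)) ≤ 1 :=
      Real.exp_le_one_iff.2 (by nlinarith [sub_nonneg.2 hr'.1])
    have h3 : 0 ≤ D / R := by positivity
    nlinarith [Real.exp_pos (-K * (r - s)), mul_le_mul_of_nonneg_left h1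
      (Real.exp_pos (-K * (r - s))).le, mul_le_mul_of_nonneg_right h2 h3]
  have h := hanti (left_mem_Icc.2 hst) (right_mem_Icc.2 hst) hst
  simp only [sub_self, mul_zero, Real.exp_zero, one_mul, sub_zero] at h
  have h1 : m t = Real.exp (K * (t - s)) * (Real.exp (-K * (t - s)) * m t) := by
    rw [← mul_assoc, ← Real.exp_add]; simp
  change m t ≤ Real.exp (K * (t - s)) * (m s + D / R * (t - s))
  rw [h1]
  gcongr
  linarith

/-- Triangle inequality through the common datum in `L²`; this is the only use of the initial
condition in the uniqueness proof. -/
lemma tendsto_integral_norm_sub_sq (h₀ : AEStronglyMeasurable Q₀ (volume : Measure E))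
    (hP : IsSolution a b c Q₀ P) (hQ : IsSolution a b c Q₀ Q) :
    Tendsto (fun s : ℝ => ∫ x, ‖Q x s - P x s‖ ^ 2) (𝓝[>] 0) (𝓝 0) := by
  have h1 : Tendsto (fun s : ℝ => eLpNorm (fun x => Q x s - Q₀ x) 2 (volume : Measure E) +
      eLpNorm (fun x => P x s - Q₀ x) 2 (volume : Measure E)) (𝓝[>] 0) (𝓝 0) := by
    simpa using hQ.initial_two.add hP.initial_two
  have h2 : Tendsto (fun s : ℝ => eLpNorm (fun x => Q x s - P x s) 2 (volume : Measure E))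
      (𝓝[>] 0) (𝓝 0) := by
    refine tendsto_of_tendsto_of_tendsto_of_le_of_le' tendsto_const_nhds h1
      (Eventually.of_forall fun _ => zero_le) ?_
    filter_upwards [self_mem_nhdsWithin] with s hs
    have e : (fun x => Q x s - P x s) = (fun x => Q x s - Q₀ x) - fun x => P x s - Q₀ x := by
      funext x; simp
    rw [e]
    exact eLpNorm_sub_le ((hQ.memLp_two s hs).1.sub h₀) ((hP.memLp_two s hs).1.sub h₀)
      one_le_two
  have h3 := (((ENNReal.tendsto_toReal ENNReal.zero_ne_top).comp h2).pow 2)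
  simp only [ENNReal.toReal_zero, ne_eq, OfNat.ofNat_ne_zero, not_false_eq_true, zero_pow] at h3
  refine h3.congr' ?_
  filter_upwards [self_mem_nhdsWithin] with s hs
  have hm : MemLp (fun x => Q x s - P x s) 2 (volume : Measure E) :=
    (hQ.memLp_two s hs).sub (hP.memLp_two s hs)
  have h4 : 0 ≤ ∫ x, ‖Q x s - P x s‖ ^ 2 := integral_nonneg fun x => sq_nonneg _
  rw [Function.comp_apply, hm.eLpNorm_eq_integral_rpow_norm two_ne_zero ENNReal.ofNat_ne_top,
    ENNReal.toReal_ofReal (by positivity)]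
  simp only [ENNReal.toReal_ofNat, Real.rpow_ofNat]
  rw [← Real.rpow_natCast, ← Real.rpow_mul h4]
  norm_num

/-- Uniqueness of solutions. -/
lemma IsSolution.eq (ha : 0 < a) (hb : 0 < b) (hc : 0 < c)
    (h₀ : AEStronglyMeasurable Q₀ (volume : Measure E)) (hP : IsSolution a b c Q₀ P)
    (hQ : IsSolution a b c Q₀ Q) (x : E) {t : ℝ} (ht : 0 < t) : Q x t = P x t := by
  obtain ⟨K, D, hD, H⟩ := exists_cutoff_estimate ha hb hc hP hQ
  have hu : ∀ s : ℝ, 0 < s → Continuous fun x => ‖Q x s - P x s‖ ^ 2 := fun s hs =>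
    (contDiff_slice (u := fun x t => ‖Q x t - P x t‖ ^ 2) (contDiffOn_norm_sub_sq hP hQ)
      hs).continuous
  have hint : ∀ s : ℝ, 0 < s → Integrable fun x => ‖Q x s - P x s‖ ^ 2 := fun s hs =>
    ((hQ.memLp_two s hs).sub (hP.memLp_two s hs)).integrable_norm_pow two_ne_zero
  -- A fixed bump at `x` below all cutoffs of large radius: the left side of the estimate then does
  -- not depend on `R`.
  let χ : ContDiffBump x := ⟨1 / 2, 1, by norm_num, by norm_num⟩
  have hR : ∀ R : ℝ, ‖x‖ + 1 ≤ R →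
      ∫ y, χ y * ‖Q y t - P y t‖ ^ 2 ≤ Real.exp (K * t) * (D / R * t) := by
    intro R hxR
    obtain ⟨φ, hφ, hφc, hφ0, hφ1, hφR, h⟩ := H R (by linarith [norm_nonneg x])
    have hφint : ∀ s : ℝ, 0 < s → Integrable fun x => φ x * ‖Q x s - P x s‖ ^ 2 := fun s hs =>
      (hφ.mul (hu s hs)).integrable_of_hasCompactSupport hφc.mul_right
    have h1 : ∫ y, φ y * ‖Q y t - P y t‖ ^ 2 ≤ Real.exp (K * t) * (D / R * t) := by
      have hl : Tendsto (fun s : ℝ => Real.exp (K * (t - s)) *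
          ((∫ x, ‖Q x s - P x s‖ ^ 2) + D / R * (t - s))) (𝓝[>] 0)
          (𝓝 (Real.exp (K * (t - 0)) * (0 + D / R * (t - 0)))) := by
        have hs : Tendsto (fun s : ℝ => t - s) (𝓝[>] 0) (𝓝 (t - 0)) :=
          (tendsto_const_nhds.sub tendsto_id).mono_left nhdsWithin_le_nhds
        exact ((Real.continuous_exp.tendsto _).comp (hs.const_mul K)).mul
          ((tendsto_integral_norm_sub_sq h₀ hP hQ).add (hs.const_mul _))
      rw [sub_zero, zero_add] at hl
      refine ge_of_tendsto hl ?_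
      filter_upwards [Ioo_mem_nhdsGT ht] with s hs
      refine (h s t hs.1 hs.2.le).trans ?_
      refine mul_le_mul_of_nonneg_left (add_le_add ?_ le_rfl) (Real.exp_pos _).le
      refine integral_mono (hφint s hs.1) (hint s hs.1) fun y => ?_
      exact mul_le_of_le_one_left (sq_nonneg _) (hφ1 y)
    refine le_trans (integral_mono ((χ.continuous.mul (hu t
      ht)).integrable_of_hasCompactSupport χ.hasCompactSupport.mul_right) (hφint t ht)
      fun y => ?_) h1
    by_cases hy : ‖y‖ ≤ R
    · simp only [hφR y hy, one_mul]
      exact mul_le_of_le_one_left (sq_nonneg _) χ.le_one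
    · have : χ y = 0 := χ.zero_of_le_dist (by
        change (1 : ℝ) ≤ dist y x
        rw [dist_eq_norm]
        have := norm_sub_norm_le y x
        push Not at hy
        linarith)
      simp only [this, zero_mul]
      exact mul_nonneg (hφ0 y) (sq_nonneg _)
  -- Letting `R → ∞` removes `D / R`. A positive value of the continuous integrand at `x` would
  -- contradict this.
  have h0 : ∫ y, χ y * ‖Q y t - P y t‖ ^ 2 ≤ 0 := by
    have hl : Tendsto (fun R : ℝ => Real.exp (K * t) * (D / R * t)) atTop
        (𝓝 (Real.exp (K * t) * (0 * t))) :=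
      ((tendsto_const_nhds.div_atTop tendsto_id).mul_const t).const_mul _
    rw [zero_mul, mul_zero] at hl
    exact ge_of_tendsto hl ((eventually_ge_atTop _).mono hR)
  by_contra hne
  have hpos := Continuous.integral_pos_of_hasCompactSupport_nonneg_nonzero (μ := volume) (x := x)
    (χ.continuous.mul (hu t ht)) χ.hasCompactSupport.mul_right
    (fun y => mul_nonneg χ.nonneg (sq_nonneg _)) (by
      have hχ : χ x = 1 := χ.one_of_mem_closedBall (Metric.mem_closedBall_self χ.rIn_pos.le)
      simp only [Pi.mul_apply, hχ, one_mul]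
      exact pow_ne_zero _ (norm_ne_zero_iff.2 (sub_ne_zero.2 hne)))
  exact absurd h0 (not_le.2 hpos)

end Uniqueness

end QTensor

end

/-! ### The heat kernel: semigroup property, Gaussian tails, second moments. -/

noncomputable section

namespace QTensor

section HeatKernel

variable {F : Type*} [NormedAddCommGroup F] [NormedSpace ℝ F]

/-- The heat kernel `(4πr)^{-3/2} exp(-|x|²/(4r))`. -/
def heatKernel (r : ℝ) (x : E) : ℝ :=
  Real.exp (-‖x‖ ^ 2 / (4 * r)) / (4 * Real.pi * r) ^ (3 / 2 : ℝ)

lemma heatKernelShifted_eq (x : E) (t : ℝ) : heatKernelShifted x t = heatKernel (t + 1) x := rfl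

lemma heatKernel_nonneg {r : ℝ} (hr : 0 ≤ r) (x : E) : 0 ≤ heatKernel r x :=
  div_nonneg (Real.exp_pos _).le (by positivity)

lemma heatKernel_neg (r : ℝ) (x : E) : heatKernel r (-x) = heatKernel r x := by
  simp [heatKernel]

lemma continuous_heatKernel (r : ℝ) : Continuous (heatKernel r) := by
  unfold heatKernel; fun_prop

lemma heatKernel_smul {r : ℝ} (hr : 0 < r) (w : E) :
    heatKernel r (Real.sqrt r • w) = (Real.sqrt r ^ 3)⁻¹ * heatKernel 1 w := by
  have h1 : (r : ℝ) ^ (3 / 2 : ℝ) = Real.sqrt r ^ 3 := by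
    rw [Real.sqrt_eq_rpow, ← Real.rpow_natCast, ← Real.rpow_mul hr.le]; norm_num
  rw [heatKernel, heatKernel, norm_smul, mul_pow, Real.norm_of_nonneg (Real.sqrt_nonneg _),
    Real.sq_sqrt hr.le, Real.mul_rpow (by positivity) hr.le, h1]
  have h2 : -(r * ‖w‖ ^ 2) / (4 * r) = -‖w‖ ^ 2 / (4 * 1) := by field_simp
  rw [h2, mul_one]
  field_simp

/-- The known value of the integral is positive, whereas the integral of a non-integrable function
is `0` by convention. -/
lemma integrable_exp_neg_mul_sq {b : ℝ} (hb : 0 < b) :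
    Integrable fun w : E => Real.exp (-b * ‖w‖ ^ 2) := by
  by_contra h
  have h1 := GaussianFourier.integral_rexp_neg_mul_sq_norm (V := E) hb
  rw [integral_undef h] at h1
  have : 0 < (Real.pi / b) ^ (Module.finrank ℝ E / 2 : ℝ) := by positivity
  exact this.ne h1

lemma heatKernel_eq {r : ℝ} (x : E) :
    heatKernel r x = ((4 * Real.pi * r) ^ (3 / 2 : ℝ))⁻¹ * Real.exp (-(1 / (4 * r)) * ‖x‖ ^ 2) := by
  rw [heatKernel, div_eq_inv_mul]; congr 2; ring

lemma integrable_heatKernel {r : ℝ} (hr : 0 < r) : Integrable (heatKernel r) := by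
  rw [funext heatKernel_eq]
  exact (integrable_exp_neg_mul_sq (by positivity)).const_mul _

lemma integral_heatKernel {r : ℝ} (hr : 0 < r) : ∫ x, heatKernel r x = 1 := by
  simp_rw [heatKernel_eq, integral_const_mul]
  rw [GaussianFourier.integral_rexp_neg_mul_sq_norm (by positivity), finrank_euclideanSpace_fin]
  have : Real.pi / (1 / (4 * r)) = 4 * Real.pi * r := by field_simp
  rw [this]
  exact inv_mul_cancel₀ (by positivity)

/-- The heat semigroup, in the form in which the kernel does not depend on the time. -/
def heatFlow (r : ℝ) (g : E → F) (x : E) : F := ∫ w, heatKernel 1 w • g (x - Real.sqrt r • w)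

lemma integral_comp_sqrt_smul {r : ℝ} (hr : 0 < r) (h : E → F) :
    ∫ w, h (Real.sqrt r • w) = (Real.sqrt r ^ 3)⁻¹ • ∫ z, h z := by
  rw [Measure.integral_comp_smul, finrank_euclideanSpace_fin, abs_of_nonneg (by positivity)]

lemma heatFlow_eq {r : ℝ} (hr : 0 < r) (g : E → F) (x : E) :
    heatFlow r g x = ∫ y, heatKernel r (x - y) • g y := by
  have h1 : heatFlow r g x =
      ∫ w, (fun z => (Real.sqrt r ^ 3 * heatKernel r z) • g (x - z)) (Real.sqrt r • w) := by
    refine integral_congr_ae (Eventually.of_forall fun w => ?_)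
    simp only [heatKernel_smul hr]
    have : Real.sqrt r ^ 3 ≠ 0 := by positivity
    rw [mul_inv_cancel_left₀ this]
  rw [h1, integral_comp_sqrt_smul hr
    (fun z => (Real.sqrt r ^ 3 * heatKernel r z) • g (x - z))]
  simp_rw [mul_smul, integral_smul]
  rw [inv_smul_smul₀ (by positivity)]
  rw [← integral_sub_left_eq_self (fun z => heatKernel r z • g (x - z)) volume x]
  simp

/-- The Chapman–Kolmogorov identity. -/
lemma integral_heatKernel_mul {h t : ℝ} (hh : 0 < h) (ht : 0 < t) (x : E) :
    ∫ y, heatKernel h (x - y) * heatKernel t y = heatKernel (h + t) x := by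
  -- Completing the square in `y`: the product is a Gaussian in `x` times a normalised Gaussian in
  -- `y` centred at `t/(h+t) · x`, which integrates to one.
  have key : ∀ y : E, heatKernel h (x - y) * heatKernel t y =
      heatKernel (h + t) x * heatKernel (h * t / (h + t)) (y - (t / (h + t)) • x) := by
    intro y
    have e1 : -‖x - y‖ ^ 2 / (4 * h) + -‖y‖ ^ 2 / (4 * t) = -‖x‖ ^ 2 / (4 * (h + t)) +
        -‖y - (t / (h + t)) • x‖ ^ 2 / (4 * (h * t / (h + t))) := by
      rw [norm_sub_sq_real, norm_sub_sq_real, inner_smul_right, norm_smul, mul_pow,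
        Real.norm_of_nonneg (by positivity), real_inner_comm x y]
      field_simp
      ring
    have e2 : (4 * Real.pi * h) ^ (3 / 2 : ℝ) * (4 * Real.pi * t) ^ (3 / 2 : ℝ) =
        (4 * Real.pi * (h + t)) ^ (3 / 2 : ℝ) *
          (4 * Real.pi * (h * t / (h + t))) ^ (3 / 2 : ℝ) := by
      rw [← Real.mul_rpow (by positivity) (by positivity),
        ← Real.mul_rpow (by positivity) (by positivity)]
      congr 1
      field_simp
    simp only [heatKernel]
    rw [div_mul_div_comm, div_mul_div_comm, ← Real.exp_add, ← Real.exp_add, e1, e2]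
  simp_rw [key, integral_const_mul]
  rw [integral_sub_right_eq_self (fun y => heatKernel (h * t / (h + t)) y),
    integral_heatKernel (by positivity), mul_one]

lemma norm_heatFlow_le {g : E → F} {M : ℝ} (hM : ∀ x, ‖g x‖ ≤ M) (r : ℝ) (x : E) :
    ‖heatFlow r g x‖ ≤ M := by
  calc ‖heatFlow r g x‖ ≤ ∫ w, heatKernel 1 w * M := by
        refine norm_integral_le_of_norm_le ((integrable_heatKernel one_pos).mul_const M)
          (Eventually.of_forall fun w => ?_)
        rw [norm_smul, Real.norm_of_nonneg (heatKernel_nonneg zero_le_one _)]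
        exact mul_le_mul_of_nonneg_left (hM _) (heatKernel_nonneg zero_le_one _)
    _ = M := by rw [integral_mul_const, integral_heatKernel one_pos, one_mul]

lemma heatFlow_heatFlow [CompleteSpace F] {h t : ℝ} (hh : 0 < h) (ht : 0 < t) {g : E → F}
    (hg : AEStronglyMeasurable g (volume : Measure E)) {M : ℝ} (hM : ∀ᵐ x, ‖g x‖ ≤ M) (x : E) :
    heatFlow h (heatFlow t g) x = heatFlow (h + t) g x := by
  rw [heatFlow_eq hh, heatFlow_eq (add_pos hh ht)]
  simp_rw [heatFlow_eq ht, ← integral_smul, smul_smul]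
  have hint : Integrable (fun p : E × E =>
      (heatKernel h (x - p.2) * heatKernel t (p.1 - p.2))) (volume.prod volume) :=
    ((integrable_heatKernel hh).comp_sub_left x).convolution_integrand
      (ContinuousLinearMap.mul ℝ ℝ) (integrable_heatKernel ht)
  have hint2 : Integrable (fun p : E × E =>
      (heatKernel h (x - p.1) * heatKernel t (p.1 - p.2)) • g p.2) (volume.prod volume) := by
    have h1 : Integrable (fun p : E × E =>
        (heatKernel h (x - p.1) * heatKernel t (p.1 - p.2))) (volume.prod volume) := by
      refine hint.swap.congr (Eventually.of_forall fun p => ?_)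
      simp only [Function.comp_apply, Prod.fst_swap, Prod.snd_swap]
      rw [← heatKernel_neg t, neg_sub]
    refine (h1.mul_const M).mono' (h1.1.smul hg.comp_snd) ?_
    have hae : ∀ᵐ p : E × E ∂(volume.prod volume), ‖g p.2‖ ≤ M :=
      Measure.quasiMeasurePreserving_snd.ae hM
    filter_upwards [hae] with p hp
    rw [norm_smul, Real.norm_of_nonneg (mul_nonneg (heatKernel_nonneg hh.le _)
      (heatKernel_nonneg ht.le _))]
    exact mul_le_mul_of_nonneg_left hp (mul_nonneg (heatKernel_nonneg hh.le _)
      (heatKernel_nonneg ht.le _))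
  rw [integral_integral_swap hint2]
  refine integral_congr_ae (Eventually.of_forall fun z => ?_)
  simp only [integral_smul_const]
  congr 1
  rw [← integral_add_right_eq_self _ z]
  simp only [add_sub_cancel_right]
  rw [← integral_heatKernel_mul hh ht (x - z)]
  refine integral_congr_ae (Eventually.of_forall fun y => ?_)
  simp only [sub_sub, add_comm]

/-- `(1 + r)^q ≤ e^{qr}`, followed by `qr ≤ q²/(4ε) + ε r²`. -/
lemma one_add_rpow_le_exp_sq {q ε : ℝ} (hq : 0 ≤ q) (hε : 0 < ε) {r : ℝ} (hr : 0 ≤ r) :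
    (1 + r) ^ q ≤ Real.exp (q ^ 2 / (4 * ε)) * Real.exp (ε * r ^ 2) := by
  have h1 : (1 + r) ^ q ≤ Real.exp (q * r) := by
    rw [mul_comm, Real.exp_mul]
    exact Real.rpow_le_rpow (by positivity) (by linarith [Real.add_one_le_exp r]) hq
  refine h1.trans ?_
  rw [← Real.exp_add]
  refine Real.exp_le_exp.2 ?_
  have : q ^ 2 / (4 * ε) + ε * r ^ 2 - q * r = (q - 2 * ε * r) ^ 2 / (4 * ε) := by
    field_simp; ring
  have h2 : 0 ≤ (q - 2 * ε * r) ^ 2 / (4 * ε) := by positivity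
  linarith

/-- The Gaussian decays faster than any power. -/
lemma exists_heatKernel_le {q : ℝ} (hq : 0 ≤ q) : ∃ C : ℝ, 0 < C ∧
    ∀ w : E, heatKernel 1 w * (1 + ‖w‖) ^ q ≤ C * Real.exp (-(1 / 8) * ‖w‖ ^ 2) := by
  refine ⟨((4 * Real.pi * 1) ^ (3 / 2 : ℝ))⁻¹ * Real.exp (q ^ 2 / (4 * (1 / 8))),
    by positivity, fun w => ?_⟩
  have h := one_add_rpow_le_exp_sq hq (ε := 1 / 8) (by norm_num) (norm_nonneg w)
  calc heatKernel 1 w * (1 + ‖w‖) ^ q ≤ heatKernel 1 w *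
        (Real.exp (q ^ 2 / (4 * (1 / 8))) * Real.exp (1 / 8 * ‖w‖ ^ 2)) :=
        mul_le_mul_of_nonneg_left h (heatKernel_nonneg zero_le_one _)
    _ = _ := by
        rw [heatKernel_eq]
        have : -(1 / 8) * ‖w‖ ^ 2 = -(1 / (4 * 1)) * ‖w‖ ^ 2 + 1 / 8 * ‖w‖ ^ 2 := by ring
        rw [this, Real.exp_add]
        ring

lemma integrable_heatKernel_mul_rpow {q : ℝ} (hq : 0 ≤ q) :
    Integrable fun w : E => heatKernel 1 w * (1 + ‖w‖) ^ q := by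
  obtain ⟨C, -, hC⟩ := exists_heatKernel_le hq
  refine ((integrable_exp_neg_mul_sq (b := 1 / 8) (by norm_num)).const_mul C).mono' ?_
    (Eventually.of_forall fun w => ?_)
  · refine ((continuous_heatKernel 1).mul ?_).aestronglyMeasurable
    exact (continuous_const.add continuous_norm).rpow_const fun w =>
      Or.inl (add_pos_of_pos_of_nonneg one_pos (norm_nonneg w)).ne'
  · rw [Real.norm_of_nonneg (mul_nonneg (heatKernel_nonneg zero_le_one _) (by positivity))]
    exact hC w

lemma fderiv_heatKernel_one (w v : E) :
    fderiv ℝ (heatKernel 1) w v = -(1 / 2) * inner ℝ w v * heatKernel 1 w := by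
  have h1 : HasFDerivAt (fun x : E => ‖x‖ ^ 2) _ w := (hasFDerivAt_id w).norm_sq
  have h2 := (h1.const_mul (-(1 / (4 * 1) : ℝ))).exp.const_mul
    ((4 * Real.pi * 1) ^ (3 / 2 : ℝ))⁻¹
  rw [funext (heatKernel_eq (r := 1)), h2.fderiv]
  simp
  ring

lemma differentiable_heatKernel_one : Differentiable ℝ (heatKernel 1) := by
  rw [funext (heatKernel_eq (r := 1))]
  exact ((((differentiable_id.norm_sq ℝ)).const_mul _).exp).const_mul _

lemma abs_apply_le_norm (w : E) (i : Fin 3) : |w i| ≤ ‖w‖ := by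
  rw [← Real.norm_eq_abs]
  exact PiLp.norm_apply_le w i

lemma integrable_heatKernel_mul_sq :
    Integrable fun w : E => heatKernel 1 w * (1 + ‖w‖) ^ 2 := by
  simpa using integrable_heatKernel_mul_rpow (q := 2) (by norm_num)

/-- Second moments of the heat kernel. -/
lemma integral_heatKernel_mul_apply_mul_apply (i j : Fin 3) :
    ∫ w : E, heatKernel 1 w * (w i * w j) = if i = j then 2 else 0 := by
  have hc : ∀ i : Fin 3, Continuous fun w : E => w i := fun i => by fun_prop
  have hint : ∀ f : E → ℝ, Continuous f → (∀ w, |f w| ≤ (1 + ‖w‖) ^ 2) →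
      Integrable fun w => heatKernel 1 w * f w := by
    intro f hf hb
    refine integrable_heatKernel_mul_sq.mono'
      ((continuous_heatKernel 1).mul hf).aestronglyMeasurable (Eventually.of_forall fun w => ?_)
    rw [norm_mul, Real.norm_of_nonneg (heatKernel_nonneg zero_le_one _)]
    exact mul_le_mul_of_nonneg_left (hb w) (heatKernel_nonneg zero_le_one _)
  have hij : ∀ i j : Fin 3, ∀ w : E, |w i * w j| ≤ (1 + ‖w‖) ^ 2 := by
    intro i j w
    rw [abs_mul]
    have := abs_apply_le_norm w i
    have := abs_apply_le_norm w j
    nlinarith [abs_nonneg (w i), abs_nonneg (w j), norm_nonneg w]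
  have hj : ∀ w : E, |w j| ≤ (1 + ‖w‖) ^ 2 := fun w => by
    have := abs_apply_le_norm w j
    nlinarith [norm_nonneg w]
  have hi : ∀ w : E, inner ℝ w (stdE i) = w i := by
    intro w
    simp [EuclideanSpace.inner_single_right]
  let pj : E →L[ℝ] ℝ := EuclideanSpace.proj j
  have hpj : ∀ w v : E, fderiv ℝ (fun w : E => w j) w v = v j := by
    intro w v
    change fderiv ℝ pj w v = v j
    rw [pj.fderiv]; rfl
  -- Since `∂ᵢ` of the kernel is `-½ wᵢ` times the kernel, integrating `wⱼ` against it by parts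
  -- leaves `∂ᵢ wⱼ = δᵢⱼ`; the factor `½` is the source of the value `2`.
  have key := integral_mul_fderiv_eq_neg_fderiv_mul_of_integrable (μ := (volume : Measure E))
    (f := fun w : E => w j) (g := heatKernel 1) (v := stdE i)
    (by
      simp only [hpj]
      exact (integrable_heatKernel one_pos).const_mul _)
    (by
      simp only [fderiv_heatKernel_one, hi]
      refine ((hint _ ((hc i).mul (hc j)) (hij i j)).const_mul (-(1 / 2))).congr
        (Eventually.of_forall fun w => ?_)
      simp only [Pi.mul_apply]; ring)
    ((hint _ (hc j) hj).congr (Eventually.of_forall fun w => mul_comm _ _))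
    (fun x _ => pj.differentiableAt) (fun x _ => differentiable_heatKernel_one x)
  simp only [fderiv_heatKernel_one, hi, hpj] at key
  rw [integral_const_mul, integral_heatKernel one_pos] at key
  have e : ∫ w : E, w j * (-(1 / 2) * w i * heatKernel 1 w) =
      -(1 / 2) * ∫ w : E, heatKernel 1 w * (w i * w j) := by
    rw [← integral_const_mul]
    refine integral_congr_ae (Eventually.of_forall fun w => ?_)
    simp only; ring
  rw [e] at key
  have hs : (stdE i) j = if i = j then 1 else 0 := by
    simp [eq_comm]
  rw [hs] at key
  split_ifs at key ⊢ <;> linarith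

end HeatKernel

end QTensor

end

/-! ### Duhamel integrals with a general bounded kernel, as bounded bilinear operators. -/

noncomputable section

namespace QTensor

section Extend

variable {F : Type*} [NormedAddCommGroup F]

/-- A map on `ℝ³ × (0, ∞)` as a function of `x` and `t`, extended by zero. -/
def extend (g : SpaceTime → F) (x : E) (t : ℝ) : F := if h : 0 < t then g (x, ⟨t, h⟩) else 0

lemma extend_of_pos (g : SpaceTime → F) (x : E) {t : ℝ} (ht : 0 < t) :
    extend g x t = g (x, ⟨t, ht⟩) := dif_pos ht

lemma Weighted.eval_eq_extend {δ k : ℝ} (U : Weighted δ k) (x : E) (t : ℝ) :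
    U.eval x t = extend U x t := rfl

lemma continuousOn_extend {g : SpaceTime → F} (hg : Continuous g) :
    ContinuousOn (fun p : E × ℝ => extend g p.1 p.2) (univ ×ˢ Ioi 0) := by
  rw [continuousOn_iff_continuous_domRestrict]
  have : (univ ×ˢ Ioi 0).domRestrict (fun p : E × ℝ => extend g p.1 p.2) =
      fun p : ((univ : Set E) ×ˢ Ioi (0 : ℝ)) => g (p.1.1, ⟨p.1.2, p.2.2⟩) := by
    funext p
    exact extend_of_pos g _ p.2.2
  rw [this]
  exact hg.comp (by fun_prop)

lemma continuous_extend_slice {g : SpaceTime → F} (hg : Continuous g) (t : ℝ) :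
    Continuous fun x => extend g x t := by
  by_cases ht : 0 < t
  · simp only [extend_of_pos g _ ht]
    exact hg.comp (by fun_prop)
  · simp only [extend, dif_neg ht]
    exact continuous_const

lemma norm_extend_le {g : SpaceTime → F} {M : ℝ} (hM : ∀ q, ‖g q‖ ≤ M) (x : E) {t : ℝ}
    (ht : 0 < t) : ‖extend g x t‖ ≤ M := by
  rw [extend_of_pos g x ht]
  exact hM _

end Extend

/-- A bounded increasing reparametrisation weight of the time axis. -/
def timeBump (t : ℝ) : ℝ := 1 - Real.exp (-t)

lemma continuous_timeBump : Continuous timeBump := by unfold timeBump; fun_prop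

/-- The difference quotients of `timeBump` with respect to `t - s` and `√(t - s)`. -/
def bumpQuot (t s : ℝ) : ℝ × ℝ :=
  ((timeBump t - timeBump s) / (t - s), (timeBump t - timeBump s) / Real.sqrt (t - s))

lemma continuousAt_bumpQuot {p : ℝ × ℝ} (h : p.2 < p.1) :
    ContinuousAt (fun p : ℝ × ℝ => bumpQuot p.1 p.2) p := by
  have h1 : ContinuousAt (fun p : ℝ × ℝ => timeBump p.1 - timeBump p.2) p :=
    ((continuous_timeBump.comp continuous_fst).sub
      (continuous_timeBump.comp continuous_snd)).continuousAt
  have h2 : 0 < p.1 - p.2 := sub_pos.2 h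
  exact (h1.div (by fun_prop) h2.ne').prodMk (h1.div (by fun_prop) (Real.sqrt_pos.2 h2).ne')

/-- Bounded continuous modifications of the heat kernel. -/
abbrev Ker : Type := BoundedContinuousFunction ((ℝ × ℝ) × E) ℝ

/-- Bounded continuous maps on `ℝ³ × (0, ∞)`. -/
abbrev BddMap : Type := BoundedContinuousFunction SpaceTime Sym0

/-- The Gaussian against which the kernels are integrated. -/
def gauss (w : E) : ℝ := Real.exp (-(1 / 16) * ‖w‖ ^ 2)

lemma gauss_pos (w : E) : 0 < gauss w := Real.exp_pos _

lemma continuous_gauss : Continuous gauss := by unfold gauss; fun_prop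

lemma integrable_gauss : Integrable gauss := integrable_exp_neg_mul_sq (by norm_num)

/-- The integrand of the Duhamel integral with modified kernel. -/
def duhamelIntegrand (a : ℝ) (κ : Ker) (g : E → ℝ → Sym0) (x : E) (t : ℝ) (p : ℝ × E) : Sym0 :=
  (Real.exp (-a * p.1) * (gauss p.2 * κ (bumpQuot t p.1, p.2))) •
    g (x - Real.sqrt (t - p.1) • p.2) p.1

/-- The Duhamel integral with exponential damping and modified kernel. -/
def duhamel (a : ℝ) (κ : Ker) (g : E → ℝ → Sym0) (x : E) (t : ℝ) : Sym0 :=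
  ∫ p in Ioo 0 t ×ˢ univ, duhamelIntegrand a κ g x t p

section Duhamel

variable {a : ℝ}

lemma continuousOn_duhamelIntegrand (κ : Ker) {g : E → ℝ → Sym0}
    (hg : ContinuousOn (fun p : E × ℝ => g p.1 p.2) (univ ×ˢ Ioi 0)) (x : E) (t : ℝ) :
    ContinuousOn (duhamelIntegrand a κ g x t) (Ioo 0 t ×ˢ univ) := by
  have h1 : ContinuousOn (fun p : ℝ × E => bumpQuot t p.1) (Ioo 0 t ×ˢ univ) := by
    intro p hp
    have := (continuousAt_bumpQuot (p := (t, p.1)) hp.1.2).comp (f := fun p : ℝ × E => (t, p.1))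
      (x := p) (by fun_prop)
    exact this.continuousWithinAt
  have h2 : ContinuousOn (fun p : ℝ × E => κ (bumpQuot t p.1, p.2)) (Ioo 0 t ×ˢ univ) :=
    κ.continuous.comp_continuousOn (h1.prodMk continuousOn_snd)
  have h3 : ContinuousOn (fun p : ℝ × E => g (x - Real.sqrt (t - p.1) • p.2) p.1)
      (Ioo 0 t ×ˢ univ) :=
    hg.comp (f := fun p : ℝ × E => (x - Real.sqrt (t - p.1) • p.2, p.1)) (by fun_prop)
      fun p hp => ⟨mem_univ _, hp.1.1⟩
  have h4 : Continuous fun p : ℝ × E => gauss p.2 := continuous_gauss.comp continuous_snd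
  exact (ContinuousOn.mul (by fun_prop) (h4.continuousOn.mul h2)).smul h3

lemma norm_duhamelIntegrand_le (κ : Ker) {g : E → ℝ → Sym0} {M : ℝ}
    (hM : ∀ x t, 0 < t → ‖g x t‖ ≤ M) (x : E) (t : ℝ) {p : ℝ × E} (hp : 0 < p.1) :
    ‖duhamelIntegrand a κ g x t p‖ ≤ Real.exp (-a * p.1) * gauss p.2 * (‖κ‖ * M) := by
  rw [duhamelIntegrand, norm_smul, norm_mul, norm_mul, Real.norm_of_nonneg (Real.exp_pos _).le,
    Real.norm_of_nonneg (gauss_pos _).le]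
  have h1 := κ.norm_coe_le_norm (bumpQuot t p.1, p.2)
  have h2 := hM (x - Real.sqrt (t - p.1) • p.2) p.1 hp
  calc Real.exp (-a * p.1) * (gauss p.2 * ‖κ (bumpQuot t p.1, p.2)‖) *
        ‖g (x - Real.sqrt (t - p.1) • p.2) p.1‖
      ≤ Real.exp (-a * p.1) * (gauss p.2 * ‖κ‖) * M := by
        have := (gauss_pos p.2).le
        gcongr
    _ = _ := by ring

lemma integrableOn_damped_gauss (ha : 0 < a) :
    IntegrableOn (fun p : ℝ × E => Real.exp (-a * p.1) * gauss p.2) (Ioi 0 ×ˢ univ) := by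
  have h := (exp_neg_integrableOn_Ioi 0 ha).mul_prod (integrable_gauss.integrableOn (s := univ))
  rwa [Measure.prod_restrict] at h

lemma integrableOn_duhamelIntegrand (ha : 0 < a) (κ : Ker) {g : E → ℝ → Sym0}
    (hg : ContinuousOn (fun p : E × ℝ => g p.1 p.2) (univ ×ˢ Ioi 0)) {M : ℝ}
    (hM : ∀ x t, 0 < t → ‖g x t‖ ≤ M) (x : E) (t : ℝ) :
    IntegrableOn (duhamelIntegrand a κ g x t) (Ioo 0 t ×ˢ univ) := by
  have hms : MeasurableSet (Ioo 0 t ×ˢ (univ : Set E)) := measurableSet_Ioo.prod MeasurableSet.univ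
  refine Integrable.mono' (((integrableOn_damped_gauss ha).mono_set ?_).mul_const (‖κ‖ * M))
    ((continuousOn_duhamelIntegrand κ hg x t).aestronglyMeasurable hms)
    ((ae_restrict_mem hms).mono fun p hp => norm_duhamelIntegrand_le κ hM x t hp.1.1)
  exact prod_mono_left fun s hs => hs.1

/-- The mass of the damped Gaussian. -/
def duhamelConst (a : ℝ) : ℝ := ∫ p in Ioi 0 ×ˢ univ, Real.exp (-a * p.1) * gauss (p : ℝ × E).2

lemma duhamelConst_nonneg (a : ℝ) : 0 ≤ duhamelConst a :=
  integral_nonneg fun _ => mul_nonneg (Real.exp_pos _).le (gauss_pos _).le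

lemma norm_duhamel_le (ha : 0 < a) (κ : Ker) {g : E → ℝ → Sym0} {M : ℝ}
    (hM : ∀ x t, 0 < t → ‖g x t‖ ≤ M) (x : E) (t : ℝ) :
    ‖duhamel a κ g x t‖ ≤ duhamelConst a * ‖κ‖ * M := by
  have hms : MeasurableSet (Ioo 0 t ×ˢ (univ : Set E)) := measurableSet_Ioo.prod MeasurableSet.univ
  have hsub : Ioo 0 t ×ˢ (univ : Set E) ⊆ Ioi 0 ×ˢ univ := prod_mono_left fun s hs => hs.1
  have hM0 : 0 ≤ M := (norm_nonneg _).trans (hM 0 1 one_pos)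
  have hint : IntegrableOn (fun p : ℝ × E => Real.exp (-a * p.1) * gauss p.2 * (‖κ‖ * M))
      (Ioi 0 ×ˢ univ) := (integrableOn_damped_gauss ha).mul_const (‖κ‖ * M)
  calc ‖duhamel a κ g x t‖
      ≤ ∫ p in Ioo 0 t ×ˢ univ, Real.exp (-a * p.1) * gauss (p : ℝ × E).2 * (‖κ‖ * M) :=
        norm_integral_le_of_norm_le (hint.mono_set hsub)
          ((ae_restrict_mem hms).mono fun p hp => norm_duhamelIntegrand_le κ hM x t hp.1.1)
    _ ≤ ∫ p in Ioi 0 ×ˢ univ, Real.exp (-a * p.1) * gauss (p : ℝ × E).2 * (‖κ‖ * M) :=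
        setIntegral_mono_set hint (Eventually.of_forall fun p => mul_nonneg
          (mul_nonneg (Real.exp_pos _).le (gauss_pos _).le) (mul_nonneg (norm_nonneg _) hM0))
          hsub.eventuallyLE
    _ = duhamelConst a * ‖κ‖ * M := by rw [integral_mul_const, duhamelConst, mul_assoc]

/-- Dominated convergence on a fixed domain, with the time interval `(0, t)` as an indicator; at a
given `t₀` it can jump only on the null set `s = t₀`. -/
lemma continuous_duhamel (ha : 0 < a) (κ : Ker) {g : E → ℝ → Sym0}
    (hg : ContinuousOn (fun p : E × ℝ => g p.1 p.2) (univ ×ˢ Ioi 0)) {M : ℝ}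
    (hM : ∀ x t, 0 < t → ‖g x t‖ ≤ M) :
    Continuous fun q : SpaceTime => duhamel a κ g q.1 q.2 := by
  have hms : ∀ t : ℝ, MeasurableSet (Ioo 0 t ×ˢ (univ : Set E)) := fun t =>
    measurableSet_Ioo.prod MeasurableSet.univ
  have hM0 : 0 ≤ M := (norm_nonneg _).trans (hM 0 1 one_pos)
  have e : (fun q : SpaceTime => duhamel a κ g q.1 q.2) = fun q : SpaceTime =>
      ∫ p, (Ioo 0 (q.2 : ℝ) ×ˢ univ).indicator (duhamelIntegrand a κ g q.1 q.2) p :=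
    funext fun q => (integral_indicator (hms _)).symm
  rw [e, continuous_iff_continuousAt]
  rintro ⟨x₀, t₀, ht₀⟩
  rw [mem_Ioi] at ht₀
  have hae : ∀ᵐ p : ℝ × E, p.1 ≠ t₀ := by
    rw [Measure.volume_eq_prod]
    exact Measure.quasiMeasurePreserving_fst.ae (Measure.ae_ne volume t₀)
  refine continuousAt_of_dominated (bound := (Ioi 0 ×ˢ univ).indicator
    fun p : ℝ × E => Real.exp (-a * p.1) * gauss p.2 * (‖κ‖ * M))
    (Eventually.of_forall fun q => ?_) (Eventually.of_forall fun q => Eventually.of_forall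
      fun p => ?_) ?_ ?_
  · exact (aestronglyMeasurable_indicator_iff (hms _)).2
      ((continuousOn_duhamelIntegrand κ hg _ _).aestronglyMeasurable (hms _))
  · by_cases hp : p ∈ Ioo 0 (q.2 : ℝ) ×ˢ (univ : Set E)
    · rw [indicator_of_mem hp, indicator_of_mem (show p ∈ Ioi 0 ×ˢ univ from ⟨hp.1.1, mem_univ _⟩)]
      exact norm_duhamelIntegrand_le κ hM _ _ hp.1.1
    · rw [indicator_of_notMem hp, norm_zero]
      exact indicator_nonneg (fun p _ => mul_nonneg
        (mul_nonneg (Real.exp_pos _).le (gauss_pos _).le) (mul_nonneg (norm_nonneg _) hM0)) _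
  · rw [integrable_indicator_iff (measurableSet_Ioi.prod MeasurableSet.univ)]
    exact (integrableOn_damped_gauss ha).mul_const _
  · filter_upwards [hae] with p hp
    have htend : ContinuousAt (fun q : SpaceTime => (q.2 : ℝ)) (x₀, ⟨t₀, ht₀⟩) := by fun_prop
    by_cases h0 : 0 < p.1
    · rcases lt_or_gt_of_ne hp with h | h
      · have ev : (fun q : SpaceTime => duhamelIntegrand a κ g q.1 q.2 p) =ᶠ[𝓝 (x₀, ⟨t₀, ht₀⟩)]
            fun q : SpaceTime =>
              (Ioo 0 (q.2 : ℝ) ×ˢ univ).indicator (duhamelIntegrand a κ g q.1 q.2) p := by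
          filter_upwards [htend.eventually (lt_mem_nhds h)] with q hq
          rw [indicator_of_mem]
          exact ⟨⟨h0, hq⟩, mem_univ _⟩
        refine ContinuousAt.congr ?_ ev
        have h1 : ContinuousAt (fun q : SpaceTime => bumpQuot q.2 p.1) (x₀, ⟨t₀, ht₀⟩) :=
          (continuousAt_bumpQuot (p := (t₀, p.1)) h).comp
            (f := fun q : SpaceTime => ((q.2 : ℝ), p.1)) (x := (x₀, ⟨t₀, ht₀⟩)) (by fun_prop)
        have h2 : ContinuousAt (fun q : SpaceTime => κ (bumpQuot q.2 p.1, p.2)) (x₀, ⟨t₀, ht₀⟩) :=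
          κ.continuous.continuousAt.comp (h1.prodMk continuousAt_const)
        have h3 : Continuous fun y => g y p.1 := continuousOn_univ.1
          (hg.comp (f := fun y : E => (y, p.1)) (by fun_prop)
            fun y _ => ⟨mem_univ y, mem_Ioi.2 h0⟩)
        have h4 : ContinuousAt (fun q : SpaceTime =>
            g (q.1 - Real.sqrt (q.2 - p.1) • p.2) p.1) (x₀, ⟨t₀, ht₀⟩) :=
          h3.continuousAt.comp (by fun_prop)
        exact (continuousAt_const.mul (continuousAt_const.mul h2)).smul h4
      · have ev : (fun q : SpaceTime => (0 : Sym0)) =ᶠ[𝓝 (x₀, ⟨t₀, ht₀⟩)]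
            fun q : SpaceTime =>
              (Ioo 0 (q.2 : ℝ) ×ˢ univ).indicator (duhamelIntegrand a κ g q.1 q.2) p := by
          filter_upwards [htend.eventually (gt_mem_nhds h)] with q hq
          rw [indicator_of_notMem]
          exact fun hmem => absurd hmem.1.2 (not_lt.2 hq.le)
        exact continuousAt_const.congr ev
    · have ev : (fun q : SpaceTime => (0 : Sym0)) = fun q : SpaceTime =>
              (Ioo 0 (q.2 : ℝ) ×ˢ univ).indicator (duhamelIntegrand a κ g q.1 q.2) p := by
        funext q
        rw [indicator_of_notMem]
        exact fun hmem => h0 hmem.1.1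
      rw [← ev]
      exact continuousAt_const

/-- The Duhamel integral as a bounded continuous map. -/
def duhamelMap (ha : 0 < a) (κ : Ker) (g : BddMap) : BddMap :=
  BoundedContinuousFunction.ofNormedAddCommGroup
    (fun q : SpaceTime => duhamel a κ (extend g) q.1 q.2)
    (continuous_duhamel ha κ (continuousOn_extend g.continuous)
      fun x _ ht => norm_extend_le g.norm_coe_le_norm x ht)
    (duhamelConst a * ‖κ‖ * ‖g‖)
    (fun _ => norm_duhamel_le ha κ (fun x _ ht => norm_extend_le g.norm_coe_le_norm x ht) _ _)

lemma duhamelMap_apply (ha : 0 < a) (κ : Ker) (g : BddMap) (q : SpaceTime) :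
    duhamelMap ha κ g q = duhamel a κ (extend g) q.1 q.2 := rfl

lemma integrableOn_duhamelMap (ha : 0 < a) (κ : Ker) (g : BddMap) (x : E) (t : ℝ) :
    IntegrableOn (duhamelIntegrand a κ (extend g) x t) (Ioo 0 t ×ˢ univ) :=
  integrableOn_duhamelIntegrand ha κ (continuousOn_extend g.continuous)
    (fun x _ ht => norm_extend_le g.norm_coe_le_norm x ht) x t

/-- The Duhamel integral as a continuous bilinear map of the kernel and the source. -/
def duhamelOp (ha : 0 < a) : Ker →L[ℝ] BddMap →L[ℝ] BddMap :=
  LinearMap.mkContinuous₂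
    (LinearMap.mk₂ ℝ (duhamelMap ha)
      (fun κ κ' g => by
        ext1 q
        rw [BoundedContinuousFunction.add_apply, duhamelMap_apply, duhamelMap_apply,
          duhamelMap_apply, duhamel, duhamel, duhamel,
          ← integral_add (integrableOn_duhamelMap ha κ g _ _) (integrableOn_duhamelMap ha κ' g _ _)]
        refine integral_congr_ae (Eventually.of_forall fun p => ?_)
        simp only [duhamelIntegrand, BoundedContinuousFunction.add_apply, mul_add, add_smul])
      (fun r κ g => by
        ext1 q
        rw [BoundedContinuousFunction.smul_apply, duhamelMap_apply, duhamelMap_apply,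
          duhamel, duhamel, ← integral_smul]
        refine integral_congr_ae (Eventually.of_forall fun p => ?_)
        simp only [duhamelIntegrand, BoundedContinuousFunction.smul_apply, smul_smul, smul_eq_mul]
        congr 1; ring)
      (fun κ g g' => by
        ext1 q
        rw [BoundedContinuousFunction.add_apply, duhamelMap_apply, duhamelMap_apply,
          duhamelMap_apply, duhamel, duhamel, duhamel,
          ← integral_add (integrableOn_duhamelMap ha κ g _ _) (integrableOn_duhamelMap ha κ g' _ _)]
        refine setIntegral_congr_fun (measurableSet_Ioo.prod MeasurableSet.univ) fun p hp => ?_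
        simp only [duhamelIntegrand, extend_of_pos _ _ hp.1.1,
          BoundedContinuousFunction.add_apply, smul_add])
      (fun r κ g => by
        ext1 q
        rw [BoundedContinuousFunction.smul_apply, duhamelMap_apply, duhamelMap_apply,
          duhamel, duhamel, ← integral_smul]
        refine setIntegral_congr_fun (measurableSet_Ioo.prod MeasurableSet.univ) fun p hp => ?_
        simp only [duhamelIntegrand, extend_of_pos _ _ hp.1.1,
          BoundedContinuousFunction.smul_apply, smul_comm r]))
    (duhamelConst a)
    (fun κ g => BoundedContinuousFunction.norm_ofNormedAddCommGroup_le _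
      (mul_nonneg (mul_nonneg (duhamelConst_nonneg a) (norm_nonneg _)) (norm_nonneg _))
      fun _ => norm_duhamel_le ha κ (fun x _ ht => norm_extend_le g.norm_coe_le_norm x ht) _ _)

lemma duhamelOp_apply (ha : 0 < a) (κ : Ker) (g : BddMap) (q : SpaceTime) :
    duhamelOp ha κ g q = duhamel a κ (extend g) q.1 q.2 := rfl

end Duhamel

end QTensor

end

/-! ### The free flow of measurable data with a general bounded kernel. -/

noncomputable section

namespace QTensor

section FreeFlow

/-- Data are only defined almost everywhere, so measurability and bounds must survive the
substitution inside the flow. -/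
lemma quasiMeasurePreserving_sub_smul (x : E) {r : ℝ} (hr : 0 < r) :
    Measure.QuasiMeasurePreserving (fun w : E => x - r • w) := by
  have h1 : Measure.QuasiMeasurePreserving (fun w : E => r • w) :=
    ⟨measurable_const_smul r, by
      rw [Measure.map_addHaar_smul _ hr.ne']
      exact Measure.smul_absolutelyContinuous⟩
  exact (Measure.measurePreserving_sub_left volume x).quasiMeasurePreserving.comp h1

/-- The free flow with modified kernel. -/
def freeFlow (κ : Ker) (f : E → Sym0) (x : E) (t : ℝ) : Sym0 :=
  ∫ w, (gauss w * κ (bumpQuot t 0, w)) • f (x - Real.sqrt t • w)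

/-- Moves `x` and `t` from the argument of the merely measurable datum into the continuous kernel,
as the proof of joint continuity requires. -/
lemma freeFlow_eq (κ : Ker) (f : E → Sym0) (x : E) {t : ℝ} (ht : 0 < t) :
    freeFlow κ f x t = (Real.sqrt t ^ 3)⁻¹ • ∫ y, (gauss ((Real.sqrt t)⁻¹ • (x - y)) *
      κ (bumpQuot t 0, (Real.sqrt t)⁻¹ • (x - y))) • f y := by
  have hs : Real.sqrt t ≠ 0 := (Real.sqrt_pos.2 ht).ne'
  have h1 : freeFlow κ f x t = ∫ w, (fun z => (gauss ((Real.sqrt t)⁻¹ • z) *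
      κ (bumpQuot t 0, (Real.sqrt t)⁻¹ • z)) • f (x - z)) (Real.sqrt t • w) := by
    refine integral_congr_ae (Eventually.of_forall fun w => ?_)
    simp only [inv_smul_smul₀ hs]
  rw [h1, integral_comp_sqrt_smul ht (fun z => (gauss ((Real.sqrt t)⁻¹ • z) *
      κ (bumpQuot t 0, (Real.sqrt t)⁻¹ • z)) • f (x - z)), ← integral_sub_left_eq_self
      (fun z => (gauss ((Real.sqrt t)⁻¹ • z) *
      κ (bumpQuot t 0, (Real.sqrt t)⁻¹ • z)) • f (x - z)) volume x]
  simp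

variable {f : E → Sym0} {M : ℝ}

lemma norm_gauss_ker_smul_le (κ : Ker) {M : ℝ} (θ : ℝ × ℝ) (w : E) {v : Sym0} (hv : ‖v‖ ≤ M) :
    ‖(gauss w * κ (θ, w)) • v‖ ≤ gauss w * (‖κ‖ * M) := by
  rw [norm_smul, norm_mul, Real.norm_of_nonneg (gauss_pos _).le, mul_assoc]
  have h1 := κ.norm_coe_le_norm (θ, w)
  have := (gauss_pos w).le
  gcongr

lemma continuous_gauss_ker (κ : Ker) (θ : ℝ × ℝ) : Continuous fun w => gauss w * κ (θ, w) :=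
  continuous_gauss.mul (κ.continuous.comp (by fun_prop))

lemma integrable_freeFlow (κ : Ker) (hf : AEStronglyMeasurable f (volume : Measure E))
    (hM : ∀ᵐ x, ‖f x‖ ≤ M) (x : E) {t : ℝ} (ht : 0 < t) :
    Integrable fun w => (gauss w * κ (bumpQuot t 0, w)) • f (x - Real.sqrt t • w) := by
  have hq := quasiMeasurePreserving_sub_smul x (Real.sqrt_pos.2 ht)
  refine (integrable_gauss.mul_const (‖κ‖ * M)).mono' ?_ ?_
  · exact (continuous_gauss_ker κ _).aestronglyMeasurable.smul (hf.comp_quasiMeasurePreserving hq)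
  · exact (hq.ae hM).mono fun w hw => norm_gauss_ker_smul_le κ _ w hw

lemma norm_freeFlow_le (κ : Ker) (hM : ∀ᵐ x, ‖f x‖ ≤ M) (x : E) {t : ℝ} (ht : 0 < t) :
    ‖freeFlow κ f x t‖ ≤ (∫ w, gauss w) * M * ‖κ‖ := by
  have hq := quasiMeasurePreserving_sub_smul x (Real.sqrt_pos.2 ht)
  calc ‖freeFlow κ f x t‖ ≤ ∫ w, gauss w * (‖κ‖ * M) :=
        norm_integral_le_of_norm_le (integrable_gauss.mul_const (‖κ‖ * M))
          ((hq.ae hM).mono fun w hw => norm_gauss_ker_smul_le κ _ w hw)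
    _ = _ := by rw [integral_mul_const]; ring

/-- The majorant for `continuous_freeFlow`, uniform near `(x₀, t₀)`; it rests on `|x₀ - y|² ≤ 2 |x -
y|² + 2`. -/
lemma gauss_scaled_le {x x₀ y : E} {t t₀ : ℝ} (ht : 0 < t) (hx : ‖x - x₀‖ < 1)
    (h : t < 2 * t₀) : gauss ((Real.sqrt t)⁻¹ • (x - y)) ≤
      Real.exp (1 / (32 * t₀)) * Real.exp (-(1 / (64 * t₀)) * ‖x₀ - y‖ ^ 2) := by
  have ht₀ : 0 < t₀ := by linarith
  rw [gauss, ← Real.exp_add]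
  refine Real.exp_le_exp.2 ?_
  rw [norm_smul, norm_inv, Real.norm_of_nonneg (Real.sqrt_nonneg _), mul_pow, inv_pow,
    Real.sq_sqrt ht.le]
  have h1 : ‖x₀ - y‖ ≤ ‖x - y‖ + 1 := by
    have : x₀ - y = (x - y) - (x - x₀) := by abel
    rw [this]
    exact (norm_sub_le _ _).trans (by linarith)
  have h2 : ‖x₀ - y‖ ^ 2 ≤ 2 * ‖x - y‖ ^ 2 + 2 := by
    nlinarith [norm_nonneg (x₀ - y), norm_nonneg (x - y), sq_nonneg (‖x - y‖ - 1)]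
  have h3 : (2 * t₀)⁻¹ ≤ t⁻¹ := inv_anti₀ ht h.le
  have h4 : (2 * t₀)⁻¹ * ‖x - y‖ ^ 2 ≤ t⁻¹ * ‖x - y‖ ^ 2 :=
    mul_le_mul_of_nonneg_right h3 (sq_nonneg _)
  have h5 : 1 / (64 * t₀) * ‖x₀ - y‖ ^ 2 ≤ 1 / (64 * t₀) * (2 * ‖x - y‖ ^ 2 + 2) :=
    mul_le_mul_of_nonneg_left h2 (by positivity)
  have h6 : 1 / (64 * t₀) * (2 * ‖x - y‖ ^ 2 + 2) =
      1 / 16 * ((2 * t₀)⁻¹ * ‖x - y‖ ^ 2) + 1 / (32 * t₀) := by field_simp; ring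
  linarith

lemma continuous_freeFlow (κ : Ker) (hf : AEStronglyMeasurable f (volume : Measure E))
    (hM : ∀ᵐ x, ‖f x‖ ≤ M) : Continuous fun q : SpaceTime => freeFlow κ f q.1 q.2 := by
  have e : (fun q : SpaceTime => freeFlow κ f q.1 q.2) = fun q : SpaceTime =>
      (Real.sqrt q.2 ^ 3)⁻¹ • ∫ y, (gauss ((Real.sqrt q.2)⁻¹ • (q.1 - y)) *
      κ (bumpQuot q.2 0, (Real.sqrt q.2)⁻¹ • (q.1 - y))) • f y :=
    funext fun q => freeFlow_eq κ f q.1 q.2.2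
  rw [e, continuous_iff_continuousAt]
  rintro ⟨x₀, t₀, ht₀⟩
  rw [mem_Ioi] at ht₀
  have hs0 : Real.sqrt t₀ ≠ 0 := (Real.sqrt_pos.2 ht₀).ne'
  have htend : ContinuousAt (fun q : SpaceTime => (q.2 : ℝ)) (x₀, ⟨t₀, ht₀⟩) := by fun_prop
  have hsq : ContinuousAt (fun q : SpaceTime => (Real.sqrt q.2)) (x₀, ⟨t₀, ht₀⟩) := by fun_prop
  have hsi : ContinuousAt (fun q : SpaceTime => (Real.sqrt q.2)⁻¹) (x₀, ⟨t₀, ht₀⟩) :=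
    hsq.inv₀ hs0
  refine ContinuousAt.smul ((hsq.pow 3).inv₀ (pow_ne_zero 3 hs0)) ?_
  refine continuousAt_of_dominated (bound := fun y => Real.exp (1 / (32 * t₀)) *
    Real.exp (-(1 / (64 * t₀)) * ‖x₀ - y‖ ^ 2) * (‖κ‖ * M))
    (Eventually.of_forall fun q => ?_) ?_ ?_ ?_
  · exact ((continuous_gauss_ker κ _).comp (by fun_prop)).aestronglyMeasurable.smul hf
  · have hx : ∀ᶠ q : SpaceTime in 𝓝 (x₀, ⟨t₀, ht₀⟩), ‖q.1 - x₀‖ < 1 := by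
      have : ContinuousAt (fun q : SpaceTime => ‖q.1 - x₀‖) (x₀, ⟨t₀, ht₀⟩) := by fun_prop
      exact this.eventually (gt_mem_nhds (by simp))
    filter_upwards [hx, htend.eventually (gt_mem_nhds (by change t₀ < 2 * t₀; linarith))]
      with q hq1 hq2
    filter_upwards [hM] with y hy
    refine (norm_gauss_ker_smul_le κ _ _ hy).trans ?_
    have hM0 : 0 ≤ M := (norm_nonneg _).trans hy
    exact mul_le_mul_of_nonneg_right (gauss_scaled_le q.2.2 hq1 hq2) (by positivity)
  · have h := ((integrable_exp_neg_mul_sq (b := 1 / (64 * t₀)) (by positivity)).comp_sub_left x₀)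
    exact (h.const_mul _).mul_const _
  · refine Eventually.of_forall fun y => ?_
    have h1 : ContinuousAt (fun q : SpaceTime => bumpQuot q.2 0) (x₀, ⟨t₀, ht₀⟩) :=
      (continuousAt_bumpQuot (p := (t₀, 0)) ht₀).comp
        (f := fun q : SpaceTime => ((q.2 : ℝ), (0 : ℝ))) (x := (x₀, ⟨t₀, ht₀⟩)) (by fun_prop)
    have h2 : ContinuousAt (fun q : SpaceTime => (Real.sqrt q.2)⁻¹ • (q.1 - y))
        (x₀, ⟨t₀, ht₀⟩) := hsi.smul (by fun_prop)
    exact ((continuous_gauss.continuousAt.comp h2).mul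
      (κ.continuous.continuousAt.comp (h1.prodMk h2))).smul continuousAt_const

/-- The free flow as a bounded continuous map. -/
def freeFlowMap (hf : AEStronglyMeasurable f (volume : Measure E)) (hM : ∀ᵐ x, ‖f x‖ ≤ M)
    (κ : Ker) : BddMap :=
  BoundedContinuousFunction.ofNormedAddCommGroup
    (fun q : SpaceTime => freeFlow κ f q.1 q.2) (continuous_freeFlow κ hf hM)
    ((∫ w, gauss w) * M * ‖κ‖) (fun q => norm_freeFlow_le κ hM q.1 q.2.2)

lemma freeFlowMap_apply (hf : AEStronglyMeasurable f (volume : Measure E))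
    (hM : ∀ᵐ x, ‖f x‖ ≤ M) (κ : Ker) (q : SpaceTime) :
    freeFlowMap hf hM κ q = freeFlow κ f q.1 q.2 := rfl

lemma norm_freeFlowMap_le (hf : AEStronglyMeasurable f (volume : Measure E))
    (hM : ∀ᵐ x, ‖f x‖ ≤ M) (κ : Ker) : ‖freeFlowMap hf hM κ‖ ≤ (∫ w, gauss w) * M * ‖κ‖ := by
  have hM0 : 0 ≤ M := by
    obtain ⟨x, hx⟩ := hM.exists
    exact (norm_nonneg _).trans hx
  refine (BoundedContinuousFunction.norm_le (mul_nonneg (mul_nonneg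
    (integral_nonneg fun w => (gauss_pos w).le) hM0) (norm_nonneg _))).2 fun q => ?_
  exact norm_freeFlow_le κ hM q.1 q.2.2

/-- The free flow as a continuous linear map of the kernel. -/
def freeFlowOp (hf : AEStronglyMeasurable f (volume : Measure E)) (hM : ∀ᵐ x, ‖f x‖ ≤ M) :
    Ker →L[ℝ] BddMap :=
  LinearMap.mkContinuous
    { toFun := freeFlowMap hf hM
      map_add' := fun κ κ' => by
        ext1 q
        rw [BoundedContinuousFunction.add_apply, freeFlowMap_apply, freeFlowMap_apply,
          freeFlowMap_apply, freeFlow, freeFlow, freeFlow,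
          ← integral_add (integrable_freeFlow κ hf hM _ q.2.2)
          (integrable_freeFlow κ' hf hM _ q.2.2)]
        refine integral_congr_ae (Eventually.of_forall fun p => ?_)
        simp only [BoundedContinuousFunction.add_apply, mul_add, add_smul]
      map_smul' := fun r κ => by
        ext1 q
        rw [RingHom.id_apply, BoundedContinuousFunction.smul_apply, freeFlowMap_apply,
          freeFlowMap_apply, freeFlow, freeFlow, ← integral_smul]
        refine integral_congr_ae (Eventually.of_forall fun p => ?_)
        simp only [BoundedContinuousFunction.smul_apply, smul_smul, smul_eq_mul]
        congr 1; ring }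
    ((∫ w, gauss w) * M) (norm_freeFlowMap_le hf hM)

lemma freeFlowOp_apply (hf : AEStronglyMeasurable f (volume : Measure E))
    (hM : ∀ᵐ x, ‖f x‖ ≤ M) (κ : Ker) (q : SpaceTime) :
    freeFlowOp hf hM κ q = freeFlow κ f q.1 q.2 := rfl

/-- The kernel which gives back the heat flow. -/
def heatKer : Ker :=
  BoundedContinuousFunction.ofNormedAddCommGroup
    (fun p => ((4 * Real.pi * 1) ^ (3 / 2 : ℝ))⁻¹ * Real.exp (-(3 / 16) * ‖p.2‖ ^ 2))
    (by fun_prop) ((4 * Real.pi * 1) ^ (3 / 2 : ℝ))⁻¹ (fun p => by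
      rw [norm_mul, Real.norm_of_nonneg (by positivity), Real.norm_of_nonneg (Real.exp_pos _).le]
      exact mul_le_of_le_one_right (by positivity)
        (Real.exp_le_one_iff.2 (by nlinarith [sq_nonneg ‖p.2‖])))

lemma heatKer_apply (p : (ℝ × ℝ) × E) : heatKer p =
    ((4 * Real.pi * 1) ^ (3 / 2 : ℝ))⁻¹ * Real.exp (-(3 / 16) * ‖p.2‖ ^ 2) := rfl

/-- The heat kernel exponent splits as `1/4 = 1/16 + 3/16`. Only the first part is fixed as
integration weight; the second leaves room for the distorted kernels to stay bounded relative to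
`gauss`. -/
lemma gauss_mul_heatKer (θ : ℝ × ℝ) (w : E) : gauss w * heatKer (θ, w) = heatKernel 1 w := by
  rw [heatKer_apply, gauss, heatKernel_eq, mul_left_comm, ← Real.exp_add]
  congr 2
  ring

lemma freeFlow_heatKer (f : E → Sym0) (x : E) (t : ℝ) :
    freeFlow heatKer f x t = heatFlow t f x := by
  simp only [freeFlow, gauss_mul_heatKer, heatFlow]

lemma duhamel_heatKer {a : ℝ} (ha : 0 < a) {g : E → ℝ → Sym0}
    (hg : ContinuousOn (fun p : E × ℝ => g p.1 p.2) (univ ×ˢ Ioi 0)) {M : ℝ}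
    (hM : ∀ x t, 0 < t → ‖g x t‖ ≤ M) (x : E) (t : ℝ) :
    duhamel a heatKer g x t =
      ∫ s in Ioo 0 t, Real.exp (-a * s) • heatFlow (t - s) (fun y => g y s) x := by
  have h := integrableOn_duhamelIntegrand ha heatKer hg hM x t
  rw [duhamel, Measure.volume_eq_prod, setIntegral_prod _ h]
  refine setIntegral_congr_fun measurableSet_Ioo fun s _ => ?_
  simp only [setIntegral_univ, duhamelIntegrand, gauss_mul_heatKer, heatFlow, ← integral_smul,
    smul_smul]

lemma integrableOn_heatFlow {a : ℝ} (ha : 0 < a) {g : E → ℝ → Sym0}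
    (hg : ContinuousOn (fun p : E × ℝ => g p.1 p.2) (univ ×ˢ Ioi 0)) {M : ℝ}
    (hM : ∀ x t, 0 < t → ‖g x t‖ ≤ M) (x : E) (t : ℝ) :
    IntegrableOn (fun s => Real.exp (-a * s) • heatFlow (t - s) (fun y => g y s) x) (Ioo 0 t) := by
  have h := integrableOn_duhamelIntegrand ha heatKer hg hM x t
  rw [IntegrableOn, Measure.volume_eq_prod, ← Measure.prod_restrict] at h
  refine h.integral_prod_left.congr (Eventually.of_forall fun s => ?_)
  simp only [Measure.restrict_univ, duhamelIntegrand, gauss_mul_heatKer, heatFlow,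
    ← integral_smul, smul_smul]

end FreeFlow

end QTensor

end

/-! ### Weighted decay of the heat flow, and the gain for data of mean zero. -/

noncomputable section

namespace QTensor

section Decay

variable {F : Type*} [NormedAddCommGroup F] [NormedSpace ℝ F]

/-- Submultiplicativity of the weight, from `1 + b + c ≤ (1 + b)(1 + c)`; it splits a weight in `x`
between `x - y` and `y`. -/
lemma one_add_rpow_le_mul {m a b c : ℝ} (hm : 0 ≤ m) (ha : 0 ≤ a) (hb : 0 ≤ b) (hc : 0 ≤ c)
    (h : a ≤ b + c) : (1 + a) ^ m ≤ (1 + b) ^ m * (1 + c) ^ m := by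
  rw [← Real.mul_rpow (by positivity) (by positivity)]
  exact Real.rpow_le_rpow (by positivity) (by nlinarith [mul_nonneg hb hc]) hm

lemma integrable_one_add_norm_neg {r : ℝ} (hr : 3 < r) :
    Integrable fun y : E => (1 + ‖y‖) ^ (-r) :=
  integrable_one_add_norm (by rw [finrank_euclideanSpace_fin]; exact_mod_cast hr)

lemma exists_heatKernel_mul_rpow_le {q : ℝ} (hq : 0 ≤ q) : ∃ C : ℝ, 0 < C ∧
    ∀ w : E, heatKernel 1 w * (1 + ‖w‖) ^ q ≤ C := by
  obtain ⟨C, hC, h⟩ := exists_heatKernel_le hq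
  refine ⟨C, hC, fun w => (h w).trans ?_⟩
  exact mul_le_of_le_one_right hC.le (Real.exp_le_one_iff.2 (by nlinarith [sq_nonneg ‖w‖]))

lemma heatKernel_eq_scaled {r : ℝ} (hr : 0 < r) (x : E) :
    heatKernel r x = (Real.sqrt r ^ 3)⁻¹ * heatKernel 1 ((Real.sqrt r)⁻¹ • x) := by
  rw [← heatKernel_smul hr, smul_inv_smul₀ (Real.sqrt_pos.2 hr).ne']

lemma sqrt_pow_three {r : ℝ} (hr : 0 ≤ r) : Real.sqrt r ^ 3 = r ^ (3 / 2 : ℝ) := by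
  rw [Real.sqrt_eq_rpow, ← Real.rpow_natCast, ← Real.rpow_mul hr]; norm_num

lemma norm_inv_sqrt_smul {r : ℝ} (x : E) : ‖(Real.sqrt r)⁻¹ • x‖ = ‖x‖ / Real.sqrt r := by
  rw [norm_smul, norm_inv, Real.norm_of_nonneg (Real.sqrt_nonneg _), inv_mul_eq_div]

/-- Pointwise decay of the heat kernel at all times, in the parabolic weight. -/
lemma exists_heatKernel_decay {m : ℝ} (hm : 0 ≤ m) : ∃ C : ℝ, 0 < C ∧ ∀ r : ℝ, 0 < r → ∀ x : E,
    (1 + ‖x‖ / Real.sqrt r) ^ m * heatKernel r x ≤ C * r ^ (-(3 / 2) : ℝ) := by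
  obtain ⟨C, hC, h⟩ := exists_heatKernel_mul_rpow_le hm
  refine ⟨C, hC, fun r hr x => ?_⟩
  have h1 := h ((Real.sqrt r)⁻¹ • x)
  rw [norm_inv_sqrt_smul] at h1
  rw [heatKernel_eq_scaled hr, sqrt_pow_three hr.le, Real.rpow_neg hr.le]
  calc _ = (r ^ (3 / 2 : ℝ))⁻¹ * (heatKernel 1 ((Real.sqrt r)⁻¹ • x) *
        (1 + ‖x‖ / Real.sqrt r) ^ m) := by ring
    _ ≤ (r ^ (3 / 2 : ℝ))⁻¹ * C := by gcongr
    _ = _ := mul_comm _ _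

lemma two_rpow_mul_le {t : ℝ} (ht : 1 ≤ t) {k : ℝ} (hk : 0 ≤ k) :
    t ^ (-k) ≤ 2 ^ k * (t + 1) ^ (-k) := by
  have h0 : 0 < t := by linarith
  rw [Real.rpow_neg h0.le, Real.rpow_neg (by positivity), ← div_eq_mul_inv,
    ← Real.div_rpow (by positivity) (by positivity), ← Real.inv_rpow h0.le]
  refine Real.rpow_le_rpow (by positivity) ?_ hk
  rw [inv_eq_one_div, div_le_div_iff₀ h0 (by positivity)]
  linarith

lemma one_le_two_rpow_mul {t : ℝ} (h0 : 0 < t) (ht : t ≤ 1) {k : ℝ} (hk : 0 ≤ k) :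
    1 ≤ 2 ^ k * (t + 1) ^ (-k) := by
  rw [Real.rpow_neg (by positivity), ← div_eq_mul_inv, ← Real.div_rpow (by positivity)
    (by positivity)]
  refine Real.one_le_rpow ?_ hk
  rw [le_div_iff₀ (by positivity)]
  linarith

lemma rpow_mul_rpow_neg_two_mul {r : ℝ} (hr : 0 ≤ r) (m : ℝ) :
    (1 + r) ^ m * (1 + r) ^ (-(2 * m)) = (1 + r) ^ (-m) := by
  rw [← Real.rpow_add (by positivity)]
  congr 1; ring

lemma div_sqrt_le {r s t : ℝ} (hr : 0 ≤ r) (hs : 0 < s) (hst : s ≤ t) :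
    r / Real.sqrt t ≤ r / Real.sqrt s :=
  div_le_div_of_nonneg_left hr (Real.sqrt_pos.2 hs) (Real.sqrt_le_sqrt hst)

lemma weight_mono {m r s t : ℝ} (hm : 0 ≤ m) (hr : 0 ≤ r) (hs : 0 < s) (hst : s ≤ t) :
    (1 + r / Real.sqrt t) ^ m ≤ (1 + r / Real.sqrt s) ^ m := by
  have := div_sqrt_le hr hs hst
  gcongr

/-- Decay of the heat flow of decaying data. -/
lemma exists_heatFlow_decay {m : ℝ} (hm : 3 < m) : ∃ C : ℝ, 0 < C ∧ ∀ (f : E → F) (M : ℝ), 0 ≤ M →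
    (∀ᵐ y, ‖f y‖ ≤ M * (1 + ‖y‖) ^ (-(2 * m))) → ∀ (t : ℝ), 0 < t → ∀ x : E,
      (1 + ‖x‖ / Real.sqrt (t + 1)) ^ m * ‖heatFlow t f x‖ ≤ C * M * (t + 1) ^ (-(3 / 2) : ℝ) := by
  have hm0 : 0 ≤ m := by linarith
  obtain ⟨C₁, hC₁, hker⟩ := exists_heatKernel_decay hm0
  set I₁ := ∫ y : E, (1 + ‖y‖) ^ (-m)
  set I₂ := ∫ w : E, heatKernel 1 w * (1 + ‖w‖) ^ m
  have hI₁ : 0 ≤ I₁ := integral_nonneg fun y => by positivity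
  have hI₂ : 0 ≤ I₂ := integral_nonneg fun y =>
    mul_nonneg (heatKernel_nonneg zero_le_one _) (by positivity)
  refine ⟨2 ^ (3 / 2 : ℝ) * (C₁ * I₁) + 2 ^ (3 / 2 : ℝ) * I₂ + 1, by positivity,
    fun f M hM hf t ht x => ?_⟩
  have hT : 0 < t + 1 := by linarith
  have hT1 : 1 ≤ Real.sqrt (t + 1) := Real.one_le_sqrt.2 (by linarith)
  have hW : 0 ≤ (1 + ‖x‖ / Real.sqrt (t + 1)) ^ m := by positivity
  have hdec : 0 ≤ (t + 1) ^ (-(3 / 2) : ℝ) := by positivity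
  -- For `t ≥ 1` the kernel absorbs the weight in `x - y` and gives `t^{-3/2}`; half of the datum's
  -- decay pays for the weight in `y`, and the other half is integrable as `m > 3`. For `t ≤ 1` the
  -- fixed Gaussian absorbs the weight in `w`, and no decay in time is needed.
  rcases le_total 1 t with h1 | h1
  · have hb : ‖heatFlow t f x‖ * (1 + ‖x‖ / Real.sqrt (t + 1)) ^ m ≤
        ∫ y : E, C₁ * t ^ (-(3 / 2) : ℝ) * M * (1 + ‖y‖) ^ (-m) := by
      rw [heatFlow_eq ht, ← Real.norm_of_nonneg hW, mul_comm, ← norm_smul, ← integral_smul]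
      refine norm_integral_le_of_norm_le
        ((integrable_one_add_norm_neg hm).const_mul _) (hf.mono fun y hy => ?_)
      rw [norm_smul, norm_smul, Real.norm_of_nonneg hW,
        Real.norm_of_nonneg (heatKernel_nonneg ht.le _)]
      have e1 : (1 + ‖x‖ / Real.sqrt (t + 1)) ^ m ≤
          (1 + ‖x - y‖ / Real.sqrt t) ^ m * (1 + ‖y‖) ^ m := by
        refine one_add_rpow_le_mul hm0 (by positivity) (by positivity) (norm_nonneg _) ?_
        have e2 : ‖x‖ ≤ ‖x - y‖ + ‖y‖ := by simpa using norm_add_le (x - y) y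
        have e3 : ‖y‖ / Real.sqrt (t + 1) ≤ ‖y‖ := div_le_self (norm_nonneg _) hT1
        calc ‖x‖ / Real.sqrt (t + 1) ≤ (‖x - y‖ + ‖y‖) / Real.sqrt (t + 1) := by gcongr
          _ = ‖x - y‖ / Real.sqrt (t + 1) + ‖y‖ / Real.sqrt (t + 1) := add_div _ _ _
          _ ≤ _ := add_le_add (div_sqrt_le (norm_nonneg _) ht (by linarith)) e3
      have e4 := hker t ht (x - y)
      have hk := heatKernel_nonneg ht.le (x - y)
      calc (1 + ‖x‖ / Real.sqrt (t + 1)) ^ m * (heatKernel t (x - y) * ‖f y‖)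
          ≤ ((1 + ‖x - y‖ / Real.sqrt t) ^ m * (1 + ‖y‖) ^ m) *
              (heatKernel t (x - y) * (M * (1 + ‖y‖) ^ (-(2 * m)))) := by gcongr
        _ = ((1 + ‖x - y‖ / Real.sqrt t) ^ m * heatKernel t (x - y)) * (M *
              ((1 + ‖y‖) ^ m * (1 + ‖y‖) ^ (-(2 * m)))) := by ring
        _ ≤ (C₁ * t ^ (-(3 / 2) : ℝ)) * (M * (1 + ‖y‖) ^ (-m)) := by
            rw [rpow_mul_rpow_neg_two_mul (norm_nonneg y)]; gcongr
        _ = _ := by ring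
    rw [integral_const_mul] at hb
    rw [mul_comm]
    have e5 := two_rpow_mul_le h1 (k := 3 / 2) (by norm_num)
    calc _ ≤ C₁ * t ^ (-(3 / 2) : ℝ) * M * I₁ := hb
      _ ≤ C₁ * (2 ^ (3 / 2 : ℝ) * (t + 1) ^ (-(3 / 2) : ℝ)) * M * I₁ := by gcongr
      _ = (2 ^ (3 / 2 : ℝ) * (C₁ * I₁)) * M * (t + 1) ^ (-(3 / 2) : ℝ) := by ring
      _ ≤ _ := by
          gcongr
          have : 0 ≤ (2 : ℝ) ^ (3 / 2 : ℝ) * I₂ := by positivity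
          linarith
  · have hst : Real.sqrt t ≤ 1 := Real.sqrt_le_one.2 h1
    have hq := quasiMeasurePreserving_sub_smul x (Real.sqrt_pos.2 ht)
    have hb : ‖heatFlow t f x‖ * (1 + ‖x‖ / Real.sqrt (t + 1)) ^ m ≤
        ∫ w : E, M * (heatKernel 1 w * (1 + ‖w‖) ^ m) := by
      rw [heatFlow, ← Real.norm_of_nonneg hW, mul_comm, ← norm_smul, ← integral_smul]
      refine norm_integral_le_of_norm_le
        ((integrable_heatKernel_mul_rpow hm0).const_mul _) ((hq.ae hf).mono fun w hw => ?_)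
      rw [norm_smul, norm_smul, Real.norm_of_nonneg hW,
        Real.norm_of_nonneg (heatKernel_nonneg zero_le_one _)]
      set y := x - Real.sqrt t • w
      have e1 : (1 + ‖x‖ / Real.sqrt (t + 1)) ^ m ≤ (1 + ‖y‖) ^ m * (1 + ‖w‖) ^ m := by
        refine one_add_rpow_le_mul hm0 (by positivity) (by positivity) (norm_nonneg _) ?_
        refine (div_le_self (norm_nonneg _) hT1).trans ?_
        have e2 : x = y + Real.sqrt t • w := by simp [y]
        have e3 : ‖Real.sqrt t • w‖ ≤ ‖w‖ := by
          rw [norm_smul, Real.norm_of_nonneg (Real.sqrt_nonneg _)]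
          exact mul_le_of_le_one_left (norm_nonneg _) hst
        calc ‖x‖ ≤ ‖y‖ + ‖Real.sqrt t • w‖ := by
              conv_lhs => rw [e2]
              exact norm_add_le _ _
          _ ≤ _ := by gcongr
      have hk := heatKernel_nonneg zero_le_one w
      have e6 : (1 + ‖y‖) ^ (-m) ≤ 1 :=
        Real.rpow_le_one_of_one_le_of_nonpos (by linarith [norm_nonneg y]) (by linarith)
      calc (1 + ‖x‖ / Real.sqrt (t + 1)) ^ m * (heatKernel 1 w * ‖f y‖)
          ≤ ((1 + ‖y‖) ^ m * (1 + ‖w‖) ^ m) *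
              (heatKernel 1 w * (M * (1 + ‖y‖) ^ (-(2 * m)))) := by gcongr
        _ = (heatKernel 1 w * (1 + ‖w‖) ^ m) * (M *
              ((1 + ‖y‖) ^ m * (1 + ‖y‖) ^ (-(2 * m)))) := by ring
        _ ≤ (heatKernel 1 w * (1 + ‖w‖) ^ m) * (M * 1) := by
            rw [rpow_mul_rpow_neg_two_mul (norm_nonneg y)]; gcongr
        _ = _ := by ring
    rw [integral_const_mul] at hb
    rw [mul_comm]
    have e5 := one_le_two_rpow_mul ht h1 (k := 3 / 2) (by norm_num)
    calc _ ≤ M * I₂ * 1 := by rw [mul_one]; exact hb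
      _ ≤ M * I₂ * (2 ^ (3 / 2 : ℝ) * (t + 1) ^ (-(3 / 2) : ℝ)) := by gcongr
      _ = (2 ^ (3 / 2 : ℝ) * I₂) * M * (t + 1) ^ (-(3 / 2) : ℝ) := by ring
      _ ≤ _ := by
          gcongr
          have : 0 ≤ (2 : ℝ) ^ (3 / 2 : ℝ) * (C₁ * I₁) := by positivity
          linarith

/-- Decay of differences of the heat kernel. -/
lemma exists_heatKernel_sub_le {m : ℝ} (hm : 0 ≤ m) : ∃ C : ℝ, 0 < C ∧ ∀ u v : E,
    (1 + ‖u‖) ^ m * |heatKernel 1 (u - v) - heatKernel 1 u| ≤ C * ‖v‖ * (1 + ‖v‖) ^ m := by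
  obtain ⟨C, hC, hker⟩ := exists_heatKernel_mul_rpow_le (q := m + 1) (by linarith)
  refine ⟨C, hC, fun u v => ?_⟩
  -- Mean value theorem along the segment from `u` to `u - v`. There `|u| ≤ |z| + |v|`, so the
  -- weight at `u` is paid by the Gaussian at `z` and by `(1 + |v|)^m`.
  have hgrad : ∀ z ∈ segment ℝ u (u - v), ‖fderiv ℝ (heatKernel 1) z‖ ≤
      C * (1 + ‖v‖) ^ m / (1 + ‖u‖) ^ m := by
    intro z hz
    have hzu : ‖u‖ ≤ ‖z‖ + ‖v‖ := by
      obtain ⟨σ, hσ, rfl⟩ := (segment_eq_image' ℝ u (u - v)).subset hz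
      have e : u = (u + σ • (u - v - u)) + σ • v := by simp
      calc ‖u‖ = ‖(u + σ • (u - v - u)) + σ • v‖ := by rw [← e]
        _ ≤ ‖u + σ • (u - v - u)‖ + ‖σ • v‖ := norm_add_le _ _
        _ ≤ _ := by
          gcongr
          rw [norm_smul, Real.norm_of_nonneg hσ.1]
          exact mul_le_of_le_one_left (norm_nonneg _) hσ.2
    have hk := heatKernel_nonneg zero_le_one z
    have h1 : ‖fderiv ℝ (heatKernel 1) z‖ ≤ (1 + ‖z‖) * heatKernel 1 z := by
      refine ContinuousLinearMap.opNorm_le_bound _ (by positivity) fun y => ?_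
      rw [fderiv_heatKernel_one, norm_mul, norm_mul, Real.norm_of_nonneg hk, Real.norm_eq_abs,
        Real.norm_eq_abs]
      have h2 := abs_real_inner_le_norm z y
      calc |(-(1 / 2) : ℝ)| * |inner ℝ z y| * heatKernel 1 z
          ≤ 1 * (‖z‖ * ‖y‖) * heatKernel 1 z := by
            gcongr
            norm_num [abs_of_pos]
        _ ≤ (1 + ‖z‖) * heatKernel 1 z * ‖y‖ := by
            nlinarith [mul_nonneg hk (norm_nonneg y)]
    refine h1.trans ?_
    rw [le_div_iff₀ (by positivity)]
    have h3 := one_add_rpow_le_mul hm (norm_nonneg u) (norm_nonneg z) (norm_nonneg v) hzu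
    have h4 := hker z
    rw [Real.rpow_add (by positivity), Real.rpow_one] at h4
    calc (1 + ‖z‖) * heatKernel 1 z * (1 + ‖u‖) ^ m
        ≤ (1 + ‖z‖) * heatKernel 1 z * ((1 + ‖z‖) ^ m * (1 + ‖v‖) ^ m) := by gcongr
      _ = heatKernel 1 z * ((1 + ‖z‖) ^ m * (1 + ‖z‖)) * (1 + ‖v‖) ^ m := by ring
      _ ≤ _ := by gcongr
  have hmv := (convex_segment u (u - v)).norm_image_sub_le_of_norm_fderiv_le
    (fun z _ => differentiable_heatKernel_one z) hgrad (left_mem_segment ℝ u (u - v))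
    (right_mem_segment ℝ u (u - v))
  rw [Real.norm_eq_abs, sub_sub_cancel_left, norm_neg, div_mul_eq_mul_div,
    le_div_iff₀ (by positivity)] at hmv
  calc _ = |heatKernel 1 (u - v) - heatKernel 1 u| * (1 + ‖u‖) ^ m := mul_comm _ _
    _ ≤ _ := hmv
    _ = _ := by ring

lemma integrable_of_decay {G : Type*} [NormedAddCommGroup G] {m : ℝ} (hm : 3 < m) {f : E → G} {M : ℝ}
    (hfm : AEStronglyMeasurable f (volume : Measure E))
    (hf : ∀ᵐ y, ‖f y‖ ≤ M * (1 + ‖y‖) ^ (-(2 * m))) : Integrable f :=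
  ((integrable_one_add_norm_neg (by linarith)).const_mul M).mono' hfm hf

/-- The heat flow of decaying data with vanishing mean decays faster. -/
lemma exists_heatFlow_decay_of_integral_eq_zero [CompleteSpace F] {m : ℝ} (hm : 4 < m) :
    ∃ C : ℝ, 0 < C ∧ ∀ (f : E → F) (M : ℝ), 0 ≤ M →
    AEStronglyMeasurable f (volume : Measure E) →
    (∀ᵐ y, ‖f y‖ ≤ M * (1 + ‖y‖) ^ (-(2 * m))) → ∫ y, f y = 0 → ∀ (t : ℝ), 0 < t → ∀ x : E,
      (1 + ‖x‖ / Real.sqrt (t + 1)) ^ m * ‖heatFlow t f x‖ ≤ C * M * (t + 1) ^ (-2 : ℝ) := by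
  have hm0 : 0 ≤ m := by linarith
  obtain ⟨C₁, hC₁, hlin⟩ := exists_heatFlow_decay (F := F) (m := m) (by linarith)
  obtain ⟨C₂, hC₂, hker⟩ := exists_heatKernel_sub_le hm0
  set I₁ := ∫ y : E, (1 + ‖y‖) ^ (-(m - 1))
  have hI₁ : 0 ≤ I₁ := integral_nonneg fun y => by positivity
  refine ⟨2 ^ (2 : ℝ) * (C₂ * I₁) + 2 ^ (1 / 2 : ℝ) * C₁, by positivity,
    fun f M hM hfm hf hz t ht x => ?_⟩
  have hT : 0 < t + 1 := by linarith
  have hW : 0 ≤ (1 + ‖x‖ / Real.sqrt (t + 1)) ^ m := by positivity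
  rcases le_total 1 t with h1 | h1
  · have hs1 : 1 ≤ Real.sqrt t := Real.one_le_sqrt.2 h1
    have hs0 : 0 < Real.sqrt t := by linarith
    have hfi := integrable_of_decay (by linarith) hfm hf
    -- Vanishing mean allows subtraction of the kernel at `x`. The difference gains `|y| / √t`,
    -- which costs one power of `|y|`; integrability of what remains requires `m - 1 > 3`.
    have hrepr : heatFlow t f x = ∫ y, (heatKernel t (x - y) - heatKernel t x) • f y := by
      rw [heatFlow_eq ht]
      have i1 : Integrable fun y => heatKernel t (x - y) • f y := by
        refine (hfi.norm.const_mul (heatKernel t 0)).mono'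
          (((continuous_heatKernel t).comp (by fun_prop)).aestronglyMeasurable.smul hfm)
          (Eventually.of_forall fun y => ?_)
        rw [norm_smul, Real.norm_of_nonneg (heatKernel_nonneg ht.le _)]
        gcongr
        simp only [heatKernel]
        gcongr
        rw [norm_zero]
        exact norm_nonneg _
      have i2 : Integrable fun y => heatKernel t x • f y := hfi.smul _
      simp only [sub_smul]
      rw [integral_sub i1 i2, integral_smul, hz, smul_zero, sub_zero]
    have hb : (1 + ‖x‖ / Real.sqrt (t + 1)) ^ m * ‖heatFlow t f x‖ ≤
        ∫ y : E, C₂ * t ^ (-2 : ℝ) * M * (1 + ‖y‖) ^ (-(m - 1)) := by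
      rw [hrepr, ← Real.norm_of_nonneg hW, ← norm_smul, ← integral_smul]
      refine norm_integral_le_of_norm_le
        ((integrable_one_add_norm_neg (by linarith)).const_mul _) (hf.mono fun y hy => ?_)
      rw [norm_smul, norm_smul, Real.norm_of_nonneg hW, Real.norm_eq_abs]
      have e1 := hker ((Real.sqrt t)⁻¹ • x) ((Real.sqrt t)⁻¹ • y)
      rw [← smul_sub, norm_inv_sqrt_smul, norm_inv_sqrt_smul] at e1
      have e2 := weight_mono hm0 (norm_nonneg x) ht (by linarith : t ≤ t + 1)
      have e3 : (1 + ‖y‖ / Real.sqrt t) ^ m ≤ (1 + ‖y‖) ^ m := by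
        have := div_le_self (norm_nonneg y) hs1
        gcongr
      have e4 : t ^ (-2 : ℝ) = (Real.sqrt t ^ 3)⁻¹ * (Real.sqrt t)⁻¹ := by
        rw [← mul_inv, ← pow_succ, show Real.sqrt t ^ (3 + 1) = (Real.sqrt t ^ 2) ^ 2 by ring,
          Real.sq_sqrt ht.le, Real.rpow_neg ht.le]
        norm_num
      have e5 : ‖y‖ * (1 + ‖y‖) ^ (-m) ≤ (1 + ‖y‖) ^ (-(m - 1)) := by
        have : (1 + ‖y‖) ^ (-(m - 1)) = (1 + ‖y‖) * (1 + ‖y‖) ^ (-m) := by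
          rw [show -(m - 1) = 1 + -m by ring, Real.rpow_add (by positivity), Real.rpow_one]
        rw [this]
        gcongr
        linarith
      calc (1 + ‖x‖ / Real.sqrt (t + 1)) ^ m * (|heatKernel t (x - y) - heatKernel t x| * ‖f y‖)
          ≤ (1 + ‖x‖ / Real.sqrt t) ^ m * (|heatKernel t (x - y) - heatKernel t x| *
              (M * (1 + ‖y‖) ^ (-(2 * m)))) := by gcongr
        _ = (Real.sqrt t ^ 3)⁻¹ * ((1 + ‖x‖ / Real.sqrt t) ^ m *
              |heatKernel 1 ((Real.sqrt t)⁻¹ • (x - y)) - heatKernel 1 ((Real.sqrt t)⁻¹ • x)|) *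
              (M * (1 + ‖y‖) ^ (-(2 * m))) := by
            rw [heatKernel_eq_scaled ht (x - y), heatKernel_eq_scaled ht x, ← mul_sub, abs_mul,
              abs_of_pos (by positivity : 0 < (Real.sqrt t ^ 3)⁻¹)]
            ring
        _ ≤ (Real.sqrt t ^ 3)⁻¹ * (C₂ * (‖y‖ / Real.sqrt t) * (1 + ‖y‖) ^ m) *
              (M * (1 + ‖y‖) ^ (-(2 * m))) := by
            refine mul_le_mul_of_nonneg_right (mul_le_mul_of_nonneg_left
              (e1.trans ?_) (by positivity)) (by positivity)
            gcongr
        _ = C₂ * ((Real.sqrt t ^ 3)⁻¹ * (Real.sqrt t)⁻¹) * M *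
              (‖y‖ * ((1 + ‖y‖) ^ m * (1 + ‖y‖) ^ (-(2 * m)))) := by
            rw [div_eq_mul_inv]; ring
        _ ≤ C₂ * t ^ (-2 : ℝ) * M * (1 + ‖y‖) ^ (-(m - 1)) := by
            rw [rpow_mul_rpow_neg_two_mul (norm_nonneg y), ← e4]; gcongr
    rw [integral_const_mul] at hb
    have e5 := two_rpow_mul_le h1 (k := 2) (by norm_num)
    calc _ ≤ C₂ * t ^ (-2 : ℝ) * M * I₁ := hb
      _ ≤ C₂ * (2 ^ (2 : ℝ) * (t + 1) ^ (-2 : ℝ)) * M * I₁ := by gcongr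
      _ = (2 ^ (2 : ℝ) * (C₂ * I₁)) * M * (t + 1) ^ (-2 : ℝ) := by ring
      _ ≤ _ := by
          gcongr
          have : 0 ≤ (2 : ℝ) ^ (1 / 2 : ℝ) * C₁ := by positivity
          linarith
  -- For `t ≤ 1` cancellation is not needed, since the extra factor `(t + 1)^{-1/2}` is bounded
  -- below.
  · have e5 := one_le_two_rpow_mul ht h1 (k := 1 / 2) (by norm_num)
    have e6 : (t + 1) ^ (-2 : ℝ) = (t + 1) ^ (-(3 / 2) : ℝ) * (t + 1) ^ (-(1 / 2) : ℝ) := by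
      rw [← Real.rpow_add hT]; norm_num
    have e7 : 0 ≤ (t + 1) ^ (-(3 / 2) : ℝ) := by positivity
    calc _ ≤ C₁ * M * (t + 1) ^ (-(3 / 2) : ℝ) * 1 := by
          rw [mul_one]; exact hlin f M hM hf t ht x
      _ ≤ C₁ * M * (t + 1) ^ (-(3 / 2) : ℝ) * (2 ^ (1 / 2 : ℝ) * (t + 1) ^ (-(1 / 2) : ℝ)) := by
          gcongr
      _ = (2 ^ (1 / 2 : ℝ) * C₁) * M * (t + 1) ^ (-2 : ℝ) := by rw [e6]; ring
      _ ≤ _ := by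
          gcongr
          have : 0 ≤ (2 : ℝ) ^ (2 : ℝ) * (C₂ * I₁) := by positivity
          linarith

end Decay

end QTensor

end

/-! ### Gaussian profile and remainder, for the free flow and for Duhamel integrals. -/

noncomputable section

namespace QTensor

section Remainder

variable {F : Type*} [NormedAddCommGroup F] [NormedSpace ℝ F]

lemma heatKernel_le_zero {r : ℝ} (hr : 0 < r) (x : E) : heatKernel r x ≤ heatKernel r 0 := by
  simp only [heatKernel]
  gcongr
  rw [norm_zero]
  exact norm_nonneg _

lemma integrable_heatKernel_smul {r : ℝ} (hr : 0 < r) {f : E → F} (hf : Integrable f) (x : E) :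
    Integrable fun y => heatKernel r (x - y) • f y := by
  refine (hf.norm.const_mul (heatKernel r 0)).mono'
    (((continuous_heatKernel r).comp (by fun_prop)).aestronglyMeasurable.smul hf.1)
    (Eventually.of_forall fun y => ?_)
  rw [norm_smul, Real.norm_of_nonneg (heatKernel_nonneg hr.le _)]
  exact mul_le_mul_of_nonneg_right (heatKernel_le_zero hr _) (norm_nonneg _)

lemma heatFlow_heatKernel_smul [CompleteSpace F] {r σ : ℝ} (hr : 0 < r) (hσ : 0 < σ) (A : F)
    (x : E) : heatFlow r (fun y => heatKernel σ y • A) x = heatKernel (r + σ) x • A := by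
  rw [heatFlow_eq hr]
  simp_rw [smul_smul]
  rw [integral_smul_const, integral_heatKernel_mul hr hσ]

lemma heatFlow_sub {r : ℝ} (hr : 0 < r) {f g : E → F} (hf : Integrable f) (hg : Integrable g)
    (x : E) : heatFlow r (fun y => f y - g y) x = heatFlow r f x - heatFlow r g x := by
  rw [heatFlow_eq hr, heatFlow_eq hr, heatFlow_eq hr,
    ← integral_sub (integrable_heatKernel_smul hr hf x) (integrable_heatKernel_smul hr hg x)]
  simp_rw [smul_sub]

/-- From `1 + r ≤ √σ (1 + r/√σ)`. The loss `σ^m` in passing from the parabolic to the flat weight is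
harmless because it is always integrated against `e^{-as}` with `σ = s + 1`. -/
lemma one_add_norm_rpow_le {σ : ℝ} (hσ : 1 ≤ σ) {m : ℝ} (hm : 0 ≤ m) {r : ℝ} (hr : 0 ≤ r) :
    (1 + r) ^ (2 * m) ≤ σ ^ m * (1 + r / Real.sqrt σ) ^ (2 * m) := by
  have h0 : 0 < σ := by linarith
  have h1 : 1 ≤ Real.sqrt σ := Real.one_le_sqrt.2 hσ
  have h2 : σ ^ m = Real.sqrt σ ^ (2 * m) := by
    rw [Real.sqrt_eq_rpow, ← Real.rpow_mul h0.le]; congr 1; ring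
  rw [h2, ← Real.mul_rpow (by positivity) (by positivity)]
  refine Real.rpow_le_rpow (by positivity) ?_ (by positivity)
  rw [mul_add, mul_one, mul_div_cancel₀ _ (by positivity : Real.sqrt σ ≠ 0)]
  linarith

/-- The heat kernel at time `σ` as a datum. -/
lemma exists_heatKernel_datum {m : ℝ} (hm : 0 ≤ m) : ∃ C : ℝ, 0 < C ∧ ∀ σ : ℝ, 1 ≤ σ → ∀ y : E,
    heatKernel σ y ≤ C * σ ^ m * (1 + ‖y‖) ^ (-(2 * m)) := by
  obtain ⟨C, hC, h⟩ := exists_heatKernel_decay (m := 2 * m) (by linarith)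
  refine ⟨C, hC, fun σ hσ y => ?_⟩
  have h0 : 0 < σ := by linarith
  have hk := heatKernel_nonneg h0.le y
  have h2 : σ ^ (-(3 / 2) : ℝ) ≤ 1 := Real.rpow_le_one_of_one_le_of_nonpos hσ (by norm_num)
  rw [Real.rpow_neg (by positivity), ← div_eq_mul_inv, le_div_iff₀ (by positivity)]
  calc heatKernel σ y * (1 + ‖y‖) ^ (2 * m)
      ≤ heatKernel σ y * (σ ^ m * (1 + ‖y‖ / Real.sqrt σ) ^ (2 * m)) := by
        gcongr
        exact one_add_norm_rpow_le hσ hm (norm_nonneg y)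
    _ = σ ^ m * ((1 + ‖y‖ / Real.sqrt σ) ^ (2 * m) * heatKernel σ y) := by ring
    _ ≤ σ ^ m * (C * 1) := by
        refine mul_le_mul_of_nonneg_left ((h σ h0 y).trans ?_) (by positivity)
        gcongr
    _ = C * σ ^ m := by ring

lemma norm_integral_le_of_decay {m : ℝ} (hm : 3 < m) {f : E → F} {M : ℝ}
    (hf : ∀ᵐ y, ‖f y‖ ≤ M * (1 + ‖y‖) ^ (-(2 * m))) :
    ‖∫ y, f y‖ ≤ (∫ y : E, (1 + ‖y‖) ^ (-(2 * m))) * M := by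
  rw [mul_comm, ← integral_const_mul]
  exact norm_integral_le_of_norm_le
    ((integrable_one_add_norm_neg (by linarith)).const_mul M) hf

/-- The heat flow of decaying data is, to leading order, a multiple of the heat kernel. -/
lemma exists_heatFlow_remainder [CompleteSpace F] {m : ℝ} (hm : 4 < m) :
    ∃ C : ℝ, 0 < C ∧ ∀ (f : E → F) (M : ℝ), 0 ≤ M →
    AEStronglyMeasurable f (volume : Measure E) →
    (∀ᵐ y, ‖f y‖ ≤ M * (1 + ‖y‖) ^ (-(2 * m))) → ∀ σ : ℝ, 1 ≤ σ → ∀ (t : ℝ), 0 < t → ∀ x : E,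
      (1 + ‖x‖ / Real.sqrt (t + 1)) ^ m * ‖heatFlow t f x - heatKernel (t + σ) x • ∫ y, f y‖ ≤
        C * M * σ ^ m * (t + 1) ^ (-2 : ℝ) := by
  have hm0 : 0 ≤ m := by linarith
  obtain ⟨C₁, hC₁, hz⟩ := exists_heatFlow_decay_of_integral_eq_zero (F := F) hm
  obtain ⟨C₂, hC₂, hker⟩ := exists_heatKernel_datum hm0
  set I := ∫ y : E, (1 + ‖y‖) ^ (-(2 * m))
  have hI : 0 ≤ I := integral_nonneg fun y => by positivity
  refine ⟨C₁ * (1 + C₂ * I), by positivity, fun f M hM hfm hf σ hσ t ht x => ?_⟩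
  have hσ0 : 0 < σ := by linarith
  set A := ∫ y, f y with hA
  have hAle : ‖A‖ ≤ I * M := norm_integral_le_of_decay (by linarith) hf
  have hfi := integrable_of_decay (by linarith) hfm hf
  have hki : Integrable fun y => heatKernel σ y • A := (integrable_heatKernel hσ0).smul_const A
  -- The profile is itself the heat flow of a Gaussian of age `σ` with the same mass as `f`, so the
  -- difference is the flow of a mean-zero datum.
  have e1 : heatFlow t f x - heatKernel (t + σ) x • A =
      heatFlow t (fun y => f y - heatKernel σ y • A) x := by
    rw [heatFlow_sub ht hfi hki, heatFlow_heatKernel_smul ht hσ0]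
  rw [e1]
  have hσm : 1 ≤ σ ^ m := Real.one_le_rpow hσ hm0
  have h := hz (fun y => f y - heatKernel σ y • A) ((1 + C₂ * I) * M * σ ^ m) (by positivity)
    (hfm.sub hki.1) (hf.mono fun y hy => ?_) (by
      rw [integral_sub hfi hki, integral_smul_const, integral_heatKernel hσ0, one_smul, sub_self])
    t ht x
  · exact h.trans (le_of_eq (by ring))
  · refine (norm_sub_le _ _).trans ?_
    rw [norm_smul, Real.norm_of_nonneg (heatKernel_nonneg hσ0.le _)]
    have hp : 0 ≤ (1 + ‖y‖) ^ (-(2 * m)) := by positivity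
    calc ‖f y‖ + heatKernel σ y * ‖A‖
        ≤ M * (1 + ‖y‖) ^ (-(2 * m)) + (C₂ * σ ^ m * (1 + ‖y‖) ^ (-(2 * m))) * (I * M) := by
          have := hker σ hσ y
          have := heatKernel_nonneg hσ0.le y
          gcongr
      _ = (M * 1 + C₂ * I * M * σ ^ m) * (1 + ‖y‖) ^ (-(2 * m)) := by ring
      _ ≤ (M * σ ^ m + C₂ * I * M * σ ^ m) * (1 + ‖y‖) ^ (-(2 * m)) := by gcongr
      _ = _ := by ring

end Remainder

/-! ### Polynomial moments of the exponential damping. -/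

section ExpMoments

/-- For `ρ ≤ 1` one has `s + 1 ≤ ρ⁻¹ e^{ρs}`. The choice `ρ = ε/(q + ε)` meets both `ρ ≤ 1` and `ρq
≤ ε`. -/
lemma exists_rpow_le_exp {q ε : ℝ} (hq : 0 ≤ q) (hε : 0 < ε) : ∃ C : ℝ, 0 < C ∧
    ∀ s : ℝ, 0 ≤ s → (s + 1) ^ q ≤ C * Real.exp (ε * s) := by
  set ρ := ε / (q + ε) with hρ
  have hρ0 : 0 < ρ := by positivity
  have hρ1 : ρ ≤ 1 := (div_le_one (by positivity)).2 (by linarith)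
  refine ⟨(1 / ρ) ^ q, by positivity, fun s hs => ?_⟩
  have h1 : s + 1 ≤ 1 / ρ * Real.exp (ρ * s) := by
    rw [div_mul_eq_mul_div, one_mul, le_div_iff₀ hρ0]
    nlinarith [Real.add_one_le_exp (ρ * s)]
  calc (s + 1) ^ q ≤ (1 / ρ * Real.exp (ρ * s)) ^ q := by gcongr
    _ = (1 / ρ) ^ q * Real.exp (ρ * s * q) := by
        rw [Real.mul_rpow (by positivity) (by positivity), Real.exp_mul (ρ * s) q]
    _ ≤ (1 / ρ) ^ q * Real.exp (ε * s) := by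
        have : ρ * q ≤ ε := by
          rw [hρ, div_mul_eq_mul_div, div_le_iff₀ (by positivity)]
          nlinarith
        exact mul_le_mul_of_nonneg_left (Real.exp_le_exp.2 (by nlinarith)) (by positivity)

variable {a q : ℝ}

lemma continuousOn_exp_mul_rpow (a q : ℝ) :
    ContinuousOn (fun s : ℝ => Real.exp (-a * s) * (s + 1) ^ q) (Ioi 0) := by
  refine ContinuousOn.mul (by fun_prop) (ContinuousOn.rpow_const (by fun_prop) fun s hs => ?_)
  exact Or.inl (add_pos hs one_pos).ne'

lemma integrableOn_exp_mul_rpow (ha : 0 < a) (hq : 0 ≤ q) :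
    IntegrableOn (fun s : ℝ => Real.exp (-a * s) * (s + 1) ^ q) (Ioi 0) := by
  obtain ⟨C, hC, h⟩ := exists_rpow_le_exp hq (half_pos ha)
  refine ((exp_neg_integrableOn_Ioi 0 (half_pos ha)).const_mul C).mono'
    ((continuousOn_exp_mul_rpow a q).aestronglyMeasurable measurableSet_Ioi)
    ((ae_restrict_mem measurableSet_Ioi).mono fun s hs => ?_)
  have hs0 : 0 < s := hs
  rw [Real.norm_of_nonneg (by positivity)]
  calc Real.exp (-a * s) * (s + 1) ^ q
      ≤ Real.exp (-a * s) * (C * Real.exp (a / 2 * s)) := by gcongr; exact h s hs0.le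
    _ = C * Real.exp (-(a / 2) * s) := by
        rw [mul_left_comm, ← Real.exp_add]; congr 2; ring

lemma exists_exp_mul_rpow_le (ha : 0 < a) (hq : 0 ≤ q) : ∃ C : ℝ, 0 < C ∧
    ∀ s : ℝ, 0 ≤ s → Real.exp (-a * s) * (s + 1) ^ q ≤ C := by
  obtain ⟨C, hC, h⟩ := exists_rpow_le_exp hq ha
  refine ⟨C, hC, fun s hs => ?_⟩
  calc Real.exp (-a * s) * (s + 1) ^ q ≤ Real.exp (-a * s) * (C * Real.exp (a * s)) := by
        gcongr; exact h s hs
    _ = C := by rw [mul_left_comm, ← Real.exp_add]; simp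

end ExpMoments

/-! ### Decay and asymptotic profile of Duhamel integrals. -/

section DuhamelDecay

variable {a m : ℝ}

/-- From `t + 1 ≤ (s + 1)(t - s + 1)`: decay in the elapsed time becomes decay in `t`, at the price
of a power of `s + 1` that the damping absorbs. -/
lemma shift_rpow_neg_le {s t : ℝ} (hs : 0 < s) (hst : s < t) {k : ℝ} (hk : 0 ≤ k) :
    (t - s + 1) ^ (-k) ≤ (s + 1) ^ k * (t + 1) ^ (-k) := by
  have h1 : 0 < t - s + 1 := by linarith
  rw [Real.rpow_neg h1.le, Real.rpow_neg (by linarith), ← div_eq_mul_inv,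
    ← Real.div_rpow (by linarith) (by linarith), ← Real.inv_rpow h1.le]
  refine Real.rpow_le_rpow (by positivity) ?_ hk
  rw [inv_eq_one_div, div_le_div_iff₀ h1 (by linarith)]
  nlinarith

/-- Decay of the Duhamel integral. -/
lemma exists_duhamel_decay (ha : 0 < a) (hm : 3 < m) : ∃ C : ℝ, 0 < C ∧
    ∀ (g : E → ℝ → Sym0), ContinuousOn (fun p : E × ℝ => g p.1 p.2) (univ ×ˢ Ioi 0) →
    ∀ L M : ℝ, 0 ≤ M → (∀ y s, 0 < s → ‖g y s‖ ≤ L) →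
    (∀ y s, 0 < s → ‖g y s‖ ≤ M * (s + 1) ^ m * (1 + ‖y‖) ^ (-(2 * m))) →
    ∀ (t : ℝ), 0 < t → ∀ x : E,
      (1 + ‖x‖ / Real.sqrt (t + 1)) ^ m * ‖duhamel a heatKer g x t‖ ≤
        C * M * min 1 t * (t + 1) ^ (-(3 / 2) : ℝ) := by
  have hm0 : 0 ≤ m := by linarith
  obtain ⟨C₁, hC₁, hlin⟩ := exists_heatFlow_decay (F := Sym0) hm
  obtain ⟨C₂, hC₂, hsup⟩ := exists_exp_mul_rpow_le ha (q := m + 3 / 2) (by linarith)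
  have hint := integrableOn_exp_mul_rpow ha (q := m + 3 / 2) (by linarith)
  set J := ∫ s in Ioi 0, Real.exp (-a * s) * (s + 1) ^ (m + 3 / 2)
  have hJ : 0 ≤ J := setIntegral_nonneg measurableSet_Ioi fun s hs => by
    have : (0 : ℝ) < s := hs
    positivity
  refine ⟨C₁ * (J + C₂), by positivity, fun g hg L M hM hL hdec t ht x => ?_⟩
  have hW : 0 ≤ (1 + ‖x‖ / Real.sqrt (t + 1)) ^ m := by positivity
  have hT : 0 ≤ (t + 1) ^ (-(3 / 2) : ℝ) := by positivity
  have hsub : Ioo 0 t ⊆ Ioi (0 : ℝ) := fun s hs => hs.1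
  have hb : (1 + ‖x‖ / Real.sqrt (t + 1)) ^ m * ‖duhamel a heatKer g x t‖ ≤
      (C₁ * M * (t + 1) ^ (-(3 / 2) : ℝ)) *
        ∫ s in Ioo 0 t, Real.exp (-a * s) * (s + 1) ^ (m + 3 / 2) := by
    rw [duhamel_heatKer ha hg hL, ← Real.norm_of_nonneg hW, ← norm_smul, ← integral_smul,
      ← integral_const_mul]
    refine norm_integral_le_of_norm_le ((hint.mono_set hsub).const_mul _)
      ((ae_restrict_mem measurableSet_Ioo).mono fun s hs => ?_)
    have hs0 : 0 < s := hs.1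
    rw [norm_smul, norm_smul, Real.norm_of_nonneg hW, Real.norm_of_nonneg (Real.exp_pos _).le]
    have h1 := hlin (fun y => g y s) (M * (s + 1) ^ m) (by positivity)
      (Eventually.of_forall fun y => hdec y s hs0) (t - s) (sub_pos.2 hs.2) x
    have h2 := weight_mono hm0 (norm_nonneg x) (by linarith [hs.2] : 0 < t - s + 1)
      (by linarith : t - s + 1 ≤ t + 1)
    have h3 := shift_rpow_neg_le hs0 hs.2 (k := 3 / 2) (by norm_num)
    calc (1 + ‖x‖ / Real.sqrt (t + 1)) ^ m *
          (Real.exp (-a * s) * ‖heatFlow (t - s) (fun y => g y s) x‖)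
        = Real.exp (-a * s) * ((1 + ‖x‖ / Real.sqrt (t + 1)) ^ m *
            ‖heatFlow (t - s) (fun y => g y s) x‖) := by ring
      _ ≤ Real.exp (-a * s) * (C₁ * (M * (s + 1) ^ m) *
            ((s + 1) ^ (3 / 2 : ℝ) * (t + 1) ^ (-(3 / 2) : ℝ))) := by
          refine mul_le_mul_of_nonneg_left ?_ (Real.exp_pos _).le
          refine (mul_le_mul_of_nonneg_right h2 (norm_nonneg _)).trans (h1.trans ?_)
          exact mul_le_mul_of_nonneg_left h3 (by positivity)
      _ = _ := by rw [Real.rpow_add (by positivity)]; ring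
  -- The whole moment bounds the integral for large `t`, and the supremum times the length for small
  -- `t`. The factor `t` is what later makes the Duhamel term vanish at the initial time.
  have h4 : ∫ s in Ioo 0 t, Real.exp (-a * s) * (s + 1) ^ (m + 3 / 2) ≤ (J + C₂) * min 1 t := by
    rcases min_cases 1 t with ⟨h, -⟩ | ⟨h, -⟩
    · rw [h, mul_one]
      refine (setIntegral_mono_set hint ((ae_restrict_mem measurableSet_Ioi).mono fun s hs => ?_)
        hsub.eventuallyLE).trans (by linarith)
      have : (0 : ℝ) < s := hs
      simp only [Pi.zero_apply]
      positivity
    · rw [h]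
      calc ∫ s in Ioo 0 t, Real.exp (-a * s) * (s + 1) ^ (m + 3 / 2)
          ≤ ∫ s in Ioo 0 t, C₂ :=
            setIntegral_mono_on (hint.mono_set hsub) (integrableOn_const (by simp))
              measurableSet_Ioo fun s hs => hsup s hs.1.le
        _ = C₂ * t := by simp [ht.le, mul_comm]
        _ ≤ _ := by gcongr; linarith
  calc _ ≤ (C₁ * M * (t + 1) ^ (-(3 / 2) : ℝ)) * ((J + C₂) * min 1 t) :=
        hb.trans (mul_le_mul_of_nonneg_left h4 (by positivity))
    _ = _ := by ring

/-- The damped total mass of a source. -/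
def totalMass (a : ℝ) (g : E → ℝ → Sym0) : Sym0 :=
  ∫ s in Ioi 0, Real.exp (-a * s) • ∫ y, g y s

lemma integrableOn_mass (ha : 0 < a) (hm : 3 < m) {g : E → ℝ → Sym0}
    (hg : ContinuousOn (fun p : E × ℝ => g p.1 p.2) (univ ×ˢ Ioi 0)) {M : ℝ}
    (hdec : ∀ y s, 0 < s → ‖g y s‖ ≤ M * (s + 1) ^ m * (1 + ‖y‖) ^ (-(2 * m))) :
    IntegrableOn (fun s => Real.exp (-a * s) • ∫ y, g y s) (Ioi 0) := by
  have hms : MeasurableSet (Ioi (0 : ℝ) ×ˢ (univ : Set E)) :=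
    measurableSet_Ioi.prod MeasurableSet.univ
  have h1 : IntegrableOn (fun p : ℝ × E => Real.exp (-a * p.1) • g p.2 p.1) (Ioi 0 ×ˢ univ) := by
    have hb := (integrableOn_exp_mul_rpow ha (q := m) (by linarith)).mul_prod
      ((integrable_one_add_norm_neg (r := 2 * m) (by linarith)).integrableOn (s := univ))
    rw [Measure.prod_restrict] at hb
    refine Integrable.mono' (hb.const_mul M) (ContinuousOn.aestronglyMeasurable ?_ hms)
      ((ae_restrict_mem hms).mono fun p hp => ?_)
    · have h0 : ContinuousOn (fun p : ℝ × E => Real.exp (-a * p.1)) (Ioi 0 ×ˢ univ) := by fun_prop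
      exact h0.smul (hg.comp (f := fun p : ℝ × E => (p.2, p.1)) (by fun_prop)
        fun p hp => ⟨hp.2, hp.1⟩)
    · rw [norm_smul, Real.norm_of_nonneg (Real.exp_pos _).le]
      refine (mul_le_mul_of_nonneg_left (hdec p.2 p.1 hp.1) (Real.exp_pos _).le).trans
        (le_of_eq (by ring))
  rw [IntegrableOn, Measure.volume_eq_prod, ← Measure.prod_restrict] at h1
  refine h1.integral_prod_left.congr (Eventually.of_forall fun s => ?_)
  simp only [Measure.restrict_univ, integral_smul]

/-- Mass and remainder of the Duhamel integral. -/
lemma exists_duhamel_remainder (ha : 0 < a) (hm : 4 < m) : ∃ C : ℝ, 0 < C ∧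
    ∀ (g : E → ℝ → Sym0), ContinuousOn (fun p : E × ℝ => g p.1 p.2) (univ ×ˢ Ioi 0) →
    ∀ L M : ℝ, 0 ≤ M → (∀ y s, 0 < s → ‖g y s‖ ≤ L) →
    (∀ y s, 0 < s → ‖g y s‖ ≤ M * (s + 1) ^ m * (1 + ‖y‖) ^ (-(2 * m))) →
    ‖totalMass a g‖ ≤ C * M ∧ ∀ (t : ℝ), 0 < t → ∀ x : E,
      (1 + ‖x‖ / Real.sqrt (t + 1)) ^ m *
        ‖duhamel a heatKer g x t - heatKernel (t + 1) x • totalMass a g‖ ≤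
        C * M * (t + 1) ^ (-2 : ℝ) := by
  have hm0 : 0 ≤ m := by linarith
  obtain ⟨C₁, hC₁, hrem⟩ := exists_heatFlow_remainder (F := Sym0) hm
  obtain ⟨C₂, hC₂, hker⟩ := exists_heatKernel_decay hm0
  -- Exponent `2m + 2`: one `m` from the size of the source at time `s`, one `m` from the age `σ = s
  -- + 1` of the comparison Gaussian, and `2` from shifting `t - s` to `t`.
  have hint := integrableOn_exp_mul_rpow ha (q := 2 * m + 2) (by linarith)
  have hint2 := integrableOn_exp_mul_rpow ha (q := m + 1 / 2) (by linarith)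
  set J := ∫ s in Ioi 0, Real.exp (-a * s) * (s + 1) ^ (2 * m + 2)
  set J₂ := ∫ s in Ioi 0, Real.exp (-a * s) * (s + 1) ^ (m + 1 / 2)
  have hnn : ∀ q : ℝ, 0 ≤ᵐ[volume.restrict (Ioi 0)]
      fun s : ℝ => Real.exp (-a * s) * (s + 1) ^ q := fun q =>
    (ae_restrict_mem measurableSet_Ioi).mono fun s hs => by
      have : (0 : ℝ) < s := hs
      simp only [Pi.zero_apply]
      positivity
  have hJ : 0 ≤ J := integral_nonneg_of_ae (hnn _)
  have hJ₂ : 0 ≤ J₂ := integral_nonneg_of_ae (hnn _)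
  set I := ∫ y : E, (1 + ‖y‖) ^ (-(2 * m))
  have hI : 0 ≤ I := integral_nonneg fun y => by positivity
  refine ⟨I * J₂ + C₁ * J + C₂ * I * J₂ + 1, by positivity, fun g hg L M hM hL hdec => ?_⟩
  have hmass : ∀ s : ℝ, 0 < s → ‖∫ y, g y s‖ ≤ I * (M * (s + 1) ^ m) := fun s hs =>
    norm_integral_le_of_decay (by linarith) (Eventually.of_forall fun y => hdec y s hs)
  have hmi := integrableOn_mass ha (by linarith) hg hdec
  -- Mass produced after time `t`. The factor `((s + 1)/(t + 1))^{1/2} ≥ 1` is inserted under the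
  -- integral, which yields the half power of `t + 1` that the kernel's own decay lacks.
  have htail : ∀ t : ℝ, 0 ≤ t → ‖∫ s in Ioi t, Real.exp (-a * s) • ∫ y, g y s‖ ≤
      I * M * J₂ * (t + 1) ^ (-(1 / 2) : ℝ) := by
    intro t ht
    have hsub : Ioi t ⊆ Ioi (0 : ℝ) := fun s hs => ht.trans_lt hs
    have h0 : 0 ≤ (t + 1) ^ (-(1 / 2) : ℝ) := by positivity
    calc ‖∫ s in Ioi t, Real.exp (-a * s) • ∫ y, g y s‖
        ≤ ∫ s in Ioi t, (I * M * (t + 1) ^ (-(1 / 2) : ℝ)) *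
            (Real.exp (-a * s) * (s + 1) ^ (m + 1 / 2)) := by
          refine norm_integral_le_of_norm_le ((hint2.mono_set hsub).const_mul _)
            ((ae_restrict_mem measurableSet_Ioi).mono fun s hs => ?_)
          have hs0 : 0 < s := hsub hs
          have hts : t < s := hs
          rw [norm_smul, Real.norm_of_nonneg (Real.exp_pos _).le]
          have h2 : 1 ≤ (t + 1) ^ (-(1 / 2) : ℝ) * (s + 1) ^ (1 / 2 : ℝ) := by
            rw [Real.rpow_neg (by positivity), inv_mul_eq_div, one_le_div (by positivity)]
            gcongr
          have h1 := hmass s hs0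
          calc Real.exp (-a * s) * ‖∫ y, g y s‖
              ≤ Real.exp (-a * s) * (I * (M * (s + 1) ^ m)) * 1 := by rw [mul_one]; gcongr
            _ ≤ Real.exp (-a * s) * (I * (M * (s + 1) ^ m)) *
                  ((t + 1) ^ (-(1 / 2) : ℝ) * (s + 1) ^ (1 / 2 : ℝ)) := by gcongr
            _ = _ := by rw [Real.rpow_add (by positivity)]; ring
      _ = (I * M * (t + 1) ^ (-(1 / 2) : ℝ)) *
            ∫ s in Ioi t, (Real.exp (-a * s) * (s + 1) ^ (m + 1 / 2)) := integral_const_mul _ _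
      _ ≤ (I * M * (t + 1) ^ (-(1 / 2) : ℝ)) * J₂ := by
          refine mul_le_mul_of_nonneg_left ?_ (by positivity)
          exact setIntegral_mono_set hint2 (hnn _) hsub.eventuallyLE
      _ = _ := by ring
  refine ⟨?_, fun t ht x => ?_⟩
  · have h := htail 0 le_rfl
    rw [zero_add, Real.one_rpow, mul_one] at h
    refine h.trans ?_
    have : 0 ≤ (C₁ * J + C₂ * I * J₂ + 1) * M := by positivity
    nlinarith
  have hW : 0 ≤ (1 + ‖x‖ / Real.sqrt (t + 1)) ^ m := by positivity
  have hsub : Ioo 0 t ⊆ Ioi (0 : ℝ) := fun s hs => hs.1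
  have hk := heatKernel_nonneg (by linarith : 0 ≤ t + 1) x
  have hsplit : totalMass a g = (∫ s in Ioo 0 t, Real.exp (-a * s) • ∫ y, g y s) +
      ∫ s in Ioi t, Real.exp (-a * s) • ∫ y, g y s := by
    rw [totalMass, ← Ioc_union_Ioi_eq_Ioi ht.le, setIntegral_union (Ioc_disjoint_Ioi le_rfl)
      measurableSet_Ioi (hmi.mono_set Ioc_subset_Ioi_self)
      (hmi.mono_set (Ioi_subset_Ioi ht.le)), integral_Ioc_eq_integral_Ioo]
  have hfl := integrableOn_heatFlow ha hg hL x t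
  -- The source at time `s` is compared with a Gaussian of age `s + 1`, which has age `t + 1` at
  -- time `t`. All profiles thus agree, and only the mass produced after `t` is left over.
  have hkey : duhamel a heatKer g x t - heatKernel (t + 1) x • totalMass a g =
      (∫ s in Ioo 0 t, Real.exp (-a * s) • (heatFlow (t - s) (fun y => g y s) x -
        heatKernel (t + 1) x • ∫ y, g y s)) -
        heatKernel (t + 1) x • ∫ s in Ioi t, Real.exp (-a * s) • ∫ y, g y s := by
    rw [hsplit, duhamel_heatKer ha hg hL, smul_add, ← sub_sub]
    congr 1
    have hmi' : IntegrableOn (fun s => heatKernel (t + 1) x • Real.exp (-a * s) • ∫ y, g y s)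
      (Ioo 0 t) := Integrable.smul (heatKernel (t + 1) x) (hmi.mono_set hsub)
    rw [← integral_smul, ← integral_sub hfl hmi']
    refine integral_congr_ae (Eventually.of_forall fun s => ?_)
    simp only [smul_sub]
    rw [smul_comm]
  have h1 : (1 + ‖x‖ / Real.sqrt (t + 1)) ^ m *
      ‖∫ s in Ioo 0 t, Real.exp (-a * s) • (heatFlow (t - s) (fun y => g y s) x -
        heatKernel (t + 1) x • ∫ y, g y s)‖ ≤ C₁ * J * M * (t + 1) ^ (-2 : ℝ) := by
    calc _ ≤ ∫ s in Ioo 0 t, (C₁ * M * (t + 1) ^ (-2 : ℝ)) *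
          (Real.exp (-a * s) * (s + 1) ^ (2 * m + 2)) := by
          rw [← Real.norm_of_nonneg hW, ← norm_smul, ← integral_smul]
          refine norm_integral_le_of_norm_le ((hint.mono_set hsub).const_mul _)
            ((ae_restrict_mem measurableSet_Ioo).mono fun s hs => ?_)
          have hs0 : 0 < s := hs.1
          rw [norm_smul, norm_smul, Real.norm_of_nonneg hW,
            Real.norm_of_nonneg (Real.exp_pos _).le]
          have hcont : Continuous fun y => g y s := continuousOn_univ.1
            (hg.comp (f := fun y : E => (y, s)) (by fun_prop)
              fun y _ => ⟨mem_univ y, mem_Ioi.2 hs0⟩)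
          have h1 := hrem (fun y => g y s) (M * (s + 1) ^ m) (by positivity)
            hcont.aestronglyMeasurable
            (Eventually.of_forall fun y => hdec y s hs0) (s + 1) (by linarith)
            (t - s) (sub_pos.2 hs.2) x
          rw [show t - s + (s + 1) = t + 1 by ring] at h1
          have h2 := weight_mono hm0 (norm_nonneg x) (by linarith [hs.2] : 0 < t - s + 1)
            (by linarith : t - s + 1 ≤ t + 1)
          have h3 := shift_rpow_neg_le hs0 hs.2 (k := 2) (by norm_num)
          have h4 : (s + 1) ^ (2 * m + 2) = (s + 1) ^ m * (s + 1) ^ m * (s + 1) ^ (2 : ℝ) := by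
            rw [← Real.rpow_add (by positivity), ← Real.rpow_add (by positivity)]
            congr 1; ring
          set N := ‖heatFlow (t - s) (fun y => g y s) x - heatKernel (t + 1) x • ∫ y, g y s‖
          calc (1 + ‖x‖ / Real.sqrt (t + 1)) ^ m * (Real.exp (-a * s) * N)
              = Real.exp (-a * s) * ((1 + ‖x‖ / Real.sqrt (t + 1)) ^ m * N) := by ring
            _ ≤ Real.exp (-a * s) * (C₁ * (M * (s + 1) ^ m) * (s + 1) ^ m *
                  ((s + 1) ^ (2 : ℝ) * (t + 1) ^ (-2 : ℝ))) := by
                refine mul_le_mul_of_nonneg_left ?_ (Real.exp_pos _).le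
                refine (mul_le_mul_of_nonneg_right h2 (norm_nonneg _)).trans (h1.trans ?_)
                exact mul_le_mul_of_nonneg_left h3 (by positivity)
            _ = _ := by rw [h4]; ring
      _ = (C₁ * M * (t + 1) ^ (-2 : ℝ)) *
            ∫ s in Ioo 0 t, (Real.exp (-a * s) * (s + 1) ^ (2 * m + 2)) := integral_const_mul _ _
      _ ≤ (C₁ * M * (t + 1) ^ (-2 : ℝ)) * J := by
          refine mul_le_mul_of_nonneg_left ?_ (by positivity)
          exact setIntegral_mono_set hint (hnn _) hsub.eventuallyLE
      _ = _ := by ring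
  have h2 : (1 + ‖x‖ / Real.sqrt (t + 1)) ^ m *
      ‖heatKernel (t + 1) x • ∫ s in Ioi t, Real.exp (-a * s) • ∫ y, g y s‖ ≤
        C₂ * I * J₂ * M * (t + 1) ^ (-2 : ℝ) := by
    rw [norm_smul, Real.norm_of_nonneg hk, ← mul_assoc]
    have e : (t + 1) ^ (-2 : ℝ) = (t + 1) ^ (-(3 / 2) : ℝ) * (t + 1) ^ (-(1 / 2) : ℝ) := by
      rw [← Real.rpow_add (by positivity)]; norm_num
    calc _ ≤ (C₂ * (t + 1) ^ (-(3 / 2) : ℝ)) * (I * M * J₂ * (t + 1) ^ (-(1 / 2) : ℝ)) :=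
          mul_le_mul (hker (t + 1) (by linarith) x) (htail t ht.le) (norm_nonneg _)
            (by positivity)
      _ = _ := by rw [e]; ring
  rw [hkey]
  calc _ ≤ (1 + ‖x‖ / Real.sqrt (t + 1)) ^ m * (_ + _) :=
        mul_le_mul_of_nonneg_left (norm_sub_le _ _) hW
    _ ≤ C₁ * J * M * (t + 1) ^ (-2 : ℝ) + C₂ * I * J₂ * M * (t + 1) ^ (-2 : ℝ) := by
        rw [mul_add]; exact add_le_add h1 h2
    _ = (C₁ * J + C₂ * I * J₂) * M * (t + 1) ^ (-2 : ℝ) := by ring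
    _ ≤ _ := by
        have : 0 ≤ I * J₂ := by positivity
        exact mul_le_mul_of_nonneg_right (mul_le_mul_of_nonneg_right (by linarith) hM)
          (by positivity)

end DuhamelDecay

end QTensor

end

/-! ### Weighted Banach spaces and the linear operators between them. -/

noncomputable section

namespace QTensor

section Pointwise

variable {α F G H : Type*} [TopologicalSpace α] [NormedAddCommGroup F] [NormedSpace ℝ F]
  [NormedAddCommGroup G] [NormedSpace ℝ G] [NormedAddCommGroup H] [NormedSpace ℝ H]

open scoped BoundedContinuousFunction

lemma norm_pointwise_le (B : F →L[ℝ] G →L[ℝ] H) (f : α →ᵇ F) (g : α →ᵇ G) (p : α) :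
    ‖B (f p) (g p)‖ ≤ ‖B‖ * ‖f‖ * ‖g‖ :=
  (B.le_opNorm₂ _ _).trans <| by
    gcongr
    · exact f.norm_coe_le_norm p
    · exact g.norm_coe_le_norm p

/-- A continuous bilinear map applied pointwise to bounded continuous functions. -/
def pointwiseMap (B : F →L[ℝ] G →L[ℝ] H) (f : α →ᵇ F) (g : α →ᵇ G) : α →ᵇ H :=
  BoundedContinuousFunction.ofNormedAddCommGroup (fun p => B (f p) (g p))
    (B.isBoundedBilinearMap.continuous.comp (f.continuous.prodMk g.continuous))
    (‖B‖ * ‖f‖ * ‖g‖) (norm_pointwise_le B f g)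

/-- The continuous bilinear map given by `pointwiseMap`. -/
def pointwise (B : F →L[ℝ] G →L[ℝ] H) : (α →ᵇ F) →L[ℝ] (α →ᵇ G) →L[ℝ] (α →ᵇ H) :=
  LinearMap.mkContinuous₂
    (LinearMap.mk₂ ℝ (pointwiseMap B)
      (fun f f' g => by ext1 p; simp [pointwiseMap])
      (fun r f g => by ext1 p; simp [pointwiseMap])
      (fun f g g' => by ext1 p; simp [pointwiseMap])
      (fun r f g => by ext1 p; simp [pointwiseMap]))
    ‖B‖ fun f g => (BoundedContinuousFunction.norm_le (by positivity)).2 (norm_pointwise_le B f g)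

end Pointwise

section Weighted

variable {δ k : ℝ}

lemma Weighted.norm_eq_toBCF (U : Weighted δ k) : ‖Weighted.toBCF δ k U‖ = ‖U‖ := rfl

lemma Weighted.toBCF_apply (U : Weighted δ k) (p : SpaceTime) :
    Weighted.toBCF δ k U p = timeWeight δ k p.1 p.2 • U p := rfl

lemma Weighted.mul_norm_le (U : Weighted δ k) (p : SpaceTime) :
    timeWeight δ k p.1 p.2 * ‖U p‖ ≤ ‖U‖ := by
  have := (Weighted.toBCF δ k U).norm_coe_le_norm p
  rwa [Weighted.toBCF_apply, norm_smul, Real.norm_of_nonneg (timeWeight_pos δ k p).le] at this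

/-- A continuous map with a weighted bound, as an element of the weighted space. -/
def Weighted.of (f : SpaceTime → Sym0) (hf : Continuous f) (C : ℝ)
    (hC : ∀ p : SpaceTime, timeWeight δ k p.1 p.2 * ‖f p‖ ≤ C) : Weighted δ k :=
  ⟨⟨f, hf⟩, C, hC⟩

lemma Weighted.of_apply {f : SpaceTime → Sym0} (hf : Continuous f) {C : ℝ}
    (hC : ∀ p : SpaceTime, timeWeight δ k p.1 p.2 * ‖f p‖ ≤ C) (p : SpaceTime) :
    Weighted.of f hf C hC p = f p := rfl

lemma Weighted.norm_le {U : Weighted δ k} {C : ℝ} (hC : 0 ≤ C)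
    (h : ∀ p : SpaceTime, timeWeight δ k p.1 p.2 * ‖U p‖ ≤ C) : ‖U‖ ≤ C := by
  rw [← Weighted.norm_eq_toBCF, BoundedContinuousFunction.norm_le hC]
  intro p
  rw [Weighted.toBCF_apply, norm_smul, Real.norm_of_nonneg (timeWeight_pos δ k p).le]
  exact h p

lemma Weighted.ext {U V : Weighted δ k} (h : ∀ p, U p = V p) : U = V :=
  Subtype.ext (ContinuousMap.ext h)

lemma Weighted.continuous (U : Weighted δ k) : Continuous fun p => U p := U.1.continuous

lemma Weighted.add_apply (U V : Weighted δ k) (p : SpaceTime) : (U + V) p = U p + V p := rfl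

lemma Weighted.smul_apply (r : ℝ) (U : Weighted δ k) (p : SpaceTime) : (r • U) p = r • U p := rfl

/-- Multiplication by the weight as a linear isometric equivalence. -/
def Weighted.equivBCF (δ k : ℝ) : Weighted δ k ≃ₗᵢ[ℝ] BddMap :=
  LinearIsometryEquiv.ofSurjective ⟨Weighted.toBCF δ k, Weighted.norm_eq_toBCF⟩ fun f => by
    refine ⟨Weighted.of (fun p => (timeWeight δ k p.1 p.2)⁻¹ • f p)
      (((timeWeight_continuous δ k).inv₀ fun p => (timeWeight_pos δ k p).ne').smul f.continuous)
      ‖f‖ fun p => ?_, ?_⟩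
    · rw [norm_smul, norm_inv, Real.norm_of_nonneg (timeWeight_pos δ k p).le,
        mul_inv_cancel_left₀ (timeWeight_pos δ k p).ne']
      exact f.norm_coe_le_norm p
    · ext1 p
      change timeWeight δ k p.1 p.2 • ((timeWeight δ k p.1 p.2)⁻¹ • f p) = f p
      rw [smul_inv_smul₀ (timeWeight_pos δ k p).ne']

lemma Weighted.equivBCF_apply (U : Weighted δ k) (p : SpaceTime) :
    Weighted.equivBCF δ k U p = timeWeight δ k p.1 p.2 • U p := rfl

instance : CompleteSpace (Weighted δ k) :=
  (completeSpace_congr (e := (Weighted.equivBCF δ k).toEquiv)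
    (Weighted.equivBCF δ k).isometry.isUniformEmbedding).2 inferInstance

lemma one_le_timeWeight (hδ : 0 < δ) (hk : 0 ≤ k) (p : SpaceTime) :
    1 ≤ timeWeight δ k p.1 p.2 := by
  have h : (0 : ℝ) < p.2 := p.2.2
  refine one_le_mul_of_one_le_of_one_le (Real.one_le_rpow ?_ (by linarith))
    (Real.one_le_rpow (by linarith) hk)
  have : 0 ≤ ‖p.1‖ / Real.sqrt (p.2 + 1) := by positivity
  linarith

lemma Weighted.norm_apply_le (hδ : 0 < δ) (hk : 0 ≤ k) (U : Weighted δ k) (p : SpaceTime) :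
    ‖U p‖ ≤ ‖U‖ :=
  (le_mul_of_one_le_left (norm_nonneg _) (one_le_timeWeight hδ hk p)).trans (U.mul_norm_le p)

/-- Weighted maps as bounded continuous maps. -/
def Weighted.incl (hδ : 0 < δ) (hk : 0 ≤ k) : Weighted δ k →L[ℝ] BddMap :=
  LinearMap.mkContinuous
    { toFun := fun U => BoundedContinuousFunction.ofNormedAddCommGroup (fun p => U p)
        U.continuous ‖U‖ (U.norm_apply_le hδ hk)
      map_add' := fun U V => rfl
      map_smul' := fun r U => rfl }
    1 fun U => by
      rw [one_mul]
      exact (BoundedContinuousFunction.norm_le (norm_nonneg _)).2 (U.norm_apply_le hδ hk)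

lemma Weighted.incl_apply (hδ : 0 < δ) (hk : 0 ≤ k) (U : Weighted δ k) (p : SpaceTime) :
    Weighted.incl hδ hk U p = U p := rfl

/-- A bounded map divided by the square of the weight of the solution space. -/
def unweightSq (δ : ℝ) (v : BddMap) (p : SpaceTime) : Sym0 :=
  (timeWeight δ (3 / 2) p.1 p.2 ^ 2)⁻¹ • v p

lemma continuous_unweightSq (v : BddMap) : Continuous (unweightSq δ v) :=
  (((timeWeight_continuous δ _).pow 2).inv₀ fun p => (pow_pos (timeWeight_pos δ _ p) 2).ne').smul
    v.continuous

lemma norm_unweightSq (v : BddMap) (p : SpaceTime) :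
    ‖unweightSq δ v p‖ = (timeWeight δ (3 / 2) p.1 p.2 ^ 2)⁻¹ * ‖v p‖ := by
  rw [unweightSq, norm_smul, Real.norm_of_nonneg (by positivity)]

lemma norm_unweightSq_le (hδ : 0 < δ) (v : BddMap) (p : SpaceTime) :
    ‖unweightSq δ v p‖ ≤ ‖v‖ := by
  rw [norm_unweightSq]
  refine (mul_le_of_le_one_left (norm_nonneg _) (inv_le_one_of_one_le₀ ?_)).trans
    (v.norm_coe_le_norm p)
  exact one_le_pow₀ (one_le_timeWeight hδ (by norm_num) p)

/-- The squared weight has spatial exponent `2m = 8 + δ`, the same as the data. Passing to the flat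
weight costs `(s + 1)^m`, while the available decay `(s + 1)^{-3}` is given away. -/
lemma norm_extend_unweightSq_le (hδ : 0 < δ) (v : BddMap) (y : E) (s : ℝ) (hs : 0 < s) :
    ‖extend (unweightSq δ v) y s‖ ≤
      ‖v‖ * (s + 1) ^ (4 + δ / 2) * (1 + ‖y‖) ^ (-(2 * (4 + δ / 2))) := by
  rw [extend_of_pos _ _ hs, norm_unweightSq]
  have h1 : (1 : ℝ) ≤ s + 1 := by linarith
  have h2 := one_add_norm_rpow_le h1 (m := 4 + δ / 2) (by linarith) (norm_nonneg y)
  have h3 : timeWeight δ (3 / 2) y s ^ 2 =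
      (1 + ‖y‖ / Real.sqrt (s + 1)) ^ (2 * (4 + δ / 2)) * (s + 1) ^ (3 : ℝ) := by
    rw [timeWeight, mul_pow, ← Real.rpow_mul_natCast (by positivity),
      ← Real.rpow_mul_natCast (by positivity)]
    norm_num
    left
    congr 1
    ring
  have h4 : (1 : ℝ) ≤ (s + 1) ^ (3 : ℝ) := Real.one_le_rpow h1 (by norm_num)
  have h5 : 0 < (1 + ‖y‖ / Real.sqrt (s + 1)) ^ (2 * (4 + δ / 2)) := by positivity
  have h6 : 0 < (1 + ‖y‖) ^ (2 * (4 + δ / 2)) := by positivity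
  have h7 : (0 : ℝ) < (s + 1) ^ (4 + δ / 2) := by positivity
  have key : (timeWeight δ (3 / 2) y s ^ 2)⁻¹ ≤
      (s + 1) ^ (4 + δ / 2) * (1 + ‖y‖) ^ (-(2 * (4 + δ / 2))) := by
    rw [h3, Real.rpow_neg (by positivity), ← div_eq_mul_inv, inv_eq_one_div,
      div_le_div_iff₀ (by positivity) h6, one_mul]
    refine h2.trans (mul_le_mul_of_nonneg_left ?_ h7.le)
    exact le_mul_of_one_le_right h5.le h4
  calc (timeWeight δ (3 / 2) y s ^ 2)⁻¹ * ‖v (y, ⟨s, hs⟩)‖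
      ≤ ((s + 1) ^ (4 + δ / 2) * (1 + ‖y‖) ^ (-(2 * (4 + δ / 2)))) * ‖v‖ :=
        mul_le_mul key (v.norm_coe_le_norm _) (norm_nonneg _) (by positivity)
    _ = _ := by ring

lemma extend_unweightSq_add (v v' : BddMap) (y : E) (s : ℝ) :
    extend (unweightSq δ (v + v')) y s =
      extend (unweightSq δ v) y s + extend (unweightSq δ v') y s := by
  by_cases hs : 0 < s
  · simp only [extend_of_pos _ _ hs, unweightSq, BoundedContinuousFunction.add_apply, smul_add]
  · simp only [extend, dif_neg hs, add_zero]

lemma extend_unweightSq_smul (r : ℝ) (v : BddMap) (y : E) (s : ℝ) :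
    extend (unweightSq δ (r • v)) y s = r • extend (unweightSq δ v) y s := by
  by_cases hs : 0 < s
  · simp only [extend_of_pos _ _ hs, unweightSq, BoundedContinuousFunction.smul_apply,
      smul_comm r]
  · simp only [extend, dif_neg hs, smul_zero]

end Weighted

/-! ### Duhamel operator and mass functional on sources measured in the squared weight. -/

section Operators

variable {δ a : ℝ}

/-- The bounded map `unweightSq δ v`. -/
def unweightSqMap (hδ : 0 < δ) (v : BddMap) : BddMap :=
  BoundedContinuousFunction.ofNormedAddCommGroup (unweightSq δ v) (continuous_unweightSq v) ‖v‖
    (norm_unweightSq_le hδ v)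

lemma unweightSqMap_add (hδ : 0 < δ) (v v' : BddMap) :
    unweightSqMap hδ (v + v') = unweightSqMap hδ v + unweightSqMap hδ v' := by
  ext1 p
  exact smul_add _ (v p) (v' p)

lemma unweightSqMap_smul (hδ : 0 < δ) (r : ℝ) (v : BddMap) :
    unweightSqMap hδ (r • v) = r • unweightSqMap hδ v := by
  ext1 p
  exact smul_comm _ r (v p)

/-- Here `v` is a source multiplied by the squared weight. The factor `min 1 t` is kept for the
initial condition; the bound in `𝒳` discards it. -/
lemma exists_weighted_duhamel_le (hδ : 0 < δ) (ha : 0 < a) : ∃ C : ℝ, 0 < C ∧ ∀ (v : BddMap)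
    (t : ℝ), 0 < t → ∀ x : E,
      (1 + ‖x‖ / Real.sqrt (t + 1)) ^ (4 + δ / 2) *
        ‖duhamel a heatKer (extend (unweightSq δ v)) x t‖ ≤
        C * ‖v‖ * min 1 t * (t + 1) ^ (-(3 / 2) : ℝ) := by
  obtain ⟨C, hC, h⟩ := exists_duhamel_decay ha (m := 4 + δ / 2) (by linarith)
  exact ⟨C, hC, fun v => h _ (continuousOn_extend (continuous_unweightSq v)) ‖v‖ ‖v‖ (norm_nonneg v)
    (fun y s hs => norm_extend_le (norm_unweightSq_le hδ v) y hs)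
    (norm_extend_unweightSq_le hδ v)⟩

lemma exists_weighted_duhamel_bound (hδ : 0 < δ) (ha : 0 < a) : ∃ C : ℝ, 0 < C ∧
    ∀ (v : BddMap) (p : SpaceTime), timeWeight δ (3 / 2) p.1 p.2 *
      ‖duhamel a heatKer (extend (unweightSq δ v)) p.1 p.2‖ ≤ C * ‖v‖ := by
  obtain ⟨C, hC, h⟩ := exists_weighted_duhamel_le hδ ha
  refine ⟨C, hC, fun v p => ?_⟩
  have hp : (0 : ℝ) < p.2 := p.2.2
  have h1 : (0 : ℝ) < (p.2 + 1 : ℝ) ^ (3 / 2 : ℝ) := by positivity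
  calc timeWeight δ (3 / 2) p.1 p.2 * ‖duhamel a heatKer (extend (unweightSq δ v)) p.1 p.2‖
      = (p.2 + 1 : ℝ) ^ (3 / 2 : ℝ) * ((1 + ‖p.1‖ / Real.sqrt (p.2 + 1)) ^ (4 + δ / 2) *
        ‖duhamel a heatKer (extend (unweightSq δ v)) p.1 p.2‖) := by rw [timeWeight]; ring
    _ ≤ (p.2 + 1 : ℝ) ^ (3 / 2 : ℝ) * (C * ‖v‖ * min 1 (p.2 : ℝ) * (p.2 + 1) ^ (-(3 / 2) : ℝ)) :=
        mul_le_mul_of_nonneg_left (h v p.2 hp p.1) h1.le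
    _ = C * ‖v‖ * min 1 (p.2 : ℝ) := by
        rw [Real.rpow_neg (by positivity)]
        field_simp
    _ ≤ C * ‖v‖ := mul_le_of_le_one_right (by positivity) (min_le_left _ _)

/-- The Duhamel integral with the heat kernel of `v` divided by the squared weight. -/
def weightedDuhamelMap (hδ : 0 < δ) (ha : 0 < a) (v : BddMap) : XSpace δ :=
  Weighted.of (fun p => duhamelOp ha heatKer (unweightSqMap hδ v) p)
    (duhamelOp ha heatKer (unweightSqMap hδ v)).continuous
    ((exists_weighted_duhamel_bound hδ ha).choose * ‖v‖)
    ((exists_weighted_duhamel_bound hδ ha).choose_spec.2 v)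

/-- `weightedDuhamelMap` as a continuous linear map. -/
def weightedDuhamel (hδ : 0 < δ) (ha : 0 < a) : BddMap →L[ℝ] XSpace δ :=
  LinearMap.mkContinuous
    { toFun := weightedDuhamelMap hδ ha
      map_add' := fun v v' => Weighted.ext fun p => by
        change duhamelOp ha heatKer (unweightSqMap hδ (v + v')) p =
          duhamelOp ha heatKer (unweightSqMap hδ v) p + duhamelOp ha heatKer (unweightSqMap hδ v') p
        rw [unweightSqMap_add, map_add, BoundedContinuousFunction.add_apply]
      map_smul' := fun r v => Weighted.ext fun p => by
        change duhamelOp ha heatKer (unweightSqMap hδ (r • v)) p =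
          r • duhamelOp ha heatKer (unweightSqMap hδ v) p
        rw [unweightSqMap_smul, map_smul, BoundedContinuousFunction.smul_apply] }
    (exists_weighted_duhamel_bound hδ ha).choose fun v =>
      Weighted.norm_le (mul_nonneg (exists_weighted_duhamel_bound hδ ha).choose_spec.1.le
        (norm_nonneg v)) ((exists_weighted_duhamel_bound hδ ha).choose_spec.2 v)

lemma incl_weightedDuhamel (hδ : 0 < δ) (ha : 0 < a) (v : BddMap) :
    Weighted.incl hδ (by norm_num) (weightedDuhamel hδ ha v) =
      duhamelOp ha heatKer (unweightSqMap hδ v) := rfl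

/-- The Duhamel integral has a heat-kernel profile up to a faster decaying remainder. -/
lemma exists_weighted_remainder (hδ : 0 < δ) (ha : 0 < a) : ∃ C : ℝ, 0 < C ∧ ∀ (v : BddMap),
    ‖totalMass a (extend (unweightSq δ v))‖ ≤ C * ‖v‖ ∧ ∀ (t : ℝ), 0 < t → ∀ x : E,
      (1 + ‖x‖ / Real.sqrt (t + 1)) ^ (4 + δ / 2) *
        ‖duhamel a heatKer (extend (unweightSq δ v)) x t -
          heatKernel (t + 1) x • totalMass a (extend (unweightSq δ v))‖ ≤
        C * ‖v‖ * (t + 1) ^ (-2 : ℝ) := by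
  obtain ⟨C, hC, h⟩ := exists_duhamel_remainder ha (m := 4 + δ / 2) (by linarith)
  exact ⟨C, hC, fun v => h _ (continuousOn_extend (continuous_unweightSq v)) ‖v‖ ‖v‖ (norm_nonneg v)
    (fun y s hs => norm_extend_le (norm_unweightSq_le hδ v) y hs)
    (norm_extend_unweightSq_le hδ v)⟩

lemma integrable_extend_unweightSq (hδ : 0 < δ) (v : BddMap) {s : ℝ} (hs : 0 < s) :
    Integrable fun y => extend (unweightSq δ v) y s :=
  integrable_of_decay (m := 4 + δ / 2) (by linarith)
    (continuous_extend_slice (continuous_unweightSq v) s).aestronglyMeasurable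
    (Eventually.of_forall fun y => norm_extend_unweightSq_le hδ v y s hs)

lemma integrableOn_weightedMass (hδ : 0 < δ) (ha : 0 < a) (v : BddMap) :
    IntegrableOn (fun s => Real.exp (-a * s) • ∫ y, extend (unweightSq δ v) y s) (Ioi 0) :=
  integrableOn_mass ha (m := 4 + δ / 2) (by linarith)
    (continuousOn_extend (continuous_unweightSq v)) (norm_extend_unweightSq_le hδ v)

/-- The total mass of `v` divided by the squared weight. -/
def weightedMass (hδ : 0 < δ) (ha : 0 < a) : BddMap →L[ℝ] Sym0 :=
  LinearMap.mkContinuous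
    { toFun := fun v => totalMass a (extend (unweightSq δ v))
      map_add' := fun v v' => by
        rw [totalMass, totalMass, totalMass, ← integral_add (integrableOn_weightedMass hδ ha v)
          (integrableOn_weightedMass hδ ha v')]
        refine setIntegral_congr_fun measurableSet_Ioi fun s hs => ?_
        simp only [extend_unweightSq_add]
        rw [integral_add (integrable_extend_unweightSq hδ v hs)
          (integrable_extend_unweightSq hδ v' hs), smul_add]
      map_smul' := fun r v => by
        rw [totalMass, totalMass, RingHom.id_apply, ← integral_smul]
        refine setIntegral_congr_fun measurableSet_Ioi fun s hs => ?_
        simp only [extend_unweightSq_smul]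
        rw [integral_smul, smul_comm] }
    (exists_weighted_remainder hδ ha).choose fun v =>
      ((exists_weighted_remainder hδ ha).choose_spec.2 v).1

lemma weightedMass_apply (hδ : 0 < δ) (ha : 0 < a) (v : BddMap) :
    weightedMass hδ ha v = totalMass a (extend (unweightSq δ v)) := rfl

end Operators

section Data

variable {δ : ℝ}

lemma Data.aestronglyMeasurable (Q : Data δ) : AEStronglyMeasurable Q (volume : Measure E) :=
  Lp.aestronglyMeasurable Q.1

lemma Data.add_ae (P Q : Data δ) : (P + Q : Data δ) =ᵐ[(volume : Measure E)] fun y => P y + Q y :=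
  Lp.coeFn_add P.1 Q.1

lemma Data.smul_ae (r : ℝ) (Q : Data δ) : (r • Q : Data δ) =ᵐ[(volume : Measure E)]
    fun y => r • Q y := Lp.coeFn_smul r Q.1

lemma Data.norm_ae_le (Q : Data δ) :
    ∀ᵐ y, ‖Q y‖ ≤ ‖Q‖ * (1 + ‖y‖) ^ (-(2 * (4 + δ / 2))) := by
  have h1 : MemLp (fun x => spaceWeight δ x • Q x) ∞ (volume : Measure E) := Q.2
  filter_upwards [ae_le_eLpNormEssSup (f := fun x => spaceWeight δ x • Q x)
    (μ := (volume : Measure E))] with y hy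
  have h2 : ‖spaceWeight δ y • Q y‖ ≤ ‖Q‖ := by
    rw [Data.norm_eq, ← toReal_enorm]
    refine ENNReal.toReal_mono h1.2.ne ?_
    rwa [eLpNorm_exponent_top]
  rw [norm_smul, Real.norm_of_nonneg (spaceWeight_pos δ y).le] at h2
  have h3 : spaceWeight δ y = (1 + ‖y‖) ^ (2 * (4 + δ / 2)) := by
    rw [spaceWeight]
    congr 1
    ring
  rwa [Real.rpow_neg (by positivity), ← div_eq_mul_inv, le_div_iff₀ (by positivity), mul_comm,
    ← h3]

lemma Data.integrable (hδ : 0 < δ) (Q : Data δ) : Integrable Q (volume : Measure E) :=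
  integrable_of_decay (m := 4 + δ / 2) (by linarith) Q.aestronglyMeasurable Q.norm_ae_le

lemma Data.norm_ae_le_norm (hδ : 0 < δ) (Q : Data δ) : ∀ᵐ y, ‖Q y‖ ≤ ‖Q‖ := by
  filter_upwards [Q.norm_ae_le] with y hy
  refine hy.trans (mul_le_of_le_one_right (norm_nonneg _) ?_)
  exact Real.rpow_le_one_of_one_le_of_nonpos (by linarith [norm_nonneg y]) (by linarith)

lemma heatFlow_congr_ae {F : Type*} [NormedAddCommGroup F] [NormedSpace ℝ F] {r : ℝ} (hr : 0 < r)
    {f g : E → F} (h : f =ᵐ[volume] g) (x : E) : heatFlow r f x = heatFlow r g x := by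
  rw [heatFlow_eq hr, heatFlow_eq hr]
  refine integral_congr_ae ?_
  filter_upwards [h] with y hy
  rw [hy]

lemma heatFlow_add {F : Type*} [NormedAddCommGroup F] [NormedSpace ℝ F] {r : ℝ} (hr : 0 < r)
    {f g : E → F} (hf : Integrable f) (hg : Integrable g) (x : E) :
    heatFlow r (fun y => f y + g y) x = heatFlow r f x + heatFlow r g x := by
  rw [heatFlow_eq hr, heatFlow_eq hr, heatFlow_eq hr,
    ← integral_add (integrable_heatKernel_smul hr hf x) (integrable_heatKernel_smul hr hg x)]
  simp_rw [smul_add]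

lemma heatFlow_const_smul {F : Type*} [NormedAddCommGroup F] [NormedSpace ℝ F] (r c : ℝ)
    (f : E → F) (x : E) : heatFlow r (fun y => c • f y) x = c • heatFlow r f x := by
  rw [heatFlow, heatFlow, ← integral_smul]
  simp_rw [smul_comm c]

lemma Data.continuous_heatFlow (hδ : 0 < δ) (Q : Data δ) :
    Continuous fun q : SpaceTime => heatFlow q.2 Q q.1 := by
  have := continuous_freeFlow heatKer Q.aestronglyMeasurable (Q.norm_ae_le_norm hδ)
  simpa only [freeFlow_heatKer] using this

lemma exists_weighted_heatFlow_bound (hδ : 0 < δ) : ∃ C : ℝ, 0 < C ∧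
    ∀ (Q : Data δ) (p : SpaceTime), timeWeight δ (3 / 2) p.1 p.2 * ‖heatFlow p.2 Q p.1‖ ≤
      C * ‖Q‖ := by
  obtain ⟨C, hC, h⟩ := exists_heatFlow_decay (F := Sym0) (m := 4 + δ / 2) (by linarith)
  refine ⟨C, hC, fun Q p => ?_⟩
  have hp : (0 : ℝ) < p.2 := p.2.2
  have h1 : (0 : ℝ) < (p.2 + 1 : ℝ) ^ (3 / 2 : ℝ) := by positivity
  calc timeWeight δ (3 / 2) p.1 p.2 * ‖heatFlow p.2 Q p.1‖
      = (p.2 + 1 : ℝ) ^ (3 / 2 : ℝ) * ((1 + ‖p.1‖ / Real.sqrt (p.2 + 1)) ^ (4 + δ / 2) *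
        ‖heatFlow p.2 Q p.1‖) := by rw [timeWeight]; ring
    _ ≤ (p.2 + 1 : ℝ) ^ (3 / 2 : ℝ) * (C * ‖Q‖ * (p.2 + 1) ^ (-(3 / 2) : ℝ)) :=
        mul_le_mul_of_nonneg_left (h Q ‖Q‖ (norm_nonneg Q) Q.norm_ae_le p.2 hp p.1) h1.le
    _ = C * ‖Q‖ := by
        rw [Real.rpow_neg (by positivity)]
        field_simp

/-- The heat flow of the data, as a continuous linear map into the solution space. -/
def dataFlow (hδ : 0 < δ) : Data δ →L[ℝ] XSpace δ :=
  LinearMap.mkContinuous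
    { toFun := fun Q => Weighted.of (fun p => heatFlow p.2 Q p.1) (Q.continuous_heatFlow hδ)
        ((exists_weighted_heatFlow_bound hδ).choose * ‖Q‖)
        ((exists_weighted_heatFlow_bound hδ).choose_spec.2 Q)
      map_add' := fun P Q => Weighted.ext fun p => by
        rw [Weighted.add_apply, Weighted.of_apply, Weighted.of_apply, Weighted.of_apply,
          ← heatFlow_add p.2.2 (P.integrable hδ) (Q.integrable hδ)]
        exact heatFlow_congr_ae p.2.2 (Data.add_ae P Q) p.1
      map_smul' := fun r Q => Weighted.ext fun p => by
        rw [RingHom.id_apply, Weighted.smul_apply, Weighted.of_apply, Weighted.of_apply,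
          ← heatFlow_const_smul]
        exact heatFlow_congr_ae p.2.2 (Data.smul_ae r Q) p.1 }
    (exists_weighted_heatFlow_bound hδ).choose fun Q =>
      Weighted.norm_le (mul_nonneg (exists_weighted_heatFlow_bound hδ).choose_spec.1.le
        (norm_nonneg Q)) ((exists_weighted_heatFlow_bound hδ).choose_spec.2 Q)

lemma dataFlow_apply (hδ : 0 < δ) (Q : Data δ) (p : SpaceTime) :
    dataFlow hδ Q p = heatFlow p.2 Q p.1 := rfl

/-- The integral of the data. -/
def dataMass (hδ : 0 < δ) : Data δ →L[ℝ] Sym0 :=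
  LinearMap.mkContinuous
    { toFun := fun Q => ∫ y, Q y
      map_add' := fun P Q => by
        rw [← integral_add (P.integrable hδ) (Q.integrable hδ)]
        exact integral_congr_ae (Data.add_ae P Q)
      map_smul' := fun r Q => by
        rw [RingHom.id_apply, ← integral_smul]
        exact integral_congr_ae (Data.smul_ae r Q) }
    (∫ y : E, (1 + ‖y‖) ^ (-(2 * (4 + δ / 2)))) fun Q =>
      norm_integral_le_of_decay (by linarith) Q.norm_ae_le

lemma dataMass_apply (hδ : 0 < δ) (Q : Data δ) : dataMass hδ Q = ∫ y, Q y := rfl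

end Data

section Damping

variable {δ k a : ℝ}

lemma damp_le (ha : 0 < a) (U : Weighted δ k) (p : SpaceTime) :
    timeWeight δ k p.1 p.2 * ‖Real.exp (-a * p.2) • U p‖ ≤ ‖U‖ := by
  have h : (0 : ℝ) < p.2 := p.2.2
  rw [norm_smul, Real.norm_of_nonneg (Real.exp_pos _).le]
  refine (mul_le_mul_of_nonneg_left (mul_le_of_le_one_left (norm_nonneg _) ?_)
    (timeWeight_pos δ k p).le).trans (U.mul_norm_le p)
  rw [Real.exp_le_one_iff]
  nlinarith

/-- Multiplication by `exp (-a t)`. -/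
def damp (δ k : ℝ) (ha : 0 < a) : Weighted δ k →L[ℝ] Weighted δ k :=
  LinearMap.mkContinuous
    { toFun := fun U => Weighted.of (fun p => Real.exp (-a * p.2) • U p)
        (Continuous.smul (f := fun p : SpaceTime => Real.exp (-a * p.2)) (by fun_prop)
          U.continuous) ‖U‖ (damp_le ha U)
      map_add' := fun U V => Weighted.ext fun p => smul_add _ (U p) (V p)
      map_smul' := fun r U => Weighted.ext fun p => smul_comm _ r (U p) }
    1 fun U => by
      rw [one_mul]
      exact Weighted.norm_le (norm_nonneg _) (damp_le ha U)

lemma damp_apply (ha : 0 < a) (U : Weighted δ k) (p : SpaceTime) :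
    damp δ k ha U p = Real.exp (-a * p.2) • U p := rfl

end Damping

end QTensor

end

/-! ### Analytic inversion, the reaction as a polynomial map, and the solution map. -/

noncomputable section

namespace QTensor

section Inverse

variable {X : Type*} [NormedAddCommGroup X] [NormedSpace ℝ X]

lemma fderiv_eq_zero_of_norm_le_sq {Y : Type*} [NormedAddCommGroup Y] [NormedSpace ℝ Y] {G : X → Y}
    {C : ℝ} (hC : ∀ᶠ x in 𝓝 0, ‖G x‖ ≤ C * ‖x‖ ^ 2) : HasFDerivAt G (0 : X →L[ℝ] Y) 0 := by
  have h0 : G 0 = 0 := by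
    have := hC.self_of_nhds
    simpa using this
  rw [hasFDerivAt_iff_isLittleO_nhds_zero]
  simp only [zero_add, h0, sub_zero, _root_.zero_apply]
  refine (Asymptotics.IsBigO.of_bound C ?_).trans_isLittleO (g := fun x : X => ‖x‖ ^ 2) ?_
  · filter_upwards [hC] with x hx
    rwa [Real.norm_of_nonneg (by positivity)]
  · refine Asymptotics.isLittleO_iff.2 fun c hc => ?_
    filter_upwards [Metric.ball_mem_nhds (0 : X) hc] with x hx
    rw [mem_ball_zero_iff] at hx
    rw [Real.norm_of_nonneg (by positivity), pow_two]
    exact mul_le_mul_of_nonneg_right hx.le (norm_nonneg x)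

/-- Analytic inversion of a quadratically small perturbation of the identity. -/
lemma exists_analytic_inverse [CompleteSpace X] {G : X → X} (hG : AnalyticAt ℝ G 0)
    {C : ℝ} (hC : ∀ᶠ x in 𝓝 0, ‖G x‖ ≤ C * ‖x‖ ^ 2) : ∃ Ψ : X → X, AnalyticAt ℝ Ψ 0 ∧ Ψ 0 = 0 ∧
      (∀ᶠ y in 𝓝 0, Ψ y - G (Ψ y) = y) ∧ ∀ᶠ x in 𝓝 0, Ψ (x - G x) = x := by
  set f : X → X := fun x => x - G x with hf
  have h0 : G 0 = 0 := by
    have := hC.self_of_nhds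
    simpa using this
  have hf0 : f 0 = 0 := by simp [hf, h0]
  have hfa : AnalyticAt ℝ f 0 := analyticAt_id.sub hG
  have hd : fderiv ℝ f 0 = ((ContinuousLinearEquiv.refl ℝ X : X ≃L[ℝ] X) : X →L[ℝ] X) := by
    have := ((hasFDerivAt_id (0 : X)).sub (fderiv_eq_zero_of_norm_le_sq hC)).fderiv
    rw [sub_zero] at this
    exact this
  have hs : HasStrictFDerivAt f ((ContinuousLinearEquiv.refl ℝ X : X ≃L[ℝ] X) : X →L[ℝ] X) 0 :=
    hd ▸ hfa.hasStrictFDerivAt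
  set e := hs.toOpenPartialHomeomorph f
  have he : (e : X → X) = f := hs.toOpenPartialHomeomorph_coe
  have h0s : (0 : X) ∈ e.source := hs.mem_toOpenPartialHomeomorph_source
  have he0 : e 0 = 0 := by rw [he, hf0]
  -- Both inverse identities are recorded: the right inverse produces solutions, and the left
  -- inverse recognises a solution that is already given.
  refine ⟨e.symm, ?_, ?_, ?_, ?_⟩
  · have := e.analyticAt_symm' (i := ContinuousLinearEquiv.refl ℝ X) h0s (he ▸ hfa) (he ▸ hd)
    rwa [he0] at this
  · conv_lhs => rw [← he0]
    exact e.left_inv h0s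
  · have ht : e.target ∈ 𝓝 (0 : X) := e.open_target.mem_nhds (he0 ▸ e.map_source h0s)
    filter_upwards [ht] with y hy
    have := e.right_inv hy
    rwa [he] at this
  · filter_upwards [e.open_source.mem_nhds h0s] with x hx
    have := e.left_inv hx
    rwa [he] at this

end Inverse

section Reaction

open scoped BoundedContinuousFunction

lemma analyticAt_pointwise {α F G H W : Type*} [TopologicalSpace α] [NormedAddCommGroup F]
    [NormedSpace ℝ F] [NormedAddCommGroup G] [NormedSpace ℝ G] [NormedAddCommGroup H]
    [NormedSpace ℝ H] [NormedAddCommGroup W] [NormedSpace ℝ W] {f : W → α →ᵇ F} {g : W → α →ᵇ G}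
    {w : W} (B : F →L[ℝ] G →L[ℝ] H) (hf : AnalyticAt ℝ f w) (hg : AnalyticAt ℝ g w) :
    AnalyticAt ℝ (fun w => pointwise B (f w) (g w)) w :=
  AnalyticAt.comp₂ (h := fun q => pointwise B q.1 q.2)
    (ContinuousLinearMap.analyticAt_bilinear (pointwise B) _) hf hg

/-- The reaction term `φ b (u² - ⅓ tr(u²) I) - ψ c tr(u²) u` with bounded coefficients. -/
def reaction (b c : ℝ) (φ ψ : SpaceTime →ᵇ ℝ) (u : BddMap) : BddMap :=
  b • pointwise (ContinuousLinearMap.lsmul ℝ ℝ) φ (pointwise devBilin u u) -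
    c • pointwise (ContinuousLinearMap.lsmul ℝ ℝ) ψ
      (pointwise (ContinuousLinearMap.lsmul ℝ ℝ) (pointwise (innerSL ℝ) u u) u)

lemma reaction_apply (b c : ℝ) (φ ψ : SpaceTime →ᵇ ℝ) (u : BddMap) (p : SpaceTime) :
    reaction b c φ ψ u p = (b * φ p) • devSq (u p) - (c * (ψ p * ‖u p‖ ^ 2)) • u p := by
  rw [← devBilin_self, ← real_inner_self_eq_norm_sq, mul_smul, mul_smul c, mul_smul (ψ p)]
  rfl

lemma norm_devSq_le (P : Sym0) : ‖devSq P‖ ≤ ‖devBilin‖ * ‖P‖ ^ 2 := by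
  rw [← devBilin_self, pow_two, ← mul_assoc]
  exact devBilin.le_opNorm₂ P P

lemma norm_reaction_le (b c : ℝ) (φ ψ : SpaceTime →ᵇ ℝ) (u : BddMap) :
    ‖reaction b c φ ψ u‖ ≤ (|b| * ‖φ‖ * ‖devBilin‖ + |c| * ‖ψ‖ * ‖u‖) * ‖u‖ ^ 2 := by
  refine (BoundedContinuousFunction.norm_le (by positivity)).2 fun p => ?_
  have h1 := u.norm_coe_le_norm p
  have h2 := φ.norm_coe_le_norm p
  have h3 := ψ.norm_coe_le_norm p
  rw [reaction_apply]
  calc ‖(b * φ p) • devSq (u p) - (c * (ψ p * ‖u p‖ ^ 2)) • u p‖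
      ≤ ‖(b * φ p) • devSq (u p)‖ + ‖(c * (ψ p * ‖u p‖ ^ 2)) • u p‖ := norm_sub_le _ _
    _ = |b| * ‖φ p‖ * ‖devSq (u p)‖ + |c| * (‖ψ p‖ * ‖u p‖ ^ 2) * ‖u p‖ := by
        simp only [norm_smul, norm_mul, norm_pow, norm_norm, Real.norm_eq_abs b,
          Real.norm_eq_abs c]
    _ ≤ |b| * ‖φ‖ * (‖devBilin‖ * ‖u‖ ^ 2) + |c| * (‖ψ‖ * ‖u‖ ^ 2) * ‖u‖ := by
        have h4 : ‖devSq (u p)‖ ≤ ‖devBilin‖ * ‖u‖ ^ 2 :=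
          (norm_devSq_le _).trans (by gcongr)
        gcongr
    _ = _ := by ring

lemma analyticAt_reaction {W : Type*} [NormedAddCommGroup W] [NormedSpace ℝ W] (b c : ℝ)
    {φ ψ : W → SpaceTime →ᵇ ℝ} {u : W → BddMap} {w : W} (hφ : AnalyticAt ℝ φ w)
    (hψ : AnalyticAt ℝ ψ w) (hu : AnalyticAt ℝ u w) :
    AnalyticAt ℝ (fun w => reaction b c (φ w) (ψ w) (u w)) w := by
  unfold reaction
  exact ((analyticAt_const (v := b)).smul (analyticAt_pointwise (ContinuousLinearMap.lsmul ℝ ℝ) hφ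
      (analyticAt_pointwise devBilin hu hu))).sub
    ((analyticAt_const (v := c)).smul (analyticAt_pointwise (ContinuousLinearMap.lsmul ℝ ℝ) hψ
      (analyticAt_pointwise (ContinuousLinearMap.lsmul ℝ ℝ)
        (analyticAt_pointwise (innerSL ℝ) hu hu) hu)))

end Reaction

section Solution

variable {δ a : ℝ}

/-- The coefficient `exp (-a t)` divided by the weight of the solution space. -/
def dampWeight (hδ : 0 < δ) (ha : 0 < a) : BoundedContinuousFunction SpaceTime ℝ :=
  BoundedContinuousFunction.ofNormedAddCommGroup
    (fun p : SpaceTime => Real.exp (-a * p.2) * (timeWeight δ (3 / 2) p.1 p.2)⁻¹)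
    (Continuous.mul (by fun_prop)
      ((timeWeight_continuous δ _).inv₀ fun p => (timeWeight_pos δ _ p).ne')) 1 fun p => by
      have h : (0 : ℝ) < p.2 := p.2.2
      have h1 := one_le_timeWeight hδ (k := 3 / 2) (by norm_num) p
      rw [Real.norm_of_nonneg (by have := timeWeight_pos δ (3 / 2) p; positivity)]
      refine mul_le_one₀ ?_ (inv_nonneg.2 (by linarith)) (inv_le_one_of_one_le₀ h1)
      rw [Real.exp_le_one_iff]
      nlinarith

/-- The reaction term of the rescaled equation, multiplied by the squared weight. -/
def weightedReaction (hδ : 0 < δ) (ha : 0 < a) (b c : ℝ) (U : XSpace δ) : BddMap :=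
  reaction b c 1 (dampWeight hδ ha) (Weighted.equivBCF δ (3 / 2) U)

/-- The reaction term of the equation for `exp (a t) Q`. -/
def rescaledReaction (a b c : ℝ) (s : ℝ) (P : Sym0) : Sym0 :=
  b • devSq P - (c * (Real.exp (-a * s) * ‖P‖ ^ 2)) • P

lemma devSq_smul (r : ℝ) (P : Sym0) : devSq (r • P) = r ^ 2 • devSq P := by
  rw [← devBilin_self, ← devBilin_self, map_smul, map_smul, _root_.smul_apply, smul_smul, pow_two]

/-- The quadratic term scales exactly like the squared weight. The cubic term carries one weight
factor too many, for which the inverse weight in `dampWeight` compensates. -/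
lemma unweightSq_weightedReaction (hδ : 0 < δ) (ha : 0 < a) (b c : ℝ) (U : XSpace δ)
    (p : SpaceTime) :
    unweightSq δ (weightedReaction hδ ha b c U) p = rescaledReaction a b c p.2 (U p) := by
  have hw := timeWeight_pos δ (3 / 2) p
  rw [unweightSq, weightedReaction, reaction_apply, Weighted.equivBCF_apply, rescaledReaction,
    devSq_smul, norm_smul, Real.norm_of_nonneg hw.le, smul_sub]
  simp only [smul_smul]
  congr 2
  · simp only [BoundedContinuousFunction.coe_one, Pi.one_apply]
    field_simp
  · change (timeWeight δ (3 / 2) p.1 p.2 ^ 2)⁻¹ * (c * ((Real.exp (-a * p.2) *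
      (timeWeight δ (3 / 2) p.1 p.2)⁻¹) * _) * _) = _
    field_simp

lemma norm_weightedReaction_le (hδ : 0 < δ) (ha : 0 < a) (b c : ℝ) {U : XSpace δ}
    (hU : ‖U‖ ≤ 1) :
    ‖weightedReaction hδ ha b c U‖ ≤ (|b| * ‖devBilin‖ + |c| * ‖dampWeight hδ ha‖) * ‖U‖ ^ 2 := by
  refine (norm_reaction_le b c _ _ _).trans ?_
  rw [LinearIsometryEquiv.norm_map]
  have h1 : ‖(1 : BoundedContinuousFunction SpaceTime ℝ)‖ ≤ 1 :=
    (BoundedContinuousFunction.norm_le zero_le_one).2 fun p => by simp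
  refine mul_le_mul_of_nonneg_right (add_le_add ?_ ?_) (by positivity)
  · have h2 : |b| * ‖(1 : BoundedContinuousFunction SpaceTime ℝ)‖ ≤ |b| :=
      mul_le_of_le_one_right (abs_nonneg _) h1
    gcongr
  · exact mul_le_of_le_one_right (by positivity) hU

lemma analyticAt_weightedReaction (hδ : 0 < δ) (ha : 0 < a) (b c : ℝ) (U : XSpace δ) :
    AnalyticAt ℝ (weightedReaction hδ ha b c) U :=
  analyticAt_reaction b c analyticAt_const analyticAt_const
    ((Weighted.equivBCF δ (3 / 2)).toContinuousLinearEquiv.toContinuousLinearMap.analyticAt U)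

/-- The analytic solution map of the integral equation for small data. -/
lemma exists_solution_map (hδ : 0 < δ) (ha : 0 < a) (b c : ℝ) : ∃ S : Data δ → XSpace δ,
    AnalyticAt ℝ S 0 ∧ S 0 = 0 ∧ ∀ᶠ Q in 𝓝 0,
      S Q = dataFlow hδ Q + weightedDuhamel hδ ha (weightedReaction hδ ha b c (S Q)) := by
  obtain ⟨Ψ, hΨ, hΨ0, hinv, -⟩ := exists_analytic_inverse
    (G := fun U : XSpace δ => weightedDuhamel hδ ha (weightedReaction hδ ha b c U))
    (C := ‖weightedDuhamel hδ ha‖ * (|b| * ‖devBilin‖ + |c| * ‖dampWeight hδ ha‖))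
    (((weightedDuhamel hδ ha).analyticAt _).comp (analyticAt_weightedReaction hδ ha b c 0)) (by
      filter_upwards [Metric.closedBall_mem_nhds (0 : XSpace δ) one_pos] with U hU
      rw [mem_closedBall_zero_iff] at hU
      rw [mul_assoc]
      exact ((weightedDuhamel hδ ha).le_opNorm _).trans
        (mul_le_mul_of_nonneg_left (norm_weightedReaction_le hδ ha b c hU) (norm_nonneg _)))
  have h0 : dataFlow hδ 0 = 0 := map_zero _
  refine ⟨fun Q => Ψ (dataFlow hδ Q), ?_, (congrArg Ψ h0).trans hΨ0, ?_⟩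
  · refine AnalyticAt.comp (g := Ψ) ?_ ((dataFlow hδ).analyticAt 0)
    rwa [h0]
  · have := (dataFlow hδ).continuous.tendsto 0
    rw [h0] at this
    filter_upwards [this.eventually hinv] with Q hQ
    exact sub_eq_iff_eq_add.1 hQ

end Solution

end QTensor

end

/-! ### Analytic square root and exponential in algebras of bounded functions. -/

noncomputable section

namespace QTensor

section PowerSeries

variable {A : Type*} [NormedCommRing A] [NormedAlgebra ℝ A] [CompleteSpace A]

/-- A power series with geometrically bounded coefficients defines an analytic map. -/
lemma exists_analytic_powerSeries [NormOneClass A] {c : ℕ → A} {C r : ℝ} (hr : 0 < r)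
    (hc : ∀ n, ‖c n‖ * r ^ n ≤ C) : ∃ Φ : A → A, AnalyticAt ℝ Φ 0 ∧
      ∀ᶠ f in 𝓝 0, HasSum (fun n => c n * f ^ n) (Φ f) := by
  set p : FormalMultilinearSeries ℝ A A := fun n =>
    (ContinuousLinearMap.mul ℝ A (c n)).compContinuousMultilinearMap
      (ContinuousMultilinearMap.mkPiAlgebraFin ℝ n A) with hp
  have hpa : ∀ n (y : A), (p n fun _ => y) = c n * y ^ n := fun n y => by
    simp [hp, ContinuousMultilinearMap.mkPiAlgebraFin_apply]
  have hpn : ∀ n, ‖p n‖ ≤ ‖c n‖ := fun n => by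
    refine (ContinuousLinearMap.norm_compContinuousMultilinearMap_le _ _).trans ?_
    rw [ContinuousMultilinearMap.norm_mkPiAlgebraFin, mul_one]
    exact ContinuousLinearMap.opNorm_mul_apply_le ℝ A (c n)
  have hrad : ((r.toNNReal : NNReal) : ℝ≥0∞) ≤ p.radius := by
    refine p.le_radius_of_bound C fun n => ?_
    rw [Real.coe_toNNReal _ hr.le]
    exact (mul_le_mul_of_nonneg_right (hpn n) (by positivity)).trans (hc n)
  have hr0 : 0 < ((r.toNNReal : NNReal) : ℝ≥0∞) := by simpa using hr
  have hs := p.hasFPowerSeriesOnBall (hr0.trans_le hrad)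
  refine ⟨p.sum, hs.analyticAt, ?_⟩
  filter_upwards [Metric.eball_mem_nhds (0 : A) (hr0.trans_le hrad)] with f hf
  have := hs.hasSum hf
  simpa only [hpa, zero_add] using this

/-- The square root of a perturbation of the unit in a commutative Banach algebra. -/
lemma exists_analytic_sqrt : ∃ Φ : A → A, AnalyticAt ℝ Φ 0 ∧ Φ 0 = 1 ∧
    ∀ᶠ f in 𝓝 0, Φ f ^ 2 = 1 + f := by
  -- The root is sought as `1 + v`: then `(1 + v)² = 1 + f` reads `v + ½ v² = ½ f`, a quadratic
  -- perturbation of the identity.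
  obtain ⟨Ψ, hΨ, hΨ0, hinv, -⟩ := exists_analytic_inverse
    (G := fun v : A => -(1 / 2 : ℝ) • v ^ 2) (C := 1 / 2)
    (by fun_prop) (Eventually.of_forall fun v => by
      rw [norm_smul]
      norm_num
      exact norm_pow_le' v two_pos)
  have hl : AnalyticAt ℝ (fun f : A => (1 / 2 : ℝ) • f) 0 := by fun_prop
  refine ⟨fun f => 1 + Ψ ((1 / 2 : ℝ) • f), analyticAt_const.add ?_, by simp [hΨ0], ?_⟩
  · refine AnalyticAt.comp (g := Ψ) ?_ hl
    rwa [smul_zero]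
  · have := hl.continuousAt.tendsto
    simp only [smul_zero] at this
    filter_upwards [this.eventually hinv] with f hf
    have h2 : (2 : ℝ) • (Ψ ((1 / 2 : ℝ) • f) - -(1 / 2 : ℝ) • Ψ ((1 / 2 : ℝ) • f) ^ 2) = f := by
      rw [hf, smul_smul]
      norm_num
    rw [smul_sub, smul_smul, ofNat_smul_eq_nsmul, two_nsmul] at h2
    norm_num at h2
    linear_combination h2

end PowerSeries

section Algebra

open scoped BoundedContinuousFunction

variable {α : Type*} [TopologicalSpace α]

/-- The inverse square root of a perturbation of one, as an analytic map of bounded functions. -/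
lemma exists_analytic_inv_sqrt : ∃ Φ : (α →ᵇ ℝ) → (α →ᵇ ℝ), AnalyticAt ℝ Φ 0 ∧ Φ 0 = 1 ∧
    ∀ᶠ f in 𝓝 0, ∀ p, Φ f p = (Real.sqrt (1 + f p))⁻¹ := by
  obtain ⟨Φ, hΦ, hΦ0, hsq⟩ := exists_analytic_sqrt (A := α →ᵇ ℝ)
  have hinv : AnalyticAt ℝ (fun f => Ring.inverse (Φ f)) 0 := by
    refine AnalyticAt.comp (g := Ring.inverse) ?_ hΦ
    rw [hΦ0]
    exact analyticAt_inverse (1 : (α →ᵇ ℝ)ˣ)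
  refine ⟨fun f => Ring.inverse (Φ f), hinv, by simp [hΦ0], ?_⟩
  have hcont := hΦ.continuousAt
  rw [ContinuousAt, hΦ0] at hcont
  -- Distance less than one from the unit forces positive values, which selects the correct square
  -- root at every point.
  have hclose : ∀ᶠ f in 𝓝 0, ‖Φ f - 1‖ < 1 := by
    have := hcont.eventually (Metric.ball_mem_nhds (1 : α →ᵇ ℝ) one_pos)
    simpa only [dist_eq_norm] using this
  have hunit : ∀ᶠ f in 𝓝 0, IsUnit (Φ f) :=
    hcont.eventually (Units.isOpen.mem_nhds (isUnit_one : IsUnit (1 : α →ᵇ ℝ)))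
  filter_upwards [hsq, hclose, hunit] with f hf1 hf2 hf3 p
  have h1 : Φ f p ^ 2 = 1 + f p := by
    have := DFunLike.congr_fun hf1 p
    simpa using this
  have h2 : 0 < Φ f p := by
    have := ((Φ f - 1).norm_coe_le_norm p).trans_lt hf2
    rw [BoundedContinuousFunction.sub_apply, BoundedContinuousFunction.coe_one, Pi.one_apply,
      Real.norm_eq_abs, abs_lt] at this
    linarith
  have h3 : Ring.inverse (Φ f) p * Φ f p = 1 := by
    have := DFunLike.congr_fun (Ring.inverse_mul_cancel _ hf3) p
    simpa using this
  rw [← h1, Real.sqrt_sq h2.le]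
  exact eq_inv_of_mul_eq_one_left h3

/-- The exponential `exp (ρ (f - ε))` with an unbounded factor `ρ ≥ 0`, as an analytic map of the
bounded function `f`. -/
lemma exists_analytic_exp [Nonempty α] {ρ : α → ℝ} (hρ : Continuous ρ) (hρ0 : ∀ p, 0 ≤ ρ p) {ε : ℝ}
    (hε : 0 < ε) : ∃ Φ : (α →ᵇ ℝ) → (α →ᵇ ℝ), AnalyticAt ℝ Φ 0 ∧
    ∀ᶠ f in 𝓝 0, ∀ p, Φ f p = Real.exp (ρ p * (f p - ε)) := by
  -- Although `ρ` is unbounded, `e^{-ερ}` makes each Taylor coefficient bounded by `ε⁻ⁿ`, since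
  -- `(ερ)ⁿ/n! ≤ e^{ερ}`. The series in `f` therefore has positive radius.
  have hb : ∀ (n : ℕ) (p : α),
      ‖ρ p ^ n / (n.factorial : ℝ) * Real.exp (-(ε * ρ p))‖ ≤ (ε⁻¹) ^ n := fun n p => by
    have h0 := hρ0 p
    rw [Real.norm_of_nonneg (by positivity), inv_pow, inv_eq_one_div,
      le_div_iff₀ (by positivity)]
    have h1 := Real.pow_div_factorial_le_exp (ε * ρ p) (by positivity) n
    rw [mul_pow] at h1
    calc ρ p ^ n / (n.factorial : ℝ) * Real.exp (-(ε * ρ p)) * ε ^ n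
        = (ε ^ n * ρ p ^ n / (n.factorial : ℝ)) * Real.exp (-(ε * ρ p)) := by ring
      _ ≤ Real.exp (ε * ρ p) * Real.exp (-(ε * ρ p)) :=
          mul_le_mul_of_nonneg_right h1 (Real.exp_pos _).le
      _ = 1 := by rw [← Real.exp_add, add_neg_cancel, Real.exp_zero]
  set c : ℕ → α →ᵇ ℝ := fun n => BoundedContinuousFunction.ofNormedAddCommGroup
    (fun p => ρ p ^ n / (n.factorial : ℝ) * Real.exp (-(ε * ρ p))) (by fun_prop) _ (hb n) with hc
  obtain ⟨Φ, hΦ, hsum⟩ := exists_analytic_powerSeries (c := c) (C := 1) hε fun n => by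
    have h1 : ‖c n‖ ≤ (ε⁻¹) ^ n := (BoundedContinuousFunction.norm_le (by positivity)).2 (hb n)
    calc ‖c n‖ * ε ^ n ≤ (ε⁻¹) ^ n * ε ^ n := by gcongr
      _ = 1 := by rw [← mul_pow, inv_mul_cancel₀ hε.ne', one_pow]
  refine ⟨Φ, hΦ, ?_⟩
  filter_upwards [hsum] with f hf p
  have h1 : HasSum (fun n => c n p * f p ^ n) (Φ f p) := by
    have := hf.mapL (BoundedContinuousFunction.evalCLM ℝ p)
    simpa using this
  have h2 : HasSum (fun n => c n p * f p ^ n) (Real.exp (-(ε * ρ p)) * Real.exp (ρ p * f p)) := by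
    have h3 := (NormedSpace.expSeries_div_hasSum_exp (ρ p * f p)).mul_left (Real.exp (-(ε * ρ p)))
    rw [← Real.exp_eq_exp_ℝ] at h3
    refine h3.congr_fun fun n => ?_
    change ρ p ^ n / (n.factorial : ℝ) * Real.exp (-(ε * ρ p)) * f p ^ n = _
    ring
  rw [h1.unique h2, ← Real.exp_add]
  congr 1
  ring

end Algebra

end QTensor

end

/-! ### The analytic family of distorted heat kernels. -/

noncomputable section

namespace QTensor

section KernelFamily

/-- Truncation to the unit interval. -/
def clamp (s : ℝ) : ℝ := max 0 (min 1 s)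

lemma continuous_clamp : Continuous clamp := by unfold clamp; fun_prop

lemma clamp_nonneg (s : ℝ) : 0 ≤ clamp s := le_max_left _ _

lemma clamp_le_one (s : ℝ) : clamp s ≤ 1 := max_le zero_le_one (min_le_left _ _)

lemma clamp_of_mem {s : ℝ} (h0 : 0 ≤ s) (h1 : s ≤ 1) : clamp s = s := by
  rw [clamp, min_eq_right h1, max_eq_right h0]

lemma norm_clamp_le_one (s : ℝ) : ‖clamp s‖ ≤ 1 := by
  rw [Real.norm_of_nonneg (clamp_nonneg s)]
  exact clamp_le_one s

/-- The first argument of the kernels, truncated. -/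
def timeCoord : Ker := BoundedContinuousFunction.ofNormedAddCommGroup (fun q => clamp q.1.1)
  (continuous_clamp.comp (by fun_prop)) 1 fun q => norm_clamp_le_one _

/-- The normalised square of the last argument of the kernels. -/
def radialCoord : Ker := BoundedContinuousFunction.ofNormedAddCommGroup
  (fun q => ‖q.2‖ ^ 2 / (1 + ‖q.2‖ ^ 2))
  (Continuous.div (by fun_prop) (by fun_prop) fun q => by positivity) 1 fun q => by
    rw [Real.norm_of_nonneg (by positivity), div_le_one (by positivity)]
    linarith

/-- The normalised product of the second argument and a coordinate of the last one. -/
def crossCoord (i : Fin 3) : Ker := BoundedContinuousFunction.ofNormedAddCommGroup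
  (fun q => clamp q.1.2 * (q.2 i / (1 + ‖q.2‖ ^ 2)))
  (Continuous.mul (continuous_clamp.comp (by fun_prop))
    (Continuous.div (by fun_prop) (by fun_prop) fun q => by positivity)) 1 fun q => by
    rw [norm_mul]
    refine mul_le_one₀ (norm_clamp_le_one _) (norm_nonneg _) ?_
    rw [norm_div, Real.norm_of_nonneg (by positivity : 0 ≤ 1 + ‖q.2‖ ^ 2),
      div_le_one (by positivity)]
    have := abs_apply_le_norm q.2 i
    rw [Real.norm_eq_abs]
    nlinarith [sq_nonneg (‖q.2‖ - 1 / 2)]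

/-- The normalised square of the second argument of the kernels. -/
def shiftCoord : Ker := BoundedContinuousFunction.ofNormedAddCommGroup
  (fun q => clamp q.1.2 ^ 2 * (1 + ‖q.2‖ ^ 2)⁻¹)
  (Continuous.mul ((continuous_clamp.comp (by fun_prop)).pow 2)
    (Continuous.inv₀ (by fun_prop) fun q => by positivity)) 1 fun q => by
    rw [norm_mul, norm_pow]
    refine mul_le_one₀ (pow_le_one₀ (norm_nonneg _) (norm_clamp_le_one _)) (norm_nonneg _) ?_
    rw [Real.norm_of_nonneg (by positivity)]
    exact inv_le_one_of_one_le₀ (by nlinarith [sq_nonneg ‖q.2‖])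

/-- The normalised exponent of the transformed kernel. -/
def kerExponent (s : Ker) (p : ℝ × E) : Ker :=
  (1 / 4 : ℝ) • ((1 - s ^ 2) * radialCoord -
    s ^ 2 * ((∑ i, (2 * p.2 i) • crossCoord i) + (∑ i, p.2 i ^ 2) • shiftCoord))

/-- The right side is the change from the Gaussian exponent `-¼ |w|²` to `-¼ s² |w + dμ|²`. It grows
quadratically in `w`, so only its quotient by `1 + |w|²` is a bounded function; that factor serves
as `ρ` in `exists_analytic_exp`. On `[0, 1]`, where `bumpQuot` takes its values, the truncation
`clamp` is invisible. -/
lemma kerExponent_apply (s : Ker) (p : ℝ × E) (D d : ℝ) (w : E) (h0 : 0 ≤ d) (h1 : d ≤ 1) :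
    (1 + ‖w‖ ^ 2) * kerExponent s p ((D, d), w) =
      (1 / 4) * (‖w‖ ^ 2 - s ((D, d), w) ^ 2 * ‖w + d • p.2‖ ^ 2) := by
  have h : ‖w + d • p.2‖ ^ 2 = ‖w‖ ^ 2 + 2 * d * (∑ i, p.2 i * w i) + d ^ 2 * ∑ i, p.2 i ^ 2 := by
    rw [norm_add_sq_real, norm_smul, inner_smul_right, mul_pow, Real.norm_eq_abs, sq_abs,
      EuclideanSpace.real_norm_sq_eq p.2, PiLp.inner_apply]
    simp only [RCLike.inner_apply, conj_trivial]
    ring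
  have hw : (1 + ‖w‖ ^ 2) ≠ 0 := by positivity
  have e : kerExponent s p ((D, d), w) = 1 / 4 * ((1 - s ((D, d), w) ^ 2) *
      (‖w‖ ^ 2 / (1 + ‖w‖ ^ 2)) - s ((D, d), w) ^ 2 *
      ((∑ i, 2 * p.2 i * (clamp d * (w i / (1 + ‖w‖ ^ 2)))) +
        (∑ i, p.2 i ^ 2) * (clamp d ^ 2 * (1 + ‖w‖ ^ 2)⁻¹))) := by
    simp only [kerExponent, Fin.sum_univ_three]
    rfl
  rw [e, h, clamp_of_mem h0 h1]
  simp only [Fin.sum_univ_three]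
  field_simp
  ring

lemma analyticAt_kerExponent {s : ℝ × E → Ker} (hs : AnalyticAt ℝ s 0) :
    AnalyticAt ℝ (fun p => kerExponent (s p) p) 0 := by
  have key : ∀ c₀ c₁ c₂ : ℝ × E → ℝ, AnalyticAt ℝ c₀ 0 → AnalyticAt ℝ c₁ 0 → AnalyticAt ℝ c₂ 0 →
      AnalyticAt ℝ (fun p => (1 / 4 : ℝ) • ((1 - s p ^ 2) * radialCoord -
        s p ^ 2 * (((2 * c₀ p) • crossCoord 0 + (2 * c₁ p) • crossCoord 1 +
          (2 * c₂ p) • crossCoord 2) + (c₀ p ^ 2 + c₁ p ^ 2 + c₂ p ^ 2) • shiftCoord))) 0 := by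
    intros
    fun_prop
  have hc : ∀ i : Fin 3, AnalyticAt ℝ (fun p : ℝ × E => p.2 i) 0 := fun i =>
    ((EuclideanSpace.proj i : E →L[ℝ] ℝ).comp (ContinuousLinearMap.snd ℝ ℝ E)).analyticAt 0
  simpa only [kerExponent, Fin.sum_univ_three] using key _ _ _ (hc 0) (hc 1) (hc 2)

/-- The heat kernel in space-time coordinates distorted by the parameter `(λ, μ)`, as an analytic
family of bounded functions. -/
lemma exists_kernel_family : ∃ κ : ℝ × E → Ker, AnalyticAt ℝ κ 0 ∧ κ 0 = heatKer ∧
    ∀ᶠ p in 𝓝 0, ∀ (D d : ℝ) (w : E), 0 ≤ D → D ≤ 1 → 0 ≤ d → d ≤ 1 →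
      gauss w * κ p ((D, d), w) = (Real.sqrt (1 + p.1 * D))⁻¹ ^ 3 *
        heatKernel 1 ((Real.sqrt (1 + p.1 * D))⁻¹ • (w + d • p.2)) := by
  obtain ⟨Φ, hΦ, hΦ0, hsqrt⟩ := exists_analytic_inv_sqrt (α := (ℝ × ℝ) × E)
  -- With `ρ = 1 + |w|²` and `ε = 3/16`, the value at exponent zero is `e^{-3/16}` times the
  -- Gaussian factor of `heatKer`; the prefactor `e^{3/16}` of the family undoes this constant.
  obtain ⟨X, hX, hexp⟩ := exists_analytic_exp (α := (ℝ × ℝ) × E) (ρ := fun q => 1 + ‖q.2‖ ^ 2)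
    (by fun_prop) (fun q => by positivity) (ε := 3 / 16) (by norm_num)
  have hl : AnalyticAt ℝ (fun p : ℝ × E => p.1 • timeCoord) 0 :=
    ((ContinuousLinearMap.fst ℝ ℝ E).smulRight timeCoord).analyticAt 0
  have hl0 : (0 : ℝ × E).1 • timeCoord = 0 := by simp
  obtain ⟨s, hs, hs0, hsv⟩ : ∃ s : ℝ × E → Ker, AnalyticAt ℝ s 0 ∧ s 0 = 1 ∧
      ∀ᶠ p in 𝓝 0, ∀ q, s p q = (Real.sqrt (1 + p.1 * timeCoord q))⁻¹ := by
    refine ⟨fun p => Φ (p.1 • timeCoord), AnalyticAt.comp (g := Φ) (by rwa [hl0]) hl,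
      (congrArg Φ hl0).trans hΦ0, ?_⟩
    have := hl.continuousAt.tendsto
    rw [hl0] at this
    exact this.eventually hsqrt
  have hf := analyticAt_kerExponent hs
  have hf0 : kerExponent (s 0) 0 = 0 := by
    rw [hs0, kerExponent]
    simp
  obtain ⟨x, hx, hxv⟩ : ∃ x : ℝ × E → Ker, AnalyticAt ℝ x 0 ∧ ∀ᶠ p in 𝓝 0, ∀ q,
      x p q = Real.exp ((1 + ‖q.2‖ ^ 2) * (kerExponent (s p) p q - 3 / 16)) := by
    refine ⟨fun p => X (kerExponent (s p) p), AnalyticAt.comp (g := X)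
      (f := fun p => kerExponent (s p) p) (by rwa [hf0]) hf, ?_⟩
    have := hf.continuousAt.tendsto
    rw [hf0] at this
    exact this.eventually hexp
  refine ⟨fun p => (((4 * Real.pi * 1) ^ (3 / 2 : ℝ))⁻¹ * Real.exp (3 / 16)) •
    (s p ^ 3 * x p), by fun_prop, ?_, ?_⟩
  · ext1 q
    have h7 := hxv.self_of_nhds q
    rw [hf0] at h7
    rw [BoundedContinuousFunction.smul_apply, hs0, one_pow, one_mul, h7, heatKer_apply,
      smul_eq_mul, mul_assoc, ← Real.exp_add]
    congr 2
    rw [BoundedContinuousFunction.coe_zero, Pi.zero_apply]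
    ring
  · filter_upwards [hsv, hxv] with p hp5 hp6 D d w hD0 hD1 hd0 hd1
    have h8 : s p ((D, d), w) = (Real.sqrt (1 + p.1 * D))⁻¹ := by
      rw [hp5]
      change (Real.sqrt (1 + p.1 * clamp D))⁻¹ = _
      rw [clamp_of_mem hD0 hD1]
    rw [BoundedContinuousFunction.smul_apply, BoundedContinuousFunction.mul_apply, hp6,
      BoundedContinuousFunction.pow_apply, h8, mul_sub, kerExponent_apply _ _ _ _ _ hd0 hd1, h8,
      heatKernel_eq, gauss, norm_smul, mul_pow, norm_inv, Real.norm_of_nonneg (Real.sqrt_nonneg _),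
      smul_eq_mul]
    set r := (Real.sqrt (1 + p.1 * D))⁻¹
    set n := ‖w + d • p.2‖
    set K := ((4 * Real.pi * 1) ^ (3 / 2 : ℝ))⁻¹
    have e : Real.exp (-(1 / 16) * ‖w‖ ^ 2) * Real.exp (3 / 16) *
        Real.exp (1 / 4 * (‖w‖ ^ 2 - r ^ 2 * n ^ 2) - (1 + ‖w‖ ^ 2) * (3 / 16)) =
        Real.exp (-(1 / 4) * (r ^ 2 * n ^ 2)) := by
      rw [← Real.exp_add, ← Real.exp_add]
      congr 1
      ring
    calc Real.exp (-(1 / 16) * ‖w‖ ^ 2) * (K * Real.exp (3 / 16) * (r ^ 3 *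
          Real.exp (1 / 4 * (‖w‖ ^ 2 - r ^ 2 * n ^ 2) - (1 + ‖w‖ ^ 2) * (3 / 16))))
        = r ^ 3 * (K * (Real.exp (-(1 / 16) * ‖w‖ ^ 2) * Real.exp (3 / 16) *
          Real.exp (1 / 4 * (‖w‖ ^ 2 - r ^ 2 * n ^ 2) - (1 + ‖w‖ ^ 2) * (3 / 16)))) := by ring
      _ = r ^ 3 * (K * Real.exp (-(1 / (4 * 1)) * (r ^ 2 * n ^ 2))) := by rw [e, mul_one]

end KernelFamily

end QTensor

end

/-! ### Space-time distortions and the kernels they induce. -/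

noncomputable section

namespace QTensor

section Distortion

/-- The distorted time `t + λ (1 - exp (-t))`. -/
def distort (l t : ℝ) : ℝ := t + l * timeBump t

lemma timeBump_sub (s t : ℝ) :
    timeBump t - timeBump s = Real.exp (-s) * (1 - Real.exp (-(t - s))) := by
  rw [mul_sub, ← Real.exp_add, timeBump, timeBump]
  ring_nf

lemma timeBump_zero : timeBump 0 = 0 := by simp [timeBump]

lemma timeBump_pos {t : ℝ} (ht : 0 < t) : 0 < timeBump t := by
  rw [timeBump, sub_pos, Real.exp_lt_one_iff]
  linarith

lemma timeBump_le_one (t : ℝ) : timeBump t ≤ 1 := by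
  have := Real.exp_pos (-t)
  rw [timeBump]
  linarith

lemma timeBump_sub_nonneg {s t : ℝ} (hst : s ≤ t) : 0 ≤ timeBump t - timeBump s := by
  rw [timeBump_sub]
  refine mul_nonneg (Real.exp_pos _).le (sub_nonneg.2 (Real.exp_le_one_iff.2 (by linarith)))

lemma timeBump_sub_le {s t : ℝ} (hs : 0 ≤ s) (hst : s ≤ t) :
    timeBump t - timeBump s ≤ min 1 (t - s) := by
  have h1 : Real.exp (-s) ≤ 1 := Real.exp_le_one_iff.2 (by linarith)
  have h2 : 0 ≤ 1 - Real.exp (-(t - s)) :=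
    sub_nonneg.2 (Real.exp_le_one_iff.2 (by linarith))
  have h3 := Real.add_one_le_exp (-(t - s))
  have h4 := Real.exp_pos (-(t - s))
  rw [timeBump_sub]
  refine (mul_le_of_le_one_left h2 h1).trans (le_min (by linarith) (by linarith))

/-- The increment of `timeBump` is at most `min 1 τ` with `τ = t - s`, hence at most both `τ` and
`√τ`. Boundedness and the Lipschitz property of `timeBump` are both needed. -/
lemma bumpQuot_mem {s t : ℝ} (hs : 0 ≤ s) (hst : s < t) :
    0 ≤ (bumpQuot t s).1 ∧ (bumpQuot t s).1 ≤ 1 ∧ 0 ≤ (bumpQuot t s).2 ∧ (bumpQuot t s).2 ≤ 1 := by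
  have h1 := timeBump_sub_nonneg hst.le
  have h2 := timeBump_sub_le hs hst.le
  have h3 : 0 < t - s := sub_pos.2 hst
  have h4 : 0 < Real.sqrt (t - s) := Real.sqrt_pos.2 h3
  refine ⟨div_nonneg h1 h3.le, (div_le_one h3).2 (h2.trans (min_le_right _ _)),
    div_nonneg h1 h4.le, (div_le_one h4).2 (h2.trans ?_)⟩
  rcases le_total 1 (t - s) with h | h
  · exact (min_le_left _ _).trans (Real.one_le_sqrt.2 h)
  · exact (min_le_right _ _).trans (Real.le_sqrt_of_sq_le (by nlinarith))

/-- Elapsed time is multiplied by `1 + λD` with `D ∈ [0, 1]`, so `|λ| < 1` preserves the order of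
times. -/
lemma distort_sub {l s t : ℝ} (hst : s < t) :
    distort l t - distort l s = (t - s) * (1 + l * (bumpQuot t s).1) := by
  have h : t - s ≠ 0 := (sub_pos.2 hst).ne'
  rw [distort, distort, bumpQuot]
  field_simp
  ring

lemma one_add_mul_pos {l D : ℝ} (hl : |l| < 1) (h0 : 0 ≤ D) (h1 : D ≤ 1) : 0 < 1 + l * D := by
  have := abs_lt.1 hl
  nlinarith

lemma distort_strictMonoOn {l : ℝ} (hl : |l| < 1) : StrictMonoOn (distort l) (Ici 0) := by
  intro s hs t _ hst
  obtain ⟨h0, h1, -⟩ := bumpQuot_mem hs hst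
  rw [← sub_pos, distort_sub hst]
  exact mul_pos (sub_pos.2 hst) (one_add_mul_pos hl h0 h1)

lemma distort_zero (l : ℝ) : distort l 0 = 0 := by rw [distort, timeBump_zero]; ring

lemma distort_pos {l t : ℝ} (hl : |l| < 1) (ht : 0 < t) : 0 < distort l t := by
  have := distort_strictMonoOn hl (mem_Ici.2 le_rfl) (mem_Ici.2 ht.le) ht
  rwa [distort_zero] at this

lemma continuous_distort (l : ℝ) : Continuous (distort l) :=
  continuous_id.add (continuous_const.mul continuous_timeBump)

lemma hasDerivAt_distort (l t : ℝ) : HasDerivAt (distort l) (1 + l * Real.exp (-t)) t := by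
  have h : HasDerivAt timeBump (Real.exp (-t)) t := by
    have := ((hasDerivAt_neg t).exp).const_sub 1
    rw [mul_neg_one, neg_neg] at this
    exact this
  exact (hasDerivAt_id t).add (h.const_mul l)

lemma image_distort {l t : ℝ} (hl : |l| < 1) (ht : 0 < t) :
    distort l '' Ioo 0 t = Ioo 0 (distort l t) := by
  refine subset_antisymm ?_ ?_
  · rintro _ ⟨s, hs, rfl⟩
    exact ⟨distort_pos hl hs.1,
      distort_strictMonoOn hl (mem_Ici.2 hs.1.le) (mem_Ici.2 ht.le) hs.2⟩
  · have := intermediate_value_Ioo ht.le (continuous_distort l).continuousOn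
    rwa [distort_zero] at this

lemma setIntegral_distort {F : Type*} [NormedAddCommGroup F] [NormedSpace ℝ F] {l t : ℝ}
    (hl : |l| < 1) (ht : 0 < t) (f : ℝ → F) :
    ∫ s in Ioo 0 (distort l t), f s =
      ∫ s in Ioo 0 t, (1 + l * Real.exp (-s)) • f (distort l s) := by
  rw [← image_distort hl ht, integral_image_eq_integral_abs_deriv_smul measurableSet_Ioo
    (fun s _ => (hasDerivAt_distort l s).hasDerivWithinAt)
    ((distort_strictMonoOn hl).injOn.mono fun s hs => mem_Ici.2 hs.1.le)]
  refine setIntegral_congr_fun measurableSet_Ioo fun s hs => ?_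
  have h1 : Real.exp (-s) ≤ 1 := Real.exp_le_one_iff.2 (by linarith [hs.1])
  simp only [abs_of_pos (one_add_mul_pos hl (Real.exp_pos (-s)).le h1)]

variable {κ : Ker} {p : ℝ × E}

/-- The kernel `κ` is the heat kernel in coordinates distorted by `p = (λ, μ)`. -/
def IsDistortedKernel (κ : Ker) (p : ℝ × E) : Prop :=
  ∀ (D d : ℝ) (w : E), 0 ≤ D → D ≤ 1 → 0 ≤ d → d ≤ 1 →
    gauss w * κ ((D, d), w) = (Real.sqrt (1 + p.1 * D))⁻¹ ^ 3 *
      heatKernel 1 ((Real.sqrt (1 + p.1 * D))⁻¹ • (w + d • p.2))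

/-- Substitute `w' = r⁻¹ (w + dμ)` with `r = √(1 + λD)`; the Jacobian is the factor `r⁻³` in the
kernel. Since `√(t - s) · r` is the root of the distorted elapsed time and `√(t - s) · d` the
increment of `timeBump`, the ordinary heat flow between the displaced points appears. -/
lemma IsDistortedKernel.integral_eq (hκ : IsDistortedKernel κ p) (hp : |p.1| < 1) {s t : ℝ}
    (hs : 0 ≤ s) (hst : s < t) (f : E → Sym0) (x : E) :
    ∫ w, (gauss w * κ (bumpQuot t s, w)) • f (x - Real.sqrt (t - s) • w) =
      heatFlow (distort p.1 t - distort p.1 s) (fun y => f (y - timeBump s • p.2))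
        (x + timeBump t • p.2) := by
  obtain ⟨hD0, hD1, hd0, hd1⟩ := bumpQuot_mem hs hst
  have hτ : 0 < t - s := sub_pos.2 hst
  set D := (bumpQuot t s).1
  set d := (bumpQuot t s).2 with hd
  have hk : 0 < 1 + p.1 * D := one_add_mul_pos hp hD0 hD1
  set r := Real.sqrt (1 + p.1 * D) with hr
  have hr0 : 0 < r := Real.sqrt_pos.2 hk
  have e1 : Real.sqrt (distort p.1 t - distort p.1 s) = Real.sqrt (t - s) * r := by
    rw [distort_sub hst, Real.sqrt_mul hτ.le]
  have e2 : Real.sqrt (t - s) * d = timeBump t - timeBump s := by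
    rw [hd, bumpQuot]
    field_simp
  set F : E → Sym0 := fun w' => heatKernel 1 w' •
    f (x + (timeBump t - timeBump s) • p.2 - (Real.sqrt (t - s) * r) • w') with hF
  have e3 : ∀ w, (gauss w * κ (bumpQuot t s, w)) • f (x - Real.sqrt (t - s) • w) =
      (r⁻¹ ^ 3) • F (r⁻¹ • (w + d • p.2)) := fun w => by
    rw [hκ D d w hD0 hD1 hd0 hd1, hF, mul_smul]
    dsimp only
    congr 3
    rw [smul_smul, mul_assoc, mul_inv_cancel₀ hr0.ne', mul_one, smul_add, smul_smul, e2]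
    abel
  calc ∫ w, (gauss w * κ (bumpQuot t s, w)) • f (x - Real.sqrt (t - s) • w)
      = ∫ w, (r⁻¹ ^ 3) • F (r⁻¹ • (w + d • p.2)) := integral_congr_ae (Eventually.of_forall e3)
    _ = (r⁻¹ ^ 3) • ∫ w, F (r⁻¹ • w) := by
        rw [integral_smul, integral_add_right_eq_self (fun w => F (r⁻¹ • w))]
    _ = ∫ w, F w := by
        rw [Measure.integral_comp_inv_smul, smul_smul, finrank_euclideanSpace_fin,
          abs_of_pos (by positivity), inv_pow, inv_mul_cancel₀ (by positivity), one_smul]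
    _ = _ := by
        rw [heatFlow, e1]
        refine integral_congr_ae (Eventually.of_forall fun w => ?_)
        simp only [hF]
        congr 2
        rw [sub_smul]
        abel

lemma IsDistortedKernel.freeFlow_eq (hκ : IsDistortedKernel κ p) (hp : |p.1| < 1) {t : ℝ}
    (ht : 0 < t) (f : E → Sym0) (x : E) :
    freeFlow κ f x t = heatFlow (distort p.1 t) f (x + timeBump t • p.2) := by
  have := hκ.integral_eq hp le_rfl ht f x
  rw [freeFlow]
  simpa only [sub_zero, distort_zero, timeBump_zero, zero_smul] using this

lemma IsDistortedKernel.duhamel_eq (hκ : IsDistortedKernel κ p) (hp : |p.1| < 1) {a : ℝ}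
    (ha : 0 < a) {g : E → ℝ → Sym0}
    (hg : ContinuousOn (fun q : E × ℝ => g q.1 q.2) (univ ×ˢ Ioi 0)) {M : ℝ}
    (hM : ∀ x t, 0 < t → ‖g x t‖ ≤ M) (x : E) (t : ℝ) :
    duhamel a κ g x t = ∫ s in Ioo 0 t, Real.exp (-a * s) •
      heatFlow (distort p.1 t - distort p.1 s) (fun y => g (y - timeBump s • p.2) s)
        (x + timeBump t • p.2) := by
  have h := integrableOn_duhamelIntegrand ha κ hg hM x t
  rw [duhamel, Measure.volume_eq_prod, setIntegral_prod _ h]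
  refine setIntegral_congr_fun measurableSet_Ioo fun s hs => ?_
  rw [← hκ.integral_eq hp hs.1.le hs.2 (fun y => g y s) x, setIntegral_univ, ← integral_smul]
  simp only [duhamelIntegrand, smul_smul]

end Distortion

/-! ### The integral equation in distorted coordinates. -/

section DistortedSolution

open scoped BoundedContinuousFunction

/-- The coefficients of the reaction term in distorted coordinates. -/
lemma exists_coeff_family (k : ℝ) : ∃ φ : ℝ × E → SpaceTime →ᵇ ℝ, AnalyticAt ℝ φ 0 ∧
    ∀ᶠ p in 𝓝 0, ∀ q, φ p q = (1 + p.1 * Real.exp (-q.2)) * Real.exp (-k * p.1 * timeBump q.2) := by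
  have hpos : ∀ q : SpaceTime, (0 : ℝ) < q.2 := fun q => q.2.2
  have : Nonempty SpaceTime := ⟨(0, ⟨1, mem_Ioi.2 one_pos⟩)⟩
  set e : SpaceTime →ᵇ ℝ := BoundedContinuousFunction.ofNormedAddCommGroup
    (fun q => Real.exp (-(q.2 : ℝ))) (by fun_prop) 1 fun q => by
      rw [Real.norm_of_nonneg (Real.exp_pos _).le, Real.exp_le_one_iff]
      linarith [hpos q]
  set θ : SpaceTime →ᵇ ℝ := BoundedContinuousFunction.ofNormedAddCommGroup
    (fun q => timeBump q.2) (continuous_timeBump.comp (by fun_prop)) 1 fun q => by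
      rw [Real.norm_of_nonneg (timeBump_pos (hpos q)).le]
      exact timeBump_le_one _
  obtain ⟨X, hX, hexp⟩ := exists_analytic_exp (α := SpaceTime) (ρ := fun _ => 1)
    continuous_const (fun q => zero_le_one) (ε := 1) one_pos
  have hl : ∀ u : SpaceTime →ᵇ ℝ, AnalyticAt ℝ (fun p : ℝ × E => p.1 • u) 0 := fun u =>
    ((ContinuousLinearMap.fst ℝ ℝ E).smulRight u).analyticAt 0
  have hl0 : ∀ u : SpaceTime →ᵇ ℝ, (0 : ℝ × E).1 • u = 0 := fun u => by simp
  obtain ⟨x, hx, hxv⟩ : ∃ x : ℝ × E → SpaceTime →ᵇ ℝ, AnalyticAt ℝ x 0 ∧ ∀ᶠ p in 𝓝 0, ∀ q,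
      x p q = Real.exp (1 * (p.1 * (-k * timeBump q.2) - 1)) := by
    refine ⟨fun p => X (p.1 • (-k) • θ), AnalyticAt.comp (g := X)
      (f := fun p : ℝ × E => p.1 • (-k) • θ) (by rwa [hl0]) (hl _), ?_⟩
    have := (hl ((-k) • θ)).continuousAt.tendsto
    rw [hl0] at this
    exact this.eventually hexp
  obtain ⟨y, hy, hyv⟩ : ∃ y : ℝ × E → SpaceTime →ᵇ ℝ, AnalyticAt ℝ y 0 ∧ ∀ p q,
      y p q = p.1 * Real.exp (-q.2) := ⟨_, hl e, fun p q => rfl⟩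
  -- The factor `e` cancels the `e^{-1}` produced by `exists_analytic_exp` with `ρ = ε = 1`.
  refine ⟨fun p => Real.exp 1 • ((1 + y p) * x p), by fun_prop, ?_⟩
  filter_upwards [hxv] with p hp q
  rw [BoundedContinuousFunction.smul_apply, BoundedContinuousFunction.mul_apply,
    BoundedContinuousFunction.add_apply, BoundedContinuousFunction.coe_one, Pi.one_apply, hp, hyv,
    smul_eq_mul, mul_left_comm, ← Real.exp_add]
  congr 2
  ring

/-- A bounded map in coordinates distorted by `p = (λ, μ)`. -/
def distortMap (U : BddMap) (p : ℝ × E) (hp : |p.1| < 1) : BddMap :=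
  BoundedContinuousFunction.ofNormedAddCommGroup
    (fun q : SpaceTime => U (q.1 + timeBump q.2 • p.2, ⟨distort p.1 q.2, distort_pos hp q.2.2⟩))
    (U.continuous.comp ((continuous_fst.add ((continuous_timeBump.comp (by fun_prop)).smul
      continuous_const)).prodMk (Continuous.subtype_mk
        ((continuous_distort p.1).comp (by fun_prop)) _))) ‖U‖ fun q => U.norm_coe_le_norm _

lemma norm_distortMap_le (U : BddMap) (p : ℝ × E) (hp : |p.1| < 1) :
    ‖distortMap U p hp‖ ≤ ‖U‖ :=
  (BoundedContinuousFunction.norm_le (norm_nonneg _)).2 fun _ => U.norm_coe_le_norm _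

lemma extend_distortMap (U : BddMap) (p : ℝ × E) (hp : |p.1| < 1) (x : E) {t : ℝ} (ht : 0 < t) :
    extend (distortMap U p hp) x t = extend U (x + timeBump t • p.2) (distort p.1 t) := by
  rw [extend_of_pos _ _ ht, extend_of_pos _ _ (distort_pos hp ht)]
  rfl

/-- The integral equation in distorted coordinates. -/
lemma distortMap_eq {a b c : ℝ} (ha : 0 < a) {f : E → Sym0} {M : ℝ}
    (hf : AEStronglyMeasurable f (volume : Measure E)) (hM : ∀ᵐ x, ‖f x‖ ≤ M)
    {U : BddMap} {p : ℝ × E} (hp : |p.1| < 1) {κ : Ker} (hκ : IsDistortedKernel κ p)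
    {φ ψ : SpaceTime →ᵇ ℝ}
    (hφ : ∀ q, φ q = (1 + p.1 * Real.exp (-q.2)) * Real.exp (-a * p.1 * timeBump q.2))
    (hψ : ∀ q, ψ q = Real.exp (-a * q.2) *
      ((1 + p.1 * Real.exp (-q.2)) * Real.exp (-(2 * a) * p.1 * timeBump q.2)))
    {N : BddMap} (hN : ∀ q, N q = rescaledReaction a b c q.2 (U q))
    (hU : U = freeFlowOp hf hM heatKer + duhamelOp ha heatKer N) :
    distortMap U p hp =
      freeFlowOp hf hM κ + duhamelOp ha κ (reaction b c φ ψ (distortMap U p hp)) := by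
  ext1 q
  obtain ⟨x, t, ht⟩ := q
  rw [mem_Ioi] at ht
  set R := reaction b c φ ψ (distortMap U p hp)
  -- With `s' = s + λθ(s)`, the measure `e^{-as'} ds'` is `e^{-as} ds` times the Jacobian `1 +
  -- λe^{-s}` and `e^{-a(s'-s)}`, which are put into the coefficients. The cubic term has a further
  -- factor `e^{-as'}`; this accounts for `2a` and `e^{-as}` in `ψ`.
  have hR : ∀ (y : E) (s : ℝ), 0 < s → extend R (y - timeBump s • p.2) s =
      ((1 + p.1 * Real.exp (-s)) * Real.exp (-a * (distort p.1 s - s))) •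
        extend N y (distort p.1 s) := fun y s hs => by
    have h1 : extend (distortMap U p hp) (y - timeBump s • p.2) s = extend U y (distort p.1 s) := by
      rw [extend_distortMap _ _ _ _ hs, sub_add_cancel]
    rw [extend_of_pos _ _ hs] at h1 ⊢
    rw [extend_of_pos _ _ (distort_pos hp hs)] at h1 ⊢
    rw [reaction_apply, h1, hN, rescaledReaction, hφ, hψ, smul_sub, smul_smul, smul_smul]
    have e1 : distort p.1 s - s = p.1 * timeBump s := by rw [distort]; ring
    have e2 : Real.exp (-a * s) * Real.exp (-(2 * a) * p.1 * timeBump s) =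
        Real.exp (-a * (p.1 * timeBump s)) * Real.exp (-a * distort p.1 s) := by
      rw [← Real.exp_add, ← Real.exp_add, distort]
      ring_nf
    rw [e1]
    dsimp only
    congr 2
    · rw [mul_comm b, mul_assoc (-a)]
    · linear_combination c * (1 + p.1 * Real.exp (-s)) *
        ‖U (y, ⟨distort p.1 s, distort_pos hp hs⟩)‖ ^ 2 * e2
  have h1 := DFunLike.congr_fun hU (x + timeBump t • p.2, ⟨distort p.1 t, distort_pos hp ht⟩)
  rw [BoundedContinuousFunction.add_apply, freeFlowOp_apply, duhamelOp_apply, freeFlow_heatKer,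
    duhamel_heatKer ha (continuousOn_extend N.continuous)
      (fun y s hs => norm_extend_le N.norm_coe_le_norm y hs), setIntegral_distort hp ht] at h1
  rw [BoundedContinuousFunction.add_apply, freeFlowOp_apply, duhamelOp_apply,
    hκ.freeFlow_eq hp ht, hκ.duhamel_eq hp ha (continuousOn_extend R.continuous)
      (fun y s hs => norm_extend_le R.norm_coe_le_norm y hs)]
  refine h1.trans ?_
  congr 1
  refine setIntegral_congr_fun measurableSet_Ioo fun s hs => ?_
  simp only [hR _ s hs.1, heatFlow_const_smul, smul_smul]
  congr 1
  rw [mul_left_comm, ← Real.exp_add]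
  congr 2
  ring

end DistortedSolution

end QTensor

end

/-! ### Smoothness from analytic dependence on the distortion. -/

noncomputable section

namespace QTensor

section Smoothness

open scoped BoundedContinuousFunction

/-- The exponential `exp (-a t)` as a bounded function. -/
def dampFun {a : ℝ} (ha : 0 < a) : SpaceTime →ᵇ ℝ :=
  BoundedContinuousFunction.ofNormedAddCommGroup (fun q => Real.exp (-a * q.2)) (by fun_prop) 1
    fun q => by
      have h : (0 : ℝ) < q.2 := q.2.2
      rw [Real.norm_of_nonneg (Real.exp_pos _).le, Real.exp_le_one_iff]
      nlinarith

lemma norm_duhamelOp_le {a : ℝ} (ha : 0 < a) (κ : Ker) (g : BddMap) :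
    ‖duhamelOp ha κ g‖ ≤ ‖duhamelOp ha‖ * ‖κ‖ * ‖g‖ :=
  ContinuousLinearMap.le_opNorm₂ (duhamelOp ha) κ g

/-- The nonlinear part of the integral equation in distorted coordinates. -/
def distortedNonlinearity {a : ℝ} (ha : 0 < a) (b c : ℝ) (κ : ℝ × E → Ker)
    (φ ψ : ℝ × E → SpaceTime →ᵇ ℝ) (z : (ℝ × E) × BddMap) : (ℝ × E) × BddMap :=
  (0, duhamelOp ha (κ z.1) (reaction b c (φ z.1) (ψ z.1) z.2))

lemma analyticAt_distortedNonlinearity {a : ℝ} (ha : 0 < a) (b c : ℝ) {κ : ℝ × E → Ker}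
    {φ ψ : ℝ × E → SpaceTime →ᵇ ℝ} (hκ : AnalyticAt ℝ κ 0) (hφ : AnalyticAt ℝ φ 0)
    (hψ : AnalyticAt ℝ ψ 0) : AnalyticAt ℝ (distortedNonlinearity ha b c κ φ ψ) 0 := by
  have hfst : AnalyticAt ℝ (fun z : (ℝ × E) × BddMap => z.1) 0 := analyticAt_fst
  have hcomp : ∀ {F : Type} [NormedAddCommGroup F] [NormedSpace ℝ F] {g : ℝ × E → F},
      AnalyticAt ℝ g 0 → AnalyticAt ℝ (fun z : (ℝ × E) × BddMap => g z.1) 0 := fun {F} _ _ {g} hg =>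
    AnalyticAt.comp (g := g) (f := fun z : (ℝ × E) × BddMap => z.1) (x := 0) hg hfst
  have hR := analyticAt_reaction b c (hcomp hφ)
    (hcomp hψ)
    (analyticAt_snd : AnalyticAt ℝ (fun z : (ℝ × E) × BddMap => z.2) 0)
  exact analyticAt_const.prod (AnalyticAt.comp₂ (h := fun q => duhamelOp ha q.1 q.2)
    (ContinuousLinearMap.analyticAt_bilinear (duhamelOp ha) _)
    (hcomp hκ) hR)

lemma exists_norm_distortedNonlinearity_le {a : ℝ} (ha : 0 < a) (b c : ℝ) {κ : ℝ × E → Ker}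
    {φ ψ : ℝ × E → SpaceTime →ᵇ ℝ} (hκ : AnalyticAt ℝ κ 0) (hφ : AnalyticAt ℝ φ 0)
    (hψ : AnalyticAt ℝ ψ 0) : ∃ C : ℝ, ∀ᶠ z in 𝓝 0,
      ‖distortedNonlinearity ha b c κ φ ψ z‖ ≤ C * ‖z‖ ^ 2 := by
  have hfst : Tendsto (fun z : (ℝ × E) × BddMap => z.1) (𝓝 0) (𝓝 0) :=
    continuous_fst.tendsto _
  have h1 : ∀ᶠ p : ℝ × E in 𝓝 0, ‖κ p‖ < ‖κ 0‖ + 1 :=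
    hκ.continuousAt.norm.eventually_lt continuousAt_const (lt_add_one _)
  have h2 : ∀ᶠ p : ℝ × E in 𝓝 0, ‖φ p‖ < ‖φ 0‖ + 1 :=
    hφ.continuousAt.norm.eventually_lt continuousAt_const (lt_add_one _)
  have h3 : ∀ᶠ p : ℝ × E in 𝓝 0, ‖ψ p‖ < ‖ψ 0‖ + 1 :=
    hψ.continuousAt.norm.eventually_lt continuousAt_const (lt_add_one _)
  set D := ‖duhamelOp ha‖
  have hD : 0 ≤ D := norm_nonneg (duhamelOp ha)
  refine ⟨D * (‖κ 0‖ + 1) * (|b| * (‖φ 0‖ + 1) * ‖devBilin‖ + |c| * (‖ψ 0‖ + 1) * 1), ?_⟩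
  filter_upwards [hfst.eventually h1, hfst.eventually h2, hfst.eventually h3,
    Metric.ball_mem_nhds 0 one_pos] with z hz1 hz2 hz3 hz4
  rw [mem_ball_zero_iff] at hz4
  have h5 : ‖z.2‖ ≤ ‖z‖ := norm_snd_le z
  have h6 : ‖distortedNonlinearity ha b c κ φ ψ z‖ =
      ‖duhamelOp ha (κ z.1) (reaction b c (φ z.1) (ψ z.1) z.2)‖ := by
    rw [distortedNonlinearity, Prod.norm_mk, norm_zero, max_eq_right (norm_nonneg _)]
  have h7 : ‖reaction b c (φ z.1) (ψ z.1) z.2‖ ≤ (|b| * (‖φ 0‖ + 1) * ‖devBilin‖ +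
      |c| * (‖ψ 0‖ + 1) * 1) * ‖z‖ ^ 2 := by
    refine (norm_reaction_le _ _ _ _ _).trans ?_
    have := h5.trans hz4.le
    gcongr
  rw [h6, mul_assoc]
  refine (norm_duhamelOp_le ha _ _).trans ?_
  exact mul_le_mul (mul_le_mul_of_nonneg_left hz1.le hD) h7 (norm_nonneg _) (by positivity)

/-- Small bounded solutions of the integral equation depend analytically on the distortion. -/
lemma exists_analytic_distortion {a : ℝ} (ha : 0 < a) (b c : ℝ) : ∃ ε > 0, ∀ (f : E → Sym0) (M : ℝ)
    (hf : AEStronglyMeasurable f (volume : Measure E)) (hM : ∀ᵐ x, ‖f x‖ ≤ M) (U N : BddMap),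
    (∀ q, N q = rescaledReaction a b c q.2 (U q)) →
    U = freeFlowOp hf hM heatKer + duhamelOp ha heatKer N →
    ‖U‖ < ε → ‖freeFlowOp hf hM heatKer‖ < ε → ∃ W : ℝ × E → BddMap, AnalyticAt ℝ W 0 ∧
      ∀ᶠ p in 𝓝 0, ∃ hp : |p.1| < 1, W p = distortMap U p hp := by
  obtain ⟨κ, hκ, hκ0, hκv⟩ := exists_kernel_family
  obtain ⟨φ, hφ, hφv⟩ := exists_coeff_family a
  obtain ⟨ψ₀, hψ₀, hψ₀v⟩ := exists_coeff_family (2 * a)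
  obtain ⟨ψ, hψ, hψv⟩ : ∃ ψ : ℝ × E → SpaceTime →ᵇ ℝ, AnalyticAt ℝ ψ 0 ∧ ∀ᶠ p in 𝓝 0, ∀ q,
      ψ p q = Real.exp (-a * q.2) *
        ((1 + p.1 * Real.exp (-q.2)) * Real.exp (-(2 * a) * p.1 * timeBump q.2)) := by
    refine ⟨fun p => dampFun ha * ψ₀ p, by fun_prop, ?_⟩
    filter_upwards [hψ₀v] with p hp q
    rw [BoundedContinuousFunction.mul_apply, hp]
    rfl
  obtain ⟨C, hC⟩ := exists_norm_distortedNonlinearity_le ha b c hκ hφ hψ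
  -- The parameter is carried along as the first component, on which the nonlinearity is zero, so
  -- that inversion acts as an implicit function theorem. The left inverse is the useful one: it
  -- recovers the given distorted solution from its free part.
  obtain ⟨Ψ, hΨ, hΨ0, -, hinv⟩ := exists_analytic_inverse
    (analyticAt_distortedNonlinearity ha b c hκ hφ hψ) hC
  obtain ⟨ε₁, hε₁, hinv⟩ := Metric.eventually_nhds_iff.1 hinv
  obtain ⟨ε₂, hε₂, han⟩ := Metric.eventually_nhds_iff.1 hΨ.eventually_analyticAt
  -- The datum enters only through the argument of `Ψ`, so the radius is chosen before the datum.
  refine ⟨min ε₁ ε₂, lt_min hε₁ hε₂, fun f M hf hM U N hN hU hUε hfε => ?_⟩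
  refine ⟨fun p => (Ψ (p, freeFlowOp hf hM (κ p))).2, ?_, ?_⟩
  · have h1 : AnalyticAt ℝ Ψ ((0 : ℝ × E), freeFlowOp hf hM (κ 0)) := by
      refine han ?_
      rw [dist_zero_right, Prod.norm_mk, norm_zero, max_eq_right (norm_nonneg _), hκ0]
      exact hfε.trans_le (min_le_right _ _)
    have h2 : AnalyticAt ℝ (fun p => (p, freeFlowOp hf hM (κ p))) 0 :=
      analyticAt_id.prod (((freeFlowOp hf hM).analyticAt _).comp hκ)
    exact analyticAt_snd.comp (AnalyticAt.comp (g := Ψ) h1 h2)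
  · have h1 : ∀ᶠ p : ℝ × E in 𝓝 0, ‖p‖ < min ε₁ 1 := by
      have := Metric.ball_mem_nhds (0 : ℝ × E) (lt_min hε₁ one_pos)
      filter_upwards [this] with p hp
      rwa [mem_ball_zero_iff] at hp
    filter_upwards [h1, hκv, hφv, hψv] with p hp hpκ hpφ hpψ
    have hp1 : |p.1| < 1 := (norm_fst_le p).trans_lt (hp.trans_le (min_le_right _ _))
    refine ⟨hp1, ?_⟩
    have h2 := distortMap_eq ha hf hM hp1 hpκ hpφ hpψ hN hU
    have h3 : Ψ ((p, distortMap U p hp1) -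
        distortedNonlinearity ha b c κ φ ψ (p, distortMap U p hp1)) = (p, distortMap U p hp1) := by
      refine hinv ?_
      rw [dist_zero_right, Prod.norm_mk]
      exact max_lt (hp.trans_le (min_le_left _ _))
        ((norm_distortMap_le U p hp1).trans_lt (hUε.trans_le (min_le_left _ _)))
    have h4 : (p, distortMap U p hp1) -
        distortedNonlinearity ha b c κ φ ψ (p, distortMap U p hp1) = (p, freeFlowOp hf hM (κ p)) := by
      rw [distortedNonlinearity, Prod.mk_sub_mk, sub_zero]
      dsimp only
      rw [sub_eq_iff_eq_add.2 h2]
    rw [h4] at h3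
    rw [h3]

/-- Since `timeBump t₀ ≠ 0`, the parameters `λ = (t - t₀)/θ(t₀)` and `μ = (x - x₀)/θ(t₀)` carry
`(x₀, t₀)` to any nearby `(x, t)`. Smoothness in the parameters is thus smoothness in space and
time. -/
lemma contDiffAt_of_distortion {U : BddMap} {W : ℝ × E → BddMap} (hW : AnalyticAt ℝ W 0)
    (h : ∀ᶠ p in 𝓝 0, ∃ hp : |p.1| < 1, W p = distortMap U p hp) (x₀ : E) {t₀ : ℝ} (ht₀ : 0 < t₀) :
    ContDiffAt ℝ ∞ (fun q : E × ℝ => extend U q.1 q.2) (x₀, t₀) := by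
  have hθ : timeBump t₀ ≠ 0 := (timeBump_pos ht₀).ne'
  set P : E × ℝ → ℝ × E := fun q =>
    ((timeBump t₀)⁻¹ * (q.2 - t₀), (timeBump t₀)⁻¹ • (q.1 - x₀)) with hP
  have hP0 : P (x₀, t₀) = 0 := by simp [hP]
  have hPc : ContDiff ℝ ∞ P := by fun_prop
  have h1 : ContDiffAt ℝ ∞ (fun q => W (P q) (x₀, ⟨t₀, ht₀⟩)) (x₀, t₀) := by
    have h2 : ContDiffAt ℝ ∞ W (P (x₀, t₀)) := by
      rw [hP0]
      exact hW.contDiffAt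
    exact (BoundedContinuousFunction.evalCLM ℝ ((x₀, ⟨t₀, ht₀⟩) : SpaceTime)).contDiff.contDiffAt.comp
      _ (h2.comp _ hPc.contDiffAt)
  refine h1.congr_of_eventuallyEq ?_
  have h3 := hPc.continuous.tendsto (x₀, t₀)
  rw [hP0] at h3
  filter_upwards [h3.eventually h] with q hq
  obtain ⟨hp, hq⟩ := hq
  have h4 := extend_distortMap U (P q) hp x₀ ht₀
  have e1 : x₀ + timeBump t₀ • (P q).2 = q.1 := by
    simp only [hP]
    rw [smul_inv_smul₀ hθ]
    abel
  have e2 : distort (P q).1 t₀ = q.2 := by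
    simp only [hP, distort]
    field_simp
    ring
  rw [e1, e2, extend_of_pos _ _ ht₀] at h4
  rw [hq, ← h4]

end Smoothness

end QTensor

end

/-! ### The Laplacian as generator of the heat flow. -/

noncomputable section

namespace QTensor

section HeatQuotient

variable {F : Type*} [NormedAddCommGroup F] [NormedSpace ℝ F]

lemma tendsto_second_quotient {g : ℝ → F} (hg : ContDiff ℝ 2 g) :
    Tendsto (fun r => (r ^ 2)⁻¹ • (g r - g 0 - r • deriv g 0)) (𝓝[>] 0)
      (𝓝 ((1 / 2 : ℝ) • deriv (deriv g) 0)) := by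
  have h := taylor_isLittleO (n := 2) convex_univ (mem_univ (0 : ℝ)) (contDiffOn_univ.2 hg)
  rw [nhdsWithin_univ] at h
  have h2 := (h.mono (nhdsWithin_le_nhds (s := Ioi 0))).tendsto_inv_smul_nhds_zero
  have h3 := h2.add_const ((1 / 2 : ℝ) • deriv (deriv g) 0)
  rw [zero_add] at h3
  refine h3.congr' ?_
  filter_upwards [self_mem_nhdsWithin] with r hr
  have hr0 : r ^ 2 ≠ 0 := pow_ne_zero 2 (ne_of_gt hr)
  rw [taylorWithinEval_succ, taylorWithinEval_succ, taylor_within_zero_eval]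
  simp only [iteratedDerivWithin_univ, iteratedDeriv_succ, iteratedDeriv_zero, sub_zero]
  have e : (1 / 2 : ℝ) • deriv (deriv g) 0 = (r ^ 2)⁻¹ • ((1 / 2 * r ^ 2) • deriv (deriv g) 0) := by
    rw [smul_smul]
    rw [mul_comm (1 / 2), inv_mul_cancel_left₀ hr0]
  rw [e, ← smul_add]
  congr 1
  norm_num
  module

lemma tendsto_line_quotient {f : E → F} (hf : ContDiff ℝ 2 f) (x w : E) :
    Tendsto (fun h => h⁻¹ • (f (x + -(Real.sqrt h • w)) - f x -
      fderiv ℝ f x (-(Real.sqrt h • w)))) (𝓝[>] 0)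
      (𝓝 ((1 / 2 : ℝ) • fderiv ℝ (fderiv ℝ f) x w w)) := by
  have hline : ∀ r : ℝ, HasDerivAt (fun r : ℝ => x + -(r • w)) (-w) r := fun r => by
    have := ((hasDerivAt_id r).smul_const w).neg.const_add x
    rw [one_smul] at this
    exact this
  have e1 : x + -((0 : ℝ) • w) = x := by rw [zero_smul, neg_zero, add_zero]
  have hd : ∀ r, HasDerivAt (fun r : ℝ => f (x + -(r • w))) (fderiv ℝ f (x + -(r • w)) (-w)) r :=
    fun r => ((hf.differentiable two_ne_zero) _).hasFDerivAt.comp_hasDerivAt r (hline r)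
  have hd1 : deriv (fun r : ℝ => f (x + -(r • w))) = fun r => fderiv ℝ f (x + -(r • w)) (-w) :=
    funext fun r => (hd r).deriv
  have hd2 : deriv (deriv fun r : ℝ => f (x + -(r • w))) 0 = fderiv ℝ (fderiv ℝ f) x w w := by
    have h1 : HasFDerivAt (fun y => fderiv ℝ f y (-w)) (fderiv ℝ (fun y => fderiv ℝ f y (-w)) x)
        (x + -((0 : ℝ) • w)) := by
      rw [e1]
      exact (((contDiff_fderiv_apply hf (m := 1) le_rfl (-w)).differentiable one_ne_zero)
        x).hasFDerivAt
    have h2 := h1.comp_hasDerivAt (0 : ℝ) (hline 0)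
    have h3 : HasDerivAt (fun r : ℝ => fderiv ℝ f (x + -(r • w)) (-w))
        (fderiv ℝ (fun y => fderiv ℝ f y (-w)) x (-w)) 0 := h2
    rw [hd1, h3.deriv, fderiv_fderiv_apply hf, map_neg, map_neg, _root_.neg_apply,
      neg_neg]
  have hc : ContDiff ℝ 2 fun r : ℝ => f (x + -(r • w)) := hf.comp (by fun_prop)
  have h3 := tendsto_second_quotient hc
  rw [hd2, hd1] at h3
  have h4 : Tendsto Real.sqrt (𝓝[>] 0) (𝓝[>] 0) := by
    refine tendsto_nhdsWithin_of_tendsto_nhds_of_eventually_within _ ?_ ?_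
    · have := Real.continuous_sqrt.tendsto 0
      rw [Real.sqrt_zero] at this
      exact this.mono_left nhdsWithin_le_nhds
    · filter_upwards [self_mem_nhdsWithin] with h hh using Real.sqrt_pos.2 hh
  refine (h3.comp h4).congr' ?_
  filter_upwards [self_mem_nhdsWithin] with h hh
  rw [Function.comp_apply, Real.sq_sqrt (le_of_lt hh), e1, ← map_smul, smul_neg]

/-- The first-order Taylor remainder of a bounded `C²` function is quadratically bounded. -/
lemma exists_taylor_bound {f : E → F} (hf : ContDiff ℝ 2 f) {M : ℝ} (hM : ∀ y, ‖f y‖ ≤ M) (x : E) :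
    ∃ C : ℝ, 0 ≤ C ∧ ∀ v, ‖f (x + v) - f x - fderiv ℝ f x v‖ ≤ C * ‖v‖ ^ 2 := by
  have hM0 : 0 ≤ M := (norm_nonneg _).trans (hM 0)
  have hd : ContDiff ℝ 1 (fderiv ℝ f) := hf.fderiv_right le_rfl
  obtain ⟨K, s, hs, hK⟩ := hd.contDiffAt.exists_lipschitzOnWith (x := x)
  obtain ⟨r, hr, hrs⟩ := Metric.mem_nhds_iff.1 hs
  set L := ‖fderiv ℝ f x‖
  have hL : 0 ≤ L := norm_nonneg _
  refine ⟨max K (2 * M / r ^ 2 + L / r), le_max_of_le_left K.2, fun v => ?_⟩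
  -- Near `x` the derivative is Lipschitz. For `|v| ≥ r` the remainder grows at most linearly, and
  -- each missing power is supplied by `|v|/r ≥ 1`.
  rcases lt_or_ge ‖v‖ r with hv | hv
  · have hsub : Metric.closedBall x ‖v‖ ⊆ s := fun y hy => hrs ((Metric.mem_closedBall.1 hy).trans_lt hv)
    have h1 := (convex_closedBall x ‖v‖).norm_image_sub_le_of_norm_hasFDerivWithin_le' (C := K * ‖v‖)
      (f := f) (f' := fderiv ℝ f) (φ := fderiv ℝ f x) (x := x) (y := x + v)
      (fun y _ => ((hf.differentiable two_ne_zero) y).hasFDerivAt.hasFDerivWithinAt) (fun y hy => by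
        have h2 := hK.dist_le_mul y (hsub hy) x (hsub (Metric.mem_closedBall_self (norm_nonneg v)))
        rw [dist_eq_norm] at h2
        exact h2.trans (mul_le_mul_of_nonneg_left hy K.2))
      (Metric.mem_closedBall_self (norm_nonneg v)) (by simp [dist_eq_norm])
    rw [add_sub_cancel_left, mul_assoc, ← pow_two] at h1
    exact h1.trans (mul_le_mul_of_nonneg_right (le_max_left _ _) (by positivity))
  · have hv0 : 0 < ‖v‖ := hr.trans_le hv
    have h1 : ‖f (x + v) - f x - fderiv ℝ f x v‖ ≤ M + M + L * ‖v‖ :=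
      (norm_sub_le _ _).trans (add_le_add ((norm_sub_le _ _).trans (add_le_add (hM _) (hM _)))
        ((fderiv ℝ f x).le_opNorm v))
    have h2 : 1 ≤ ‖v‖ / r := (one_le_div hr).2 hv
    refine h1.trans (le_trans ?_ (mul_le_mul_of_nonneg_right (le_max_right _ _) (by positivity)))
    have h3 : (2 * M / r ^ 2 + L / r) * ‖v‖ ^ 2 =
        2 * M * (‖v‖ / r) ^ 2 + L * ‖v‖ * (‖v‖ / r) := by
      field_simp
    rw [h3]
    have h4 : 1 ≤ (‖v‖ / r) ^ 2 := one_le_pow₀ h2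
    nlinarith [mul_le_mul_of_nonneg_left h4 (by positivity : 0 ≤ 2 * M),
      mul_le_mul_of_nonneg_left h2 (by positivity : 0 ≤ L * ‖v‖)]

lemma integrable_heatKernel_smul_of_le {g : E → F} (hg : Continuous g) {C : ℝ}
    (hC : ∀ w, ‖g w‖ ≤ C * (1 + ‖w‖) ^ 2) : Integrable fun w => heatKernel 1 w • g w := by
  refine (integrable_heatKernel_mul_sq.const_mul C).mono'
    ((continuous_heatKernel 1).smul hg).aestronglyMeasurable (Eventually.of_forall fun w => ?_)
  rw [norm_smul, Real.norm_of_nonneg (heatKernel_nonneg zero_le_one _), mul_left_comm]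
  exact mul_le_mul_of_nonneg_left (hC w) (heatKernel_nonneg zero_le_one _)

lemma integral_heatKernel_smul_apply (L : E →L[ℝ] F) : ∫ w, heatKernel 1 w • L w = 0 := by
  have h := integral_neg_eq_self (fun w => heatKernel 1 w • L w) volume
  simp only [heatKernel_neg, map_neg, smul_neg, integral_neg] at h
  have h2 : (2 : ℝ) • ∫ w, heatKernel 1 w • L w = 0 := by
    rw [two_smul]
    nth_rewrite 1 [← h]
    exact neg_add_cancel _
  exact (smul_eq_zero.1 h2).resolve_left two_ne_zero

lemma integrable_heatKernel_mul_apply_mul_apply (i j : Fin 3) :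
    Integrable fun w : E => heatKernel 1 w * (w i * w j) := by
  refine integrable_heatKernel_smul_of_le (g := fun w : E => w i * w j) (C := 1) (by fun_prop)
    fun w => ?_
  rw [norm_mul, one_mul, pow_two]
  have hi : ‖w i‖ ≤ 1 + ‖w‖ := (abs_apply_le_norm w i).trans (by linarith)
  have hj : ‖w j‖ ≤ 1 + ‖w‖ := (abs_apply_le_norm w j).trans (by linarith)
  exact mul_le_mul hi hj (norm_nonneg _) (by positivity)

/-- Second moments of the heat kernel against a bilinear map. -/
lemma integral_heatKernel_smul_bilinear [CompleteSpace F] (B : E →L[ℝ] E →L[ℝ] F) :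
    ∫ w, heatKernel 1 w • ((1 / 2 : ℝ) • B w w) = ∑ i, B (stdE i) (stdE i) := by
  have h0 : ∀ (L : E →L[ℝ] F) (w : E), L w = ∑ i, w i • L (stdE i) := fun L w => by
    conv_lhs => rw [← stdE.sum_repr w]
    simp
  have h1 : ∀ w, heatKernel 1 w • ((1 / 2 : ℝ) • B w w) =
      ∑ i, ∑ j, (heatKernel 1 w * (w i * w j)) • ((1 / 2 : ℝ) • B (stdE i) (stdE j)) := fun w => by
    have h2 : B w w = ∑ i, w i • ∑ j, w j • B (stdE i) (stdE j) := by
      change B.flip w w = _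
      rw [h0 (B.flip w) w]
      exact Finset.sum_congr rfl fun i _ => congrArg (w i • ·) (h0 (B (stdE i)) w)
    rw [h2]
    simp only [Finset.smul_sum, smul_smul]
    refine Finset.sum_congr rfl fun i _ => Finset.sum_congr rfl fun j _ => ?_
    congr 1
    ring
  have hint : ∀ i j, Integrable fun w : E =>
      (heatKernel 1 w * (w i * w j)) • ((1 / 2 : ℝ) • B (stdE i) (stdE j)) := fun i j =>
    (integrable_heatKernel_mul_apply_mul_apply i j).smul_const _
  simp_rw [h1]
  rw [integral_finsetSum _ fun i _ => integrable_finsetSum _ fun j _ => hint i j]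
  refine Finset.sum_congr rfl fun i _ => ?_
  rw [integral_finsetSum _ fun j _ => hint i j]
  simp only [integral_smul_const, integral_heatKernel_mul_apply_mul_apply]
  simp only [smul_smul]
  norm_num

/-- The heat flow of a bounded `C²` function has the Laplacian as its derivative at time zero. -/
lemma tendsto_heatFlow_quotient [CompleteSpace F] {f : E → F} (hf : ContDiff ℝ 2 f) {M : ℝ}
    (hM : ∀ y, ‖f y‖ ≤ M) (x : E) :
    Tendsto (fun h => h⁻¹ • (heatFlow h f x - f x)) (𝓝[>] 0) (𝓝 (Laplacian.laplacian f x)) := by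
  obtain ⟨C, hC, hCb⟩ := exists_taylor_bound hf hM x
  have hM0 : 0 ≤ M := (norm_nonneg _).trans (hM 0)
  set B := fderiv ℝ (fderiv ℝ f) x
  set e : E → F := fun v => f (x + v) - f x - fderiv ℝ f x v with he
  have hec : Continuous e := by
    have := hf.continuous
    fun_prop
  have hlap : Laplacian.laplacian f x = ∫ w, heatKernel 1 w • ((1 / 2 : ℝ) • B w w) := by
    rw [integral_heatKernel_smul_bilinear, laplacian_eq_sum hf]
    exact Finset.sum_congr rfl fun i _ => fderiv_fderiv_apply hf x _ _
  have hone : ∀ w : E, 1 ≤ (1 + ‖w‖) ^ 2 := fun w => one_le_pow₀ (by linarith [norm_nonneg w])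
  -- The first-order Taylor term may be subtracted freely because the kernel is even. What remains
  -- is bounded by `C |w|²` uniformly in `h`, so dominated convergence leaves the second moments.
  have hquot : ∀ h : ℝ, 0 < h → h⁻¹ • (heatFlow h f x - f x) =
      ∫ w, heatKernel 1 w • (h⁻¹ • e (-(Real.sqrt h • w))) := fun h hh => by
    have i1 : Integrable fun w => heatKernel 1 w • f (x - Real.sqrt h • w) :=
      integrable_heatKernel_smul_of_le (hf.continuous.comp (by fun_prop)) (C := M) fun w =>
        (hM _).trans (le_mul_of_one_le_right hM0 (hone w))
    have i2 : Integrable fun w : E => heatKernel 1 w • f x :=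
      (integrable_heatKernel one_pos).smul_const _
    have i3 : Integrable fun w => heatKernel 1 w • fderiv ℝ f x w :=
      integrable_heatKernel_smul_of_le (fderiv ℝ f x).continuous (C := ‖fderiv ℝ f x‖) fun w =>
        ((fderiv ℝ f x).le_opNorm w).trans (mul_le_mul_of_nonneg_left
          (by nlinarith [norm_nonneg w]) (norm_nonneg _))
    have e1 : ∀ w, heatKernel 1 w • (h⁻¹ • e (-(Real.sqrt h • w))) =
        h⁻¹ • (heatKernel 1 w • f (x - Real.sqrt h • w) - heatKernel 1 w • f x +
          Real.sqrt h • (heatKernel 1 w • fderiv ℝ f x w)) := fun w => by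
      simp only [he, map_neg, map_smul, ← sub_eq_add_neg]
      module
    have i4 : Integrable fun w => heatKernel 1 w • f (x - Real.sqrt h • w) - heatKernel 1 w • f x :=
      i1.sub i2
    have i5 : Integrable fun w => Real.sqrt h • (heatKernel 1 w • fderiv ℝ f x w) := i3.smul _
    simp_rw [e1]
    rw [integral_smul, integral_add i4 i5, integral_sub i1 i2, integral_smul,
      integral_heatKernel_smul_apply, integral_smul_const, integral_heatKernel one_pos, smul_zero,
      add_zero, one_smul, heatFlow]
  rw [hlap]
  refine Tendsto.congr' (f₁ := fun h => ∫ w, heatKernel 1 w • (h⁻¹ • e (-(Real.sqrt h • w)))) ?_ ?_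
  · filter_upwards [self_mem_nhdsWithin] with h hh
    exact (hquot h hh).symm
  refine tendsto_integral_filter_of_dominated_convergence
    (fun w => C * (heatKernel 1 w * (1 + ‖w‖) ^ 2)) ?_ ?_
    (integrable_heatKernel_mul_sq.const_mul C) ?_
  · exact Eventually.of_forall fun h => ((continuous_heatKernel 1).smul
      (continuous_const.smul (hec.comp (by fun_prop)))).aestronglyMeasurable
  · filter_upwards [self_mem_nhdsWithin] with h hh
    rw [mem_Ioi] at hh
    refine Eventually.of_forall fun w => ?_
    rw [norm_smul, Real.norm_of_nonneg (heatKernel_nonneg zero_le_one _), mul_left_comm]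
    refine mul_le_mul_of_nonneg_left ?_ (heatKernel_nonneg zero_le_one _)
    have h1 := hCb (-(Real.sqrt h • w))
    rw [norm_neg, norm_smul, mul_pow, Real.norm_of_nonneg (Real.sqrt_nonneg h),
      Real.sq_sqrt hh.le] at h1
    rw [norm_smul, norm_inv, Real.norm_of_nonneg hh.le, inv_mul_le_iff₀ hh]
    refine h1.trans ?_
    have h2 : ‖w‖ ^ 2 ≤ (1 + ‖w‖) ^ 2 := by
      have := norm_nonneg w
      gcongr
      linarith
    calc C * (h * ‖w‖ ^ 2) = h * (C * ‖w‖ ^ 2) := by ring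
      _ ≤ h * (C * (1 + ‖w‖) ^ 2) := by gcongr
  · refine Eventually.of_forall fun w => Tendsto.const_smul ?_ _
    exact tendsto_line_quotient hf x w

end HeatQuotient

end QTensor

end

/-! ### Restarting the integral equation, and the right time derivative. -/

noncomputable section

namespace QTensor

section Restart

variable {F : Type*} [NormedAddCommGroup F] [NormedSpace ℝ F]

lemma heatFlow_zero [CompleteSpace F] (f : E → F) (x : E) : heatFlow 0 f x = f x := by
  simp only [heatFlow, Real.sqrt_zero, zero_smul, sub_zero]
  rw [integral_smul_const, integral_heatKernel one_pos, one_smul]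

/-- The time `r = 0` is included because the kernel in `heatFlow` does not depend on `r`. Negative
`r` also does no harm: `Real.sqrt` vanishes there and the flow is the identity, so a two-sided
neighbourhood makes sense. -/
lemma continuousAt_heatFlow {g : E → ℝ → F}
    (hg : ContinuousOn (fun p : E × ℝ => g p.1 p.2) (univ ×ˢ Ioi 0)) {M : ℝ}
    (hM : ∀ x t, 0 < t → ‖g x t‖ ≤ M) {z : ℝ × E × ℝ} (hz : 0 < z.2.2) :
    ContinuousAt (fun z : ℝ × E × ℝ => heatFlow z.1 (fun y => g y z.2.2) z.2.1) z := by
  have hpos : ∀ᶠ z' : ℝ × E × ℝ in 𝓝 z, 0 < z'.2.2 :=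
    (continuous_snd.comp continuous_snd).continuousAt.eventually (lt_mem_nhds hz)
  have hgc : ∀ z' : ℝ × E × ℝ, 0 < z'.2.2 → ∀ w : E,
      ContinuousAt (fun p : E × ℝ => g p.1 p.2) (z'.2.1 - Real.sqrt z'.1 • w, z'.2.2) :=
    fun z' hz' w => hg.continuousAt ((isOpen_univ.prod isOpen_Ioi).mem_nhds
      (mk_mem_prod (mem_univ _) (mem_Ioi.2 hz')))
  refine continuousAt_of_dominated (bound := fun w => heatKernel 1 w * M) ?_ ?_
    ((integrable_heatKernel one_pos).mul_const M) ?_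
  · filter_upwards [hpos] with z' hz'
    refine ((continuous_heatKernel 1).smul ?_).aestronglyMeasurable
    exact continuous_iff_continuousAt.2 fun w => ContinuousAt.comp
      (g := fun p : E × ℝ => g p.1 p.2) (f := fun w : E => (z'.2.1 - Real.sqrt z'.1 • w, z'.2.2))
      (hgc z' hz' w) (by fun_prop)
  · filter_upwards [hpos] with z' hz'
    refine Eventually.of_forall fun w => ?_
    rw [norm_smul, Real.norm_of_nonneg (heatKernel_nonneg zero_le_one _)]
    exact mul_le_mul_of_nonneg_left (hM _ _ hz') (heatKernel_nonneg zero_le_one _)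
  · refine Eventually.of_forall fun w => continuousAt_const.smul ?_
    exact ContinuousAt.comp (g := fun p : E × ℝ => g p.1 p.2)
      (f := fun z : ℝ × E × ℝ => (z.2.1 - Real.sqrt z.1 • w, z.2.2)) (hgc z hz w) (by fun_prop)

lemma heatFlow_add_of_bounded {f g : E → F} (hf : Continuous f) (hg : Continuous g) {L M : ℝ}
    (hL : ∀ y, ‖f y‖ ≤ L) (hM : ∀ y, ‖g y‖ ≤ M) (r : ℝ) (x : E) :
    heatFlow r (fun y => f y + g y) x = heatFlow r f x + heatFlow r g x := by
  have hi : ∀ {f : E → F} {L : ℝ}, Continuous f → (∀ y, ‖f y‖ ≤ L) →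
      Integrable fun w => heatKernel 1 w • f (x - Real.sqrt r • w) := fun {f L} hf hL =>
    integrable_heatKernel_smul_of_le (hf.comp (by fun_prop)) (C := L) fun w =>
      (hL _).trans (le_mul_of_one_le_right ((norm_nonneg _).trans (hL 0))
        (one_le_pow₀ (by linarith [norm_nonneg w])))
  simp only [heatFlow, smul_add]
  exact integral_add (hi hf hL) (hi hg hM)

variable {a : ℝ} {f : E → Sym0} {g : E → ℝ → Sym0} {L M : ℝ}

/-- The heat flow of a Duhamel integral. -/
lemma heatFlow_duhamel (ha : 0 < a)
    (hg : ContinuousOn (fun p : E × ℝ => g p.1 p.2) (univ ×ˢ Ioi 0))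
    (hM : ∀ x t, 0 < t → ‖g x t‖ ≤ M) {h t : ℝ} (hh : 0 < h) (x : E) :
    heatFlow h (fun y => duhamel a heatKer g y t) x =
      ∫ s in Ioo 0 t, Real.exp (-a * s) • heatFlow (h + t - s) (fun y => g y s) x := by
  have hM0 : 0 ≤ M := (norm_nonneg _).trans (hM 0 1 one_pos)
  set ψ : E → ℝ → Sym0 := fun w s => heatKernel 1 w • Real.exp (-a * s) •
    heatFlow (t - s) (fun y => g y s) (x - Real.sqrt h • w) with hψ
  have hms : MeasurableSet ((univ : Set E) ×ˢ Ioo 0 t) := MeasurableSet.univ.prod measurableSet_Ioo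
  have hint : Integrable (Function.uncurry ψ)
      ((volume : Measure E).prod (volume.restrict (Ioo 0 t))) := by
    have hb : Integrable (fun z : E × ℝ => heatKernel 1 z.1 * M)
        ((volume : Measure E).prod (volume.restrict (Ioo 0 t))) :=
      (integrable_heatKernel one_pos).mul_prod (integrable_const M)
    have hrestr : (volume : Measure E).prod (volume.restrict (Ioo 0 t)) =
        (volume : Measure (E × ℝ)).restrict (univ ×ˢ Ioo 0 t) := by
      rw [Measure.volume_eq_prod, ← Measure.prod_restrict, Measure.restrict_univ]
    rw [hrestr] at hb ⊢
    refine hb.mono' (ContinuousOn.aestronglyMeasurable ?_ hms) ?_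
    · intro z hz
      refine ContinuousAt.continuousWithinAt ?_
      have h1 := ContinuousAt.comp (f := fun z : E × ℝ => (t - z.2, x - Real.sqrt h • z.1, z.2))
        (x := z) (continuousAt_heatFlow hg hM hz.2.1) (by fun_prop)
      exact ((continuous_heatKernel 1).comp continuous_fst).continuousAt.smul
        (ContinuousAt.smul (f := fun z : E × ℝ => Real.exp (-a * z.2)) (by fun_prop) h1)
    · refine (ae_restrict_mem hms).mono fun z hz => ?_
      simp only [Function.uncurry, hψ]
      rw [norm_smul, norm_smul, Real.norm_of_nonneg (heatKernel_nonneg zero_le_one _),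
        Real.norm_of_nonneg (Real.exp_pos _).le]
      refine mul_le_mul_of_nonneg_left ?_ (heatKernel_nonneg zero_le_one _)
      refine (mul_le_of_le_one_left (norm_nonneg _) ?_).trans
        (norm_heatFlow_le (fun y => hM y z.2 hz.2.1) _ _)
      rw [Real.exp_le_one_iff]
      nlinarith [hz.2.1]
  have h1 : heatFlow h (fun y => duhamel a heatKer g y t) x =
      ∫ w, ∫ s in Ioo 0 t, ψ w s := by
    rw [heatFlow]
    refine integral_congr_ae (Eventually.of_forall fun w => ?_)
    simp only [hψ]
    rw [integral_smul, duhamel_heatKer ha hg hM]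
  rw [h1, integral_integral_swap hint]
  refine setIntegral_congr_fun measurableSet_Ioo fun s hs => ?_
  have h2 : ∀ w, ψ w s = Real.exp (-a * s) • (heatKernel 1 w •
      heatFlow (t - s) (fun y => g y s) (x - Real.sqrt h • w)) := fun w => smul_comm _ _ _
  simp only [h2]
  have hslice : Continuous fun y => g y s := continuous_iff_continuousAt.2 fun y =>
    ContinuousAt.comp (g := fun p : E × ℝ => g p.1 p.2) (f := fun y : E => (y, s))
      (hg.continuousAt ((isOpen_univ.prod isOpen_Ioi).mem_nhds
        (mk_mem_prod (mem_univ _) (mem_Ioi.2 hs.1)))) (by fun_prop)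
  rw [integral_smul, ← heatFlow.eq_def, heatFlow_heatFlow hh (sub_pos.2 hs.2)
    hslice.aestronglyMeasurable (Eventually.of_forall fun y => hM y s hs.1), add_sub_assoc]

/-- Solutions of the integral equation can be restarted at any positive time. -/
lemma heatFlow_restart (ha : 0 < a) (hf : AEStronglyMeasurable f (volume : Measure E))
    (hL : ∀ᵐ x, ‖f x‖ ≤ L)
    (hg : ContinuousOn (fun p : E × ℝ => g p.1 p.2) (univ ×ˢ Ioi 0))
    (hM : ∀ x t, 0 < t → ‖g x t‖ ≤ M) {R : E → ℝ → Sym0}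
    (hR : ∀ x t, 0 < t → R x t = heatFlow t f x + duhamel a heatKer g x t) {h t : ℝ} (hh : 0 < h)
    (ht : 0 < t) (x : E) :
    R x (t + h) = heatFlow h (fun y => R y t) x +
      ∫ s in t..(t + h), Real.exp (-a * s) • heatFlow (t + h - s) (fun y => g y s) x := by
  have hc1 : Continuous fun y => heatFlow t f y := by
    have := (continuous_freeFlow heatKer hf hL).comp
      (by fun_prop : Continuous fun y : E => ((y, ⟨t, ht⟩) : SpaceTime))
    simpa only [freeFlow_heatKer, Function.comp_def] using this
  have hc2 : Continuous fun y => duhamel a heatKer g y t :=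
    (continuous_duhamel ha heatKer hg hM).comp
      (by fun_prop : Continuous fun y : E => ((y, ⟨t, ht⟩) : SpaceTime))
  have hb1 : ∀ y, ‖heatFlow t f y‖ ≤ (∫ w, gauss w) * L * ‖heatKer‖ := fun y => by
    rw [← freeFlow_heatKer]
    exact norm_freeFlow_le heatKer hL y ht
  have hfl : heatFlow h (fun y => R y t) x = heatFlow (t + h) f x +
      ∫ s in Ioo 0 t, Real.exp (-a * s) • heatFlow (t + h - s) (fun y => g y s) x := by
    simp only [hR _ t ht]
    rw [heatFlow_add_of_bounded hc1 hc2 hb1 fun y => norm_duhamel_le ha heatKer hM y t,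
      heatFlow_duhamel ha hg hM hh]
    rw [show heatFlow h (fun y => heatFlow t f y) x = heatFlow (h + t) f x from
      heatFlow_heatFlow hh ht hf hL x, add_comm h t]
  have hint := integrableOn_heatFlow ha hg hM x (t + h)
  rw [← integrableOn_Ioc_iff_integrableOn_Ioo,
    ← intervalIntegrable_iff_integrableOn_Ioc_of_le (by linarith)] at hint
  rw [hfl, hR x (t + h) (by linarith), duhamel_heatKer ha hg hM, add_assoc]
  congr 1
  rw [← integral_Ioc_eq_integral_Ioo, ← integral_Ioc_eq_integral_Ioo,
    ← intervalIntegral.integral_of_le (by linarith), ← intervalIntegral.integral_of_le ht.le,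
    intervalIntegral.integral_add_adjacent_intervals]
  · exact hint.mono_set (by
      rw [uIcc_of_le ht.le, uIcc_of_le (by linarith)]
      exact Icc_subset_Icc_right (by linarith))
  · exact hint.mono_set (by
      rw [uIcc_of_le (by linarith), uIcc_of_le (by linarith)]
      exact Icc_subset_Icc_left (by linarith))

/-- The integrand depends on `h` as well as `s`; joint continuity at the corner `(0, t)` keeps it
uniformly close to its value there on the shrinking interval. -/
lemma tendsto_average {F : Type*} [NormedAddCommGroup F] [NormedSpace ℝ F] [CompleteSpace F]
    {ψ : ℝ → ℝ → F} {t : ℝ}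
    (hψ : ContinuousAt (fun z : ℝ × ℝ => ψ z.1 z.2) (0, t))
    (hint : ∀ h, 0 < h → IntervalIntegrable (ψ h) volume t (t + h)) :
    Tendsto (fun h => h⁻¹ • ∫ s in t..(t + h), ψ h s) (𝓝[>] 0) (𝓝 (ψ 0 t)) := by
  rw [Metric.tendsto_nhds]
  intro ε hε
  obtain ⟨r, hr, hψr⟩ := Metric.continuousAt_iff.1 hψ (ε / 2) (by positivity)
  filter_upwards [self_mem_nhdsWithin, nhdsWithin_le_nhds (Metric.ball_mem_nhds (0 : ℝ) hr)]
    with h hh hhr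
  rw [mem_Ioi] at hh
  rw [Metric.mem_ball, dist_zero_right, Real.norm_of_nonneg hh.le] at hhr
  have h1 : h⁻¹ • (∫ s in t..(t + h), ψ h s) - ψ 0 t = h⁻¹ • ∫ s in t..(t + h), (ψ h s - ψ 0 t) := by
    rw [intervalIntegral.integral_sub (hint h hh) intervalIntegrable_const,
      intervalIntegral.integral_const, add_sub_cancel_left, smul_sub, inv_smul_smul₀ hh.ne']
  have h2 : ‖∫ s in t..(t + h), (ψ h s - ψ 0 t)‖ ≤ ε / 2 * |t + h - t| := by
    refine intervalIntegral.norm_integral_le_of_norm_le_const fun s hs => ?_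
    rw [uIoc_of_le (by linarith)] at hs
    rw [← dist_eq_norm]
    refine (hψr (x := (h, s)) ?_).le
    rw [Prod.dist_eq, max_lt_iff, dist_zero_right, Real.norm_of_nonneg hh.le, Real.dist_eq,
      abs_of_nonneg (by linarith [hs.1])]
    exact ⟨hhr, by linarith [hs.2]⟩
  rw [add_sub_cancel_left, abs_of_pos hh] at h2
  rw [dist_eq_norm, h1, norm_smul, norm_inv, Real.norm_of_nonneg hh.le, inv_mul_lt_iff₀ hh]
  nlinarith

/-- The right time derivative of a solution of the integral equation. -/
lemma tendsto_mild_quotient (ha : 0 < a) (hf : AEStronglyMeasurable f (volume : Measure E))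
    (hL : ∀ᵐ x, ‖f x‖ ≤ L)
    (hg : ContinuousOn (fun p : E × ℝ => g p.1 p.2) (univ ×ˢ Ioi 0))
    (hM : ∀ x t, 0 < t → ‖g x t‖ ≤ M) {R : E → ℝ → Sym0}
    (hR : ∀ x t, 0 < t → R x t = heatFlow t f x + duhamel a heatKer g x t) {K : ℝ}
    (hK : ∀ x t, 0 < t → ‖R x t‖ ≤ K) {t : ℝ} (ht : 0 < t) (hR2 : ContDiff ℝ 2 fun y => R y t)
    (x : E) :
    Tendsto (fun h => h⁻¹ • (R x (t + h) - R x t)) (𝓝[>] 0)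
      (𝓝 (Laplacian.laplacian (fun y => R y t) x + Real.exp (-a * t) • g x t)) := by
  have h1 := tendsto_heatFlow_quotient hR2 (fun y => hK y t ht) x
  have h2 : Tendsto (fun h => h⁻¹ • ∫ s in t..(t + h), Real.exp (-a * s) •
      heatFlow (t + h - s) (fun y => g y s) x) (𝓝[>] 0) (𝓝 (Real.exp (-a * t) • g x t)) := by
    have h3 := tendsto_average (t := t)
      (ψ := fun h s => Real.exp (-a * s) • heatFlow (t + h - s) (fun y => g y s) x) ?_ ?_
    · simpa only [add_zero, sub_self, heatFlow_zero] using h3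
    · refine ContinuousAt.smul (f := fun z : ℝ × ℝ => Real.exp (-a * z.2)) (by fun_prop) ?_
      exact ContinuousAt.comp
        (g := fun z : ℝ × E × ℝ => heatFlow z.1 (fun y => g y z.2.2) z.2.1)
        (f := fun z : ℝ × ℝ => (t + z.1 - z.2, x, z.2)) (x := (0, t))
        (continuousAt_heatFlow hg hM ht) (by fun_prop)
    · intro h hh
      have hint := integrableOn_heatFlow ha hg hM x (t + h)
      rw [← integrableOn_Ioc_iff_integrableOn_Ioo,
        ← intervalIntegrable_iff_integrableOn_Ioc_of_le (by linarith)] at hint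
      exact hint.mono_set (by
        rw [uIcc_of_le (by linarith), uIcc_of_le (by linarith)]
        exact Icc_subset_Icc_left (by linarith))
  refine (h1.add h2).congr' ?_
  filter_upwards [self_mem_nhdsWithin] with h hh
  rw [heatFlow_restart ha hf hL hg hM hR hh ht x, ← smul_add]
  congr 1
  abel

end Restart

end QTensor

end

/-! ### Convergence of the heat flow to its datum in `L¹`, and interpolation to `Lᵖ`. -/

noncomputable section

namespace QTensor

section Interpolation

variable {α F : Type*} [MeasurableSpace α] {μ : Measure α} [NormedAddCommGroup F]

/-- Interpolation between `L¹` and `L^∞` through `|f|^p ≤ M^{p-1} |f|`. -/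
lemma eLpNorm_le_of_norm_le {f : α → F} {M : ℝ} (hM : ∀ᵐ x ∂μ, ‖f x‖ ≤ M) {p : ℝ} (hp : 1 ≤ p) :
    eLpNorm f (ENNReal.ofReal p) μ ≤
      (ENNReal.ofReal M ^ (p - 1) * ∫⁻ x, ‖f x‖ₑ ∂μ) ^ (1 / p) := by
  have hp0 : 0 < p := by linarith
  rw [eLpNorm_eq_lintegral_rpow_enorm_toReal (by simpa using hp0) ENNReal.ofReal_ne_top,
    ENNReal.toReal_ofReal hp0.le]
  refine ENNReal.rpow_le_rpow ?_ (by positivity)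
  rw [← lintegral_const_mul' _ _ (ENNReal.rpow_ne_top_of_nonneg (by linarith) ENNReal.ofReal_ne_top)]
  refine lintegral_mono_ae (hM.mono fun x hx => ?_)
  have h1 : ‖f x‖ₑ ≤ ENNReal.ofReal M := by
    rw [← ofReal_norm]
    exact ENNReal.ofReal_le_ofReal hx
  calc ‖f x‖ₑ ^ p = ‖f x‖ₑ ^ (p - 1) * ‖f x‖ₑ ^ (1 : ℝ) := by
        rw [← ENNReal.rpow_add_of_nonneg _ _ (by linarith) zero_le_one, sub_add_cancel]
    _ ≤ ENNReal.ofReal M ^ (p - 1) * ‖f x‖ₑ := by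
        rw [ENNReal.rpow_one]
        gcongr

lemma memLp_of_integrable_of_norm_le {f : α → F} (hf : Integrable f μ) {M : ℝ}
    (hM : ∀ᵐ x ∂μ, ‖f x‖ ≤ M) {p : ℝ} (hp : 1 ≤ p) : MemLp f (ENNReal.ofReal p) μ := by
  refine ⟨hf.1, (eLpNorm_le_of_norm_le hM hp).trans_lt ?_⟩
  refine ENNReal.rpow_lt_top_of_nonneg (by positivity) (ENNReal.mul_ne_top
    (ENNReal.rpow_ne_top_of_nonneg (by linarith) ENNReal.ofReal_ne_top) hf.2.ne)

lemma tendsto_eLpNorm_of_lintegral {ι : Type*} {l : Filter ι} {f : ι → α → F} {M : ℝ}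
    (hM : ∀ᶠ i in l, ∀ᵐ x ∂μ, ‖f i x‖ ≤ M)
    (h : Tendsto (fun i => ∫⁻ x, ‖f i x‖ₑ ∂μ) l (𝓝 0)) {p : ℝ} (hp : 1 ≤ p) :
    Tendsto (fun i => eLpNorm (f i) (ENNReal.ofReal p) μ) l (𝓝 0) := by
  have hp0 : 0 < p := by linarith
  have h1 : Tendsto (fun i => (ENNReal.ofReal M ^ (p - 1) * ∫⁻ x, ‖f i x‖ₑ ∂μ) ^ (1 / p)) l
      (𝓝 0) := by
    have h2 := ENNReal.Tendsto.const_mul (a := ENNReal.ofReal M ^ (p - 1)) h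
      (Or.inr (ENNReal.rpow_ne_top_of_nonneg (by linarith) ENNReal.ofReal_ne_top))
    rw [mul_zero] at h2
    have h3 := h2.ennrpow_const (1 / p)
    rwa [ENNReal.zero_rpow_of_pos (by positivity)] at h3
  exact tendsto_of_tendsto_of_tendsto_of_le_of_le' tendsto_const_nhds h1
    (Eventually.of_forall fun i => zero_le) (hM.mono fun i hi => eLpNorm_le_of_norm_le hi hp)

end Interpolation

/-! ### Attainment of the datum by the heat flow. -/

section InitialData

variable {F : Type*} [NormedAddCommGroup F] [NormedSpace ℝ F]

/-- The heat flow is a contraction of `L¹`. -/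
lemma lintegral_heatFlow_le {r : ℝ} (hr : 0 < r) {f : E → F}
    (hf : AEStronglyMeasurable f (volume : Measure E)) :
    ∫⁻ x, ‖heatFlow r f x‖ₑ ≤ ∫⁻ y, ‖f y‖ₑ := by
  have hk : ∀ y, ∫⁻ x, ‖heatKernel r (x - y)‖ₑ = 1 := fun y => by
    rw [lintegral_sub_right_eq_self (fun x => ‖heatKernel r x‖ₑ),
      ← ofReal_integral_norm_eq_lintegral_enorm (integrable_heatKernel hr)]
    simp only [Real.norm_of_nonneg (heatKernel_nonneg hr.le _)]
    rw [integral_heatKernel hr, ENNReal.ofReal_one]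
  have hm : Measurable fun z : E × E => ‖heatKernel r (z.1 - z.2)‖ₑ :=
    ((continuous_heatKernel r).comp (by fun_prop)).measurable.enorm
  calc ∫⁻ x, ‖heatFlow r f x‖ₑ
      ≤ ∫⁻ x, ∫⁻ y, ‖heatKernel r (x - y)‖ₑ * ‖f y‖ₑ := by
        refine lintegral_mono fun x => ?_
        rw [heatFlow_eq hr]
        refine (enorm_integral_le_lintegral_enorm _).trans (le_of_eq ?_)
        simp only [enorm_smul]
    _ = ∫⁻ y, ∫⁻ x, ‖heatKernel r (x - y)‖ₑ * ‖f y‖ₑ :=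
        lintegral_lintegral_swap (hm.aemeasurable.mul hf.enorm.comp_snd)
    _ = ∫⁻ y, ‖f y‖ₑ := by
        refine lintegral_congr fun y => ?_
        rw [lintegral_mul_const' _ _ enorm_ne_top, hk, one_mul]

/-- From `(1 + |x|)/√(t + 1) ≤ 1 + |x|/√(t + 1)`: replaces the parabolic weight by one independent
of `t`, so that for `t ≤ 1` there is a common integrable majorant. -/
lemma le_of_weight_mul_le {m A B t : ℝ} (hm : 0 ≤ m) (ht : 0 < t) {x : E} (hB : 0 ≤ B)
    (h : (1 + ‖x‖ / Real.sqrt (t + 1)) ^ m * A ≤ B) :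
    A ≤ B * Real.sqrt (t + 1) ^ m * (1 + ‖x‖) ^ (-m) := by
  have hs : 1 ≤ Real.sqrt (t + 1) := Real.one_le_sqrt.2 (by linarith)
  have hs0 : 0 < Real.sqrt (t + 1) := by linarith
  have hx := norm_nonneg x
  have h1 : (1 + ‖x‖) / Real.sqrt (t + 1) ≤ 1 + ‖x‖ / Real.sqrt (t + 1) := by
    rw [add_div]
    exact add_le_add_left ((div_le_one hs0).2 hs) _
  have h2 : ((1 + ‖x‖) / Real.sqrt (t + 1)) ^ m ≤ (1 + ‖x‖ / Real.sqrt (t + 1)) ^ m :=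
    Real.rpow_le_rpow (by positivity) h1 hm
  have h3 : 0 < ((1 + ‖x‖) / Real.sqrt (t + 1)) ^ m := by positivity
  have h4 : A ≤ B / ((1 + ‖x‖) / Real.sqrt (t + 1)) ^ m := by
    rcases le_total A 0 with hA | hA
    · exact hA.trans (by positivity)
    · rw [le_div_iff₀ h3, mul_comm]
      exact (mul_le_mul_of_nonneg_right h2 hA).trans h
  refine h4.trans (le_of_eq ?_)
  rw [Real.div_rpow (by positivity) hs0.le, Real.rpow_neg (by positivity)]
  field_simp

lemma sqrt_rpow_le_two_rpow {m t : ℝ} (hm : 0 ≤ m) (ht : t ≤ 1) :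
    Real.sqrt (t + 1) ^ m ≤ 2 ^ m := by
  refine Real.rpow_le_rpow (Real.sqrt_nonneg _) ?_ hm
  rw [Real.sqrt_le_left (by norm_num)]
  linarith

lemma eventually_small : ∀ᶠ t : ℝ in 𝓝[>] 0, 0 < t ∧ t ≤ 1 := by
  filter_upwards [self_mem_nhdsWithin, nhdsWithin_le_nhds (Iic_mem_nhds (zero_lt_one' ℝ))]
    with t h1 h2 using ⟨h1, h2⟩

lemma continuous_heatFlow_of_bounded {g : E → F} (hg : Continuous g) {M : ℝ}
    (hM : ∀ y, ‖g y‖ ≤ M) (t : ℝ) : Continuous fun x => heatFlow t g x := by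
  refine continuous_iff_continuousAt.2 fun x => ?_
  have h1 := continuousAt_heatFlow (g := fun y _ => g y) (M := M)
    ((hg.comp continuous_fst).continuousOn) (fun y _ _ => hM y) (z := (t, x, (1 : ℝ))) one_pos
  exact ContinuousAt.comp (f := fun x : E => (t, x, (1 : ℝ))) (x := x) h1 (by fun_prop)

/-- The heat flow of a continuous function with compact support converges in `L¹`. -/
lemma tendsto_heatFlow_of_hasCompactSupport [CompleteSpace F] {g : E → F} (hg : Continuous g)
    (hgc : HasCompactSupport g) :
    Tendsto (fun t => ∫⁻ x, ‖heatFlow t g x - g x‖ₑ) (𝓝[>] 0) (𝓝 0) := by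
  obtain ⟨C, hC, hdec⟩ := exists_heatFlow_decay (F := F) (m := 4) (by norm_num)
  obtain ⟨M, hM⟩ := hg.bounded_above_of_compact_support hgc
  obtain ⟨K, hK⟩ := Continuous.bounded_above_of_compact_support
    (f := fun y => (1 + ‖y‖) ^ (2 * 4 : ℝ) • g y)
    (((continuous_const.add continuous_norm).rpow_const fun y => Or.inr (by norm_num)).smul hg)
    hgc.smul_left
  have hK0 : 0 ≤ K := (norm_nonneg _).trans (hK 0)
  -- Compact support gives any power decay. Exponent `8 = 2 · 4` lets the decay estimate dominate
  -- the flows for `t ≤ 1` by a multiple of `(1 + |x|)^{-4}`, which is integrable.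
  have hgd : ∀ y, ‖g y‖ ≤ K * (1 + ‖y‖) ^ (-(2 * 4) : ℝ) := fun y => by
    have h1 := hK y
    rw [norm_smul, Real.norm_of_nonneg (by positivity)] at h1
    rw [Real.rpow_neg (by positivity), ← div_eq_mul_inv, le_div_iff₀ (by positivity), mul_comm]
    exact h1
  set b : E → ℝ := fun x => C * K * 2 ^ (4 : ℝ) * (1 + ‖x‖) ^ (-4 : ℝ) + ‖g x‖ with hb
  have hbi : Integrable b :=
    ((integrable_one_add_norm_neg (by norm_num)).const_mul _).add
      (hg.integrable_of_hasCompactSupport hgc).norm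
  have hlim : ∀ x, Tendsto (fun t => heatFlow t g x) (𝓝[>] 0) (𝓝 (g x)) := fun x => by
    have h1 := continuousAt_heatFlow (g := fun y _ => g y) (M := M)
      ((hg.comp continuous_fst).continuousOn) (fun y _ _ => hM y)
      (z := ((0 : ℝ), x, (1 : ℝ))) one_pos
    have h2 := ContinuousAt.comp (f := fun t : ℝ => (t, x, (1 : ℝ))) (x := 0) h1 (by fun_prop)
    have h3 : Tendsto (fun t => heatFlow t g x) (𝓝 0) (𝓝 (heatFlow 0 g x)) := h2
    rw [heatFlow_zero] at h3
    exact h3.mono_left nhdsWithin_le_nhds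
  have h0 : ∫⁻ _ : E, (0 : ℝ≥0∞) = 0 := by simp
  rw [← h0]
  refine tendsto_lintegral_filter_of_dominated_convergence (fun x => ENNReal.ofReal (b x)) ?_ ?_
    hbi.lintegral_lt_top.ne ?_
  · filter_upwards [self_mem_nhdsWithin] with t ht
    exact ((continuous_heatFlow_of_bounded hg hM t).sub hg).enorm.measurable
  · filter_upwards [eventually_small] with t ht
    refine Eventually.of_forall fun x => ?_
    rw [← ofReal_norm]
    refine ENNReal.ofReal_le_ofReal ((norm_sub_le _ _).trans ?_)
    refine add_le_add_left ?_ ‖g x‖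
    have h1 := hdec g K hK0 (Eventually.of_forall hgd) t ht.1 x
    have h2 : C * K * (t + 1) ^ (-(3 / 2) : ℝ) ≤ C * K :=
      mul_le_of_le_one_right (by positivity)
        (Real.rpow_le_one_of_one_le_of_nonpos (by linarith [ht.1]) (by norm_num))
    refine (le_of_weight_mul_le (by norm_num) ht.1 (by positivity) (h1.trans h2)).trans ?_
    have := sqrt_rpow_le_two_rpow (m := 4) (by norm_num) ht.2
    gcongr
  · refine Eventually.of_forall fun x => ?_
    have h1 := ((hlim x).sub_const (g x)).enorm
    rwa [sub_self, enorm_zero] at h1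

/-- The heat flow converges in `L¹` to its initial datum. -/
lemma tendsto_lintegral_heatFlow [CompleteSpace F] {f : E → F} (hf : Integrable f) :
    Tendsto (fun t => ∫⁻ x, ‖heatFlow t f x - f x‖ₑ) (𝓝[>] 0) (𝓝 0) := by
  rw [ENNReal.tendsto_nhds_zero]
  intro ε hε
  have hε3 : ε / 3 ≠ 0 := (ENNReal.div_pos hε.ne' (by norm_num)).ne'
  obtain ⟨g, hgc, hfg, hg, hgi⟩ := hf.exists_hasCompactSupport_lintegral_sub_le hε3
  have h1 := (ENNReal.tendsto_nhds_zero.1 (tendsto_heatFlow_of_hasCompactSupport hg hgc))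
    (ε / 3) (pos_iff_ne_zero.2 hε3)
  filter_upwards [h1, self_mem_nhdsWithin] with t ht1 ht
  rw [mem_Ioi] at ht
  have hfgm : AEStronglyMeasurable (fun y => f y - g y) (volume : Measure E) := hf.1.sub hgi.1
  have h2 : ∫⁻ x, ‖heatFlow t (fun y => f y - g y) x‖ₑ ≤ ε / 3 :=
    (lintegral_heatFlow_le ht hfgm).trans hfg
  have hgm : AEMeasurable (fun x => ‖heatFlow t g x - g x‖ₑ) (volume : Measure E) := by
    obtain ⟨M, hM⟩ := hg.bounded_above_of_compact_support hgc
    exact ((continuous_heatFlow_of_bounded hg hM t).sub hg).enorm.measurable.aemeasurable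
  calc ∫⁻ x, ‖heatFlow t f x - f x‖ₑ
      ≤ ∫⁻ x, (‖heatFlow t g x - g x‖ₑ + (‖f x - g x‖ₑ +
          ‖heatFlow t (fun y => f y - g y) x‖ₑ)) := by
        refine lintegral_mono fun x => ?_
        have e : heatFlow t f x - f x = (heatFlow t g x - g x) + (-(f x - g x) +
            heatFlow t (fun y => f y - g y) x) := by
          rw [heatFlow_sub ht hf hgi]
          abel
        rw [e]
        refine (enorm_add_le _ _).trans (add_le_add le_rfl ((enorm_add_le _ _).trans ?_))
        rw [enorm_neg]
    _ = (∫⁻ x, ‖heatFlow t g x - g x‖ₑ) + ((∫⁻ x, ‖f x - g x‖ₑ) +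
          ∫⁻ x, ‖heatFlow t (fun y => f y - g y) x‖ₑ) := by
        rw [lintegral_add_left' hgm, lintegral_add_left' hfgm.enorm]
    _ ≤ ε / 3 + (ε / 3 + ε / 3) := add_le_add ht1 (add_le_add hfg h2)
    _ = ε := by rw [← add_assoc, ENNReal.add_thirds]

end InitialData

end QTensor

end

/-! ### Small solutions of the integral equation are smooth and solve the differential equation. -/

noncomputable section

namespace QTensor

section MildSolution

variable {δ a b c : ℝ} {Q₀ : Data δ} {U : XSpace δ}

/-- `U` solves the integral equation with datum `Q₀`. -/
def IsMildSolution (hδ : 0 < δ) (ha : 0 < a) (b c : ℝ) (Q₀ : Data δ) (U : XSpace δ) : Prop :=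
  U = dataFlow hδ Q₀ + weightedDuhamel hδ ha (weightedReaction hδ ha b c U)

lemma IsMildSolution.eval_eq {hδ : 0 < δ} {ha : 0 < a} (h : IsMildSolution hδ ha b c Q₀ U) (x : E)
    {t : ℝ} (ht : 0 < t) : U.eval x t = heatFlow t Q₀ x +
      duhamel a heatKer (extend (unweightSq δ (weightedReaction hδ ha b c U))) x t := by
  rw [Weighted.eval_eq_extend, extend_of_pos _ _ ht]
  exact congrArg (fun V : XSpace δ => V (x, ⟨t, ht⟩)) h

lemma extend_weightedReaction (hδ : 0 < δ) (ha : 0 < a) (x : E) {t : ℝ} (ht : 0 < t) :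
    extend (unweightSq δ (weightedReaction hδ ha b c U)) x t =
      rescaledReaction a b c t (U.eval x t) := by
  rw [extend_of_pos _ _ ht, Weighted.eval_eq_extend, extend_of_pos _ _ ht]
  exact unweightSq_weightedReaction hδ ha b c U _

lemma Weighted.norm_incl_le {k : ℝ} (hδ : 0 < δ) (hk : 0 ≤ k) (V : Weighted δ k) :
    ‖Weighted.incl hδ hk V‖ ≤ ‖V‖ :=
  (BoundedContinuousFunction.norm_le (norm_nonneg _)).2 (V.norm_apply_le hδ hk)

lemma freeFlowOp_heatKer_data (hδ : 0 < δ) (Q₀ : Data δ) :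
    freeFlowOp Q₀.aestronglyMeasurable (Q₀.norm_ae_le_norm hδ) heatKer =
      Weighted.incl hδ (by norm_num) (dataFlow hδ Q₀) := by
  ext1 q
  rw [freeFlowOp_apply, freeFlow_heatKer, Weighted.incl_apply, dataFlow_apply]

/-- Small solutions of the integral equation are smooth. -/
lemma exists_smooth_radius (hδ : 0 < δ) (ha : 0 < a) (b c : ℝ) : ∃ ε > 0, ∀ (Q₀ : Data δ)
    (U : XSpace δ), IsMildSolution hδ ha b c Q₀ U → ‖U‖ < ε → ‖Q₀‖ < ε →
      ContDiffOn ℝ ∞ (fun q : E × ℝ => U.eval q.1 q.2) (univ ×ˢ Ioi 0) := by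
  obtain ⟨ε, hε, h⟩ := exists_analytic_distortion ha b c
  have hD : 0 < ‖dataFlow hδ‖ + 1 := by positivity
  refine ⟨min ε (ε / (‖dataFlow hδ‖ + 1)), lt_min hε (by positivity), fun Q₀ U hU hUε hQε => ?_⟩
  obtain ⟨W, hW, hWd⟩ := h Q₀ ‖Q₀‖ Q₀.aestronglyMeasurable (Q₀.norm_ae_le_norm hδ)
    (Weighted.incl hδ (by norm_num) U) (unweightSqMap hδ (weightedReaction hδ ha b c U))
    (fun q => unweightSq_weightedReaction hδ ha b c U q) (by
      rw [freeFlowOp_heatKer_data, ← incl_weightedDuhamel, ← map_add]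
      exact congrArg _ hU)
    ((Weighted.norm_incl_le hδ _ U).trans_lt (hUε.trans_le (min_le_left _ _))) (by
      rw [freeFlowOp_heatKer_data]
      refine (Weighted.norm_incl_le hδ _ _).trans_lt (((dataFlow hδ).le_opNorm Q₀).trans_lt ?_)
      have h1 := hQε.trans_le (min_le_right _ _)
      rw [lt_div_iff₀ hD] at h1
      nlinarith [norm_nonneg Q₀])
  rintro ⟨x, t⟩ hq
  exact (contDiffAt_of_distortion hW hWd x hq.2).contDiffWithinAt

lemma continuousOn_weightedReaction (hδ : 0 < δ) (ha : 0 < a) (b c : ℝ) (U : XSpace δ) :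
    ContinuousOn (fun p : E × ℝ =>
      extend (unweightSq δ (weightedReaction hδ ha b c U)) p.1 p.2) (univ ×ˢ Ioi 0) :=
  continuousOn_extend (continuous_unweightSq _)

/-- Smooth solutions of the integral equation solve the rescaled equation. -/
lemma IsMildSolution.hasDerivAt {hδ : 0 < δ} {ha : 0 < a} (h : IsMildSolution hδ ha b c Q₀ U)
    (hs : ContDiffOn ℝ ∞ (fun q : E × ℝ => U.eval q.1 q.2) (univ ×ˢ Ioi 0)) (x : E) {t : ℝ}
    (ht : 0 < t) : HasDerivAt (fun s => U.eval x s)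
      (Laplacian.laplacian (fun y => U.eval y t) x +
        Real.exp (-a * t) • rescaledReaction a b c t (U.eval x t)) t := by
  have h1 := (differentiableAt_slice hs x ht).hasDerivAt
  -- The integral equation only identifies a right derivative. As `U` is already known to be
  -- differentiable in time, this determines the full derivative.
  have h2 := (hasDerivAt_iff_tendsto_slope_zero.1 h1).mono_left
    (nhdsWithin_mono (0 : ℝ) (fun r (hr : r ∈ Ioi (0 : ℝ)) => ne_of_gt hr))
  have h3 := tendsto_mild_quotient ha Q₀.aestronglyMeasurable (Q₀.norm_ae_le_norm hδ)
    (continuousOn_weightedReaction hδ ha b c U)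
    (fun y s hs => norm_extend_le (norm_unweightSq_le hδ _) y hs)
    (R := fun x t => U.eval x t) (fun x t ht => h.eval_eq x ht)
    (fun x t ht => norm_extend_le (U.norm_apply_le hδ (by norm_num)) x ht) ht
    (contDiff_infty.1 (contDiff_slice hs ht) 2) x
  rw [extend_weightedReaction hδ ha x ht] at h3
  rw [← tendsto_nhds_unique h2 h3]
  exact h1

lemma eval_damp (ha : 0 < a) (U : XSpace δ) (x : E) {t : ℝ} (ht : 0 < t) :
    (damp δ (3 / 2) ha U).eval x t = Real.exp (-a * t) • U.eval x t := by
  rw [Weighted.eval_eq_extend, Weighted.eval_eq_extend, extend_of_pos _ _ ht,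
    extend_of_pos _ _ ht, damp_apply]

lemma laplacian_const_smul {f : E → Sym0} (hf : ContDiff ℝ 2 f) (r : ℝ) (x : E) :
    Laplacian.laplacian (fun y => r • f y) x = r • Laplacian.laplacian f x := by
  rw [laplacian_eq_sum hf, laplacian_eq_sum (hf.const_smul r), Finset.smul_sum]
  refine Finset.sum_congr rfl fun i _ => ?_
  have h1 : (fun y => fderiv ℝ (fun y => r • f y) y (stdE i)) =
      fun y => r • fderiv ℝ f y (stdE i) := by
    funext y
    rw [fderiv_fun_const_smul ((hf.differentiable two_ne_zero) y), _root_.smul_apply]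
  rw [h1, fderiv_fun_const_smul ((contDiff_fderiv_apply hf (m := 1) le_rfl _).differentiable
    one_ne_zero x), _root_.smul_apply]

/-- Smooth solutions of the integral equation solve the original equation. -/
lemma IsMildSolution.equation {hδ : 0 < δ} {ha : 0 < a} (h : IsMildSolution hδ ha b c Q₀ U)
    (hs : ContDiffOn ℝ ∞ (fun q : E × ℝ => U.eval q.1 q.2) (univ ×ˢ Ioi 0)) (x : E) {t : ℝ}
    (ht : 0 < t) :
    deriv (fun s => (damp δ (3 / 2) ha U).eval x s) t =
      Laplacian.laplacian (fun y => (damp δ (3 / 2) ha U).eval y t) x -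
        a • (damp δ (3 / 2) ha U).eval x t + b • devSq ((damp δ (3 / 2) ha U).eval x t) -
        (c * (((damp δ (3 / 2) ha U).eval x t).mat *
          ((damp δ (3 / 2) ha U).eval x t).mat).trace) • (damp δ (3 / 2) ha U).eval x t := by
  have h1 : (fun s => (damp δ (3 / 2) ha U).eval x s) =ᶠ[𝓝 t]
      fun s => Real.exp (-a * s) • U.eval x s := by
    filter_upwards [lt_mem_nhds ht] with s hs using eval_damp ha U x hs
  have h2 : HasDerivAt (fun s => Real.exp (-a * s)) (Real.exp (-a * t) * (-a)) t := by
    have := ((hasDerivAt_id t).const_mul (-a)).exp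
    simpa using this
  have h3 : HasDerivAt (fun s => Real.exp (-a * s) • U.eval x s) _ t :=
    h2.smul (h.hasDerivAt hs x ht)
  rw [h1.deriv_eq, h3.deriv]
  simp only [eval_damp ha U _ ht]
  rw [laplacian_const_smul (contDiff_infty.1 (contDiff_slice hs ht) 2),
    Sym0.trace_mul_self, norm_smul, Real.norm_of_nonneg (Real.exp_pos _).le, devSq_smul,
    rescaledReaction]
  module

end MildSolution

end QTensor

end

/-! ### Membership in the phase space and attainment of the initial datum. -/

noncomputable section

namespace QTensor

section Phase

variable {δ a b c : ℝ}

lemma Weighted.eval_of_pos {k : ℝ} (U : Weighted δ k) (x : E) {t : ℝ} (ht : 0 < t) :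
    U.eval x t = U (x, ⟨t, ht⟩) := dif_pos ht

lemma continuous_eval_slice {k : ℝ} (U : Weighted δ k) {t : ℝ} (ht : 0 < t) :
    Continuous fun x => U.eval x t := by
  simp only [U.eval_of_pos _ ht]
  exact U.continuous.comp (by fun_prop)

lemma norm_eval_le (hδ : 0 < δ) (U : XSpace δ) (x : E) {t : ℝ} (ht : 0 < t) :
    ‖U.eval x t‖ ≤ ‖U‖ := by
  rw [U.eval_of_pos _ ht]
  exact U.norm_apply_le hδ (by norm_num) _

lemma integrable_eval_slice (hδ : 0 < δ) (U : XSpace δ) {t : ℝ} (ht : 0 < t) :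
    Integrable fun x => U.eval x t := by
  refine (((integrable_one_add_norm_neg (r := 4 + δ / 2) (by linarith)).const_mul
    (‖U‖ * Real.sqrt (t + 1) ^ (4 + δ / 2)))).mono'
    (continuous_eval_slice U ht).aestronglyMeasurable (Eventually.of_forall fun x => ?_)
  refine le_of_weight_mul_le (by linarith) ht (norm_nonneg U) ?_
  have h1 := U.mul_norm_le (x, ⟨t, ht⟩)
  rw [timeWeight, ← U.eval_of_pos x ht] at h1
  refine le_trans ?_ h1
  refine mul_le_mul_of_nonneg_right (le_mul_of_one_le_right (by positivity) ?_) (norm_nonneg _)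
  exact Real.one_le_rpow (by linarith) (by norm_num)

lemma memLp_eval_slice (hδ : 0 < δ) (U : XSpace δ) {t : ℝ} (ht : 0 < t) {p : ℝ} (hp : 1 ≤ p) :
    MemLp (fun x => U.eval x t) (ENNReal.ofReal p) (volume : Measure E) :=
  memLp_of_integrable_of_norm_le (integrable_eval_slice hδ U ht)
    (Eventually.of_forall fun x => norm_eval_le hδ U x ht) hp

/-- The factor `min 1 t` in the weighted estimate makes the Duhamel term `O(t)` in `L¹`, uniformly
for `t ≤ 1`. -/
lemma exists_duhamel_lintegral_majorant (hδ : 0 < δ) (ha : 0 < a) (v : BddMap) :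
    ∃ K : ℝ, 0 ≤ K ∧ ∀ t : ℝ, 0 < t → t ≤ 1 → ∀ x : E,
      ‖duhamel a heatKer (extend (unweightSq δ v)) x t‖ ≤ t * (K * (1 + ‖x‖) ^ (-(4 + δ / 2))) := by
  obtain ⟨C, hC, h⟩ := exists_weighted_duhamel_le hδ ha
  refine ⟨C * ‖v‖ * 2 ^ (4 + δ / 2), by positivity, fun t ht ht1 x => ?_⟩
  have h1 : C * ‖v‖ * min 1 t * (t + 1) ^ (-(3 / 2) : ℝ) ≤ C * ‖v‖ * t := by
    refine (mul_le_of_le_one_right (by positivity)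
      (Real.rpow_le_one_of_one_le_of_nonpos (by linarith) (by norm_num))).trans ?_
    exact mul_le_mul_of_nonneg_left (min_le_right _ _) (by positivity)
  refine (le_of_weight_mul_le (by linarith) ht (by positivity) ((h v t ht x).trans h1)).trans ?_
  calc C * ‖v‖ * t * Real.sqrt (t + 1) ^ (4 + δ / 2) * (1 + ‖x‖) ^ (-(4 + δ / 2))
      ≤ C * ‖v‖ * t * 2 ^ (4 + δ / 2) * (1 + ‖x‖) ^ (-(4 + δ / 2)) :=
        mul_le_mul_of_nonneg_right (mul_le_mul_of_nonneg_left
          (sqrt_rpow_le_two_rpow (by linarith) ht1) (by positivity)) (by positivity)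
    _ = _ := by ring

/-- Solutions of the integral equation attain their datum in `L¹`. -/
lemma IsMildSolution.tendsto_lintegral {hδ : 0 < δ} {ha : 0 < a} {Q₀ : Data δ} {U : XSpace δ}
    (h : IsMildSolution hδ ha b c Q₀ U) :
    Tendsto (fun t => ∫⁻ x, ‖(damp δ (3 / 2) ha U).eval x t - Q₀ x‖ₑ) (𝓝[>] 0) (𝓝 0) := by
  obtain ⟨K, hK, hD⟩ :=
    exists_duhamel_lintegral_majorant hδ ha (weightedReaction hδ ha b c U)
  set w : E → ℝ := fun x => K * (1 + ‖x‖) ^ (-(4 + δ / 2)) with hw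
  have hwi : Integrable w := (integrable_one_add_norm_neg (by linarith)).const_mul K
  have hexp : Tendsto (fun t : ℝ => 1 - Real.exp (-a * t)) (𝓝[>] 0) (𝓝 0) := by
    have : Continuous fun t : ℝ => 1 - Real.exp (-a * t) := by fun_prop
    have h0 := this.tendsto 0
    simp only [mul_zero, Real.exp_zero, sub_self] at h0
    exact h0.mono_left nhdsWithin_le_nhds
  have hid : Tendsto (fun t : ℝ => t) (𝓝[>] 0) (𝓝 0) := tendsto_id.mono_left nhdsWithin_le_nhds
  have hlim : Tendsto (fun t : ℝ => (∫⁻ x, ‖heatFlow t Q₀ x - Q₀ x‖ₑ) +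
      (ENNReal.ofReal (1 - Real.exp (-a * t)) * (∫⁻ x, ‖Q₀ x‖ₑ) +
        ENNReal.ofReal t * ∫⁻ x, ENNReal.ofReal (w x))) (𝓝[>] 0) (𝓝 0) := by
    have e1 := ENNReal.Tendsto.mul_const (b := ∫⁻ x, ‖Q₀ x‖ₑ)
      (ENNReal.tendsto_ofReal hexp) (Or.inr (Q₀.integrable hδ).2.ne)
    have e2 := ENNReal.Tendsto.mul_const (b := ∫⁻ x, ENNReal.ofReal (w x))
      (ENNReal.tendsto_ofReal hid) (Or.inr hwi.lintegral_lt_top.ne)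
    have e3 := (tendsto_lintegral_heatFlow (Q₀.integrable hδ)).add (e1.add e2)
    simpa using e3
  refine tendsto_of_tendsto_of_tendsto_of_le_of_le' tendsto_const_nhds hlim
    (Eventually.of_forall fun t => zero_le) ?_
  filter_upwards [eventually_small] with t ⟨ht, ht1⟩
  have hm : AEMeasurable (fun x => ‖Q₀ x‖ₑ) (volume : Measure E) := Q₀.aestronglyMeasurable.enorm
  have hwm : AEMeasurable (fun x => ENNReal.ofReal (w x)) (volume : Measure E) :=
    hwi.1.aemeasurable.ennreal_ofReal
  have hsum : AEMeasurable (fun x => ENNReal.ofReal (1 - Real.exp (-a * t)) * ‖Q₀ x‖ₑ +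
      ENNReal.ofReal t * ENNReal.ofReal (w x)) (volume : Measure E) :=
    (hm.const_mul _).add (hwm.const_mul _)
  rw [← lintegral_const_mul'' _ hm, ← lintegral_const_mul'' _ hwm,
    ← lintegral_add_right' _ (hwm.const_mul _),
    ← lintegral_add_right' _ hsum]
  refine lintegral_mono fun x => ?_
  have he1 : Real.exp (-a * t) ≤ 1 := Real.exp_le_one_iff.2 (by nlinarith)
  have he0 := Real.exp_pos (-a * t)
  -- Three errors vanish separately: that of the heat flow, that of the factor `e^{-at}` on the
  -- datum, and the Duhamel term.
  have hsplit : (damp δ (3 / 2) ha U).eval x t - Q₀ x =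
      Real.exp (-a * t) • (heatFlow t Q₀ x - Q₀ x) + ((-(1 - Real.exp (-a * t))) • Q₀ x +
        Real.exp (-a * t) •
          duhamel a heatKer (extend (unweightSq δ (weightedReaction hδ ha b c U))) x t) := by
    rw [eval_damp ha U x ht, h.eval_eq x ht]
    module
  have hle : ‖(damp δ (3 / 2) ha U).eval x t - Q₀ x‖ ≤ ‖heatFlow t Q₀ x - Q₀ x‖ +
      ((1 - Real.exp (-a * t)) * ‖Q₀ x‖ + t * w x) := by
    rw [hsplit]
    refine (norm_add_le _ _).trans (add_le_add ?_ ((norm_add_le _ _).trans (add_le_add ?_ ?_)))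
    · rw [norm_smul, Real.norm_of_nonneg he0.le]
      exact mul_le_of_le_one_left (norm_nonneg _) he1
    · rw [norm_smul, norm_neg, Real.norm_of_nonneg (by linarith)]
    · rw [norm_smul, Real.norm_of_nonneg he0.le]
      exact (mul_le_of_le_one_left (norm_nonneg _) he1).trans (hD t ht ht1 x)
  have hw0 : 0 ≤ w x := by positivity
  rw [← ofReal_norm, ← ofReal_norm, ← ofReal_norm,
    ← ENNReal.ofReal_mul (by linarith), ← ENNReal.ofReal_mul ht.le,
    ← ENNReal.ofReal_add (mul_nonneg (by linarith) (norm_nonneg _)) (by positivity),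
    ← ENNReal.ofReal_add (norm_nonneg _)
      (add_nonneg (mul_nonneg (by linarith) (norm_nonneg _)) (by positivity))]
  exact ENNReal.ofReal_le_ofReal hle

lemma IsMildSolution.tendsto_eLpNorm {hδ : 0 < δ} {ha : 0 < a} {Q₀ : Data δ} {U : XSpace δ}
    (h : IsMildSolution hδ ha b c Q₀ U) {p : ℝ} (hp : 1 ≤ p) :
    Tendsto (fun t => eLpNorm (fun x => (damp δ (3 / 2) ha U).eval x t - Q₀ x)
      (ENNReal.ofReal p) (volume : Measure E)) (𝓝[>] 0) (𝓝 0) := by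
  refine tendsto_eLpNorm_of_lintegral (M := ‖damp δ (3 / 2) ha U‖ + ‖Q₀‖) ?_
    h.tendsto_lintegral hp
  filter_upwards [eventually_small] with t ⟨ht, _⟩
  filter_upwards [Q₀.norm_ae_le_norm hδ] with x hx
  exact (norm_sub_le _ _).trans (add_le_add (norm_eval_le hδ _ x ht) hx)

/-- Smooth solutions of the integral equation solve the initial value problem. -/
lemma IsMildSolution.isSolution {hδ : 0 < δ} {ha : 0 < a} {Q₀ : Data δ} {U : XSpace δ}
    (h : IsMildSolution hδ ha b c Q₀ U)
    (hs : ContDiffOn ℝ ∞ (fun q : E × ℝ => U.eval q.1 q.2) (univ ×ˢ Ioi 0)) :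
    IsSolution a b c Q₀ (damp δ (3 / 2) ha U).eval where
  smooth := by
    have h0 : ContDiff ℝ ∞ fun q : E × ℝ => Real.exp (-a * q.2) := by fun_prop
    have h1 : ContDiffOn ℝ ∞ (fun q : E × ℝ => Real.exp (-a * q.2) • U.eval q.1 q.2)
        (univ ×ˢ Ioi 0) :=
      h0.contDiffOn.smul hs
    exact h1.congr fun q hq => eval_damp ha U q.1 hq.2
  equation x t ht := h.equation hs x ht
  memLp_two t ht := by
    simpa using memLp_eval_slice hδ (damp δ (3 / 2) ha U) ht (p := 2) (by norm_num)
  memLp_six t ht := by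
    simpa using memLp_eval_slice hδ (damp δ (3 / 2) ha U) ht (p := 6) (by norm_num)
  initial_two := by simpa using h.tendsto_eLpNorm (p := 2) (by norm_num)
  initial_six := by simpa using h.tendsto_eLpNorm (p := 6) (by norm_num)

end Phase

end QTensor

end

/-! ### The coefficient `A`: uniqueness, formula and profile. -/

noncomputable section

namespace QTensor

section Coefficient

variable {δ a b c : ℝ}

lemma norm_eval_zero_le (V : RemainderSpace δ) {t : ℝ} (ht : 0 < t) :
    ‖V.eval 0 t‖ ≤ ‖V‖ * (t + 1) ^ (-2 : ℝ) := by
  have h := V.mul_norm_le (0, ⟨t, ht⟩)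
  rw [timeWeight, norm_zero, zero_div, add_zero, Real.one_rpow, one_mul, ← V.eval_of_pos 0 ht] at h
  rwa [Real.rpow_neg (by positivity), ← div_eq_mul_inv, le_div_iff₀ (by positivity), mul_comm]

/-- At `x = 0` the profile decays like `(t + 1)^{-3/2}` and remainders like `(t + 1)^{-2}`, so two
coefficients differ by `O((t + 1)^{-1/2})`; let `t → ∞`. -/
lemma HasCoefficient.unique {Q : E → ℝ → Sym0} {A A' : Sym0} (h : HasCoefficient a δ Q A)
    (h' : HasCoefficient a δ Q A') : A = A' := by
  obtain ⟨V, hV⟩ := h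
  obtain ⟨V', hV'⟩ := h'
  have hle : ∀ t : ℝ, 0 < t → ‖A - A'‖ ≤
      (‖V‖ + ‖V'‖) * (4 * Real.pi) ^ (3 / 2 : ℝ) * (t + 1) ^ (-(1 / 2) : ℝ) := by
    intro t ht
    have ht1 : (0 : ℝ) < t + 1 := by linarith
    have hpi := Real.pi_pos
    have h1 : heatKernelShifted 0 t • (A - A') = V'.eval 0 t - V.eval 0 t := by
      have h2 := (hV 0 t ht).symm.trans (hV' 0 t ht)
      rw [mul_smul, mul_smul, ← smul_add, ← smul_add] at h2
      have h3 := smul_right_injective Sym0 (Real.exp_pos (-a * t)).ne' h2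
      rw [smul_sub, sub_eq_sub_iff_add_eq_add]
      simpa only [add_comm] using h3
    have h2 : heatKernelShifted 0 t = ((4 * Real.pi) ^ (3 / 2 : ℝ) * (t + 1) ^ (3 / 2 : ℝ))⁻¹ := by
      rw [heatKernelShifted, ← Real.mul_rpow (by positivity) ht1.le]
      simp
    have h3 : heatKernelShifted 0 t * ‖A - A'‖ ≤ (‖V‖ + ‖V'‖) * (t + 1) ^ (-2 : ℝ) := by
      have h4 := congrArg norm h1
      rw [norm_smul, Real.norm_of_nonneg (by rw [h2]; positivity)] at h4
      rw [h4, add_mul, add_comm]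
      exact (norm_sub_le _ _).trans (add_le_add (norm_eval_zero_le V' ht) (norm_eval_zero_le V ht))
    rw [h2, inv_mul_le_iff₀ (by positivity)] at h3
    refine h3.trans (le_of_eq ?_)
    have h5 : (t + 1) ^ (3 / 2 : ℝ) * (t + 1) ^ (-2 : ℝ) = (t + 1) ^ (-(1 / 2) : ℝ) := by
      rw [← Real.rpow_add ht1]
      norm_num
    rw [← h5]
    ring
  have hlim : Tendsto (fun t : ℝ => (‖V‖ + ‖V'‖) * (4 * Real.pi) ^ (3 / 2 : ℝ) *
      (t + 1) ^ (-(1 / 2) : ℝ)) atTop (𝓝 0) := by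
    have h1 := ((tendsto_rpow_neg_atTop (y := 1 / 2) (by norm_num)).comp
      (tendsto_atTop_add_const_right atTop (1 : ℝ) tendsto_id)).const_mul
        ((‖V‖ + ‖V'‖) * (4 * Real.pi) ^ (3 / 2 : ℝ))
    rw [mul_zero] at h1
    exact h1
  have h0 : ‖A - A'‖ ≤ 0 := ge_of_tendsto hlim
    ((eventually_gt_atTop 0).mono fun t ht => hle t ht)
  exact sub_eq_zero.1 (norm_le_zero_iff.1 h0)

/-- The coefficient of the solution `U` of the integral equation with datum `Q₀`. -/
def coefficient (hδ : 0 < δ) (ha : 0 < a) (b c : ℝ) (Q₀ : Data δ) (U : XSpace δ) : Sym0 :=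
  dataMass hδ Q₀ + weightedMass hδ ha (weightedReaction hδ ha b c U)

lemma continuous_heatKernelShifted :
    Continuous fun p : SpaceTime => heatKernelShifted p.1 p.2 := by
  have h : ∀ p : SpaceTime, (0 : ℝ) < (p.2 : ℝ) + 1 := fun p => by
    have := p.2.2; rw [mem_Ioi] at this; linarith
  have hpi := Real.pi_pos
  unfold heatKernelShifted
  refine Continuous.div (Real.continuous_exp.comp (Continuous.div (by fun_prop) (by fun_prop)
    fun p => ?_)) (Continuous.rpow_const (by fun_prop) fun p => Or.inl ?_) fun p => ?_
  · have := h p; positivity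
  · have := h p; positivity
  · have := h p; positivity

/-- The masses of datum and source multiply the same Gaussian of age `t + 1`: the datum is compared
with age `σ = 1`, and each term leaves a remainder with the decay of `X₀`. -/
lemma IsMildSolution.hasCoefficient {hδ : 0 < δ} {ha : 0 < a} {Q₀ : Data δ} {U : XSpace δ}
    (h : IsMildSolution hδ ha b c Q₀ U) :
    HasCoefficient a δ (damp δ (3 / 2) ha U).eval (coefficient hδ ha b c Q₀ U) := by
  set v := weightedReaction hδ ha b c U with hv
  set A := coefficient hδ ha b c Q₀ U with hA
  obtain ⟨C₁, hC₁, h1⟩ := exists_heatFlow_remainder (F := Sym0) (m := 4 + δ / 2) (by linarith)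
  obtain ⟨C₂, hC₂, h2⟩ := exists_weighted_remainder hδ ha
  have hbound : ∀ p : SpaceTime, timeWeight δ 2 p.1 p.2 *
      ‖U p - heatKernelShifted p.1 p.2 • A‖ ≤ C₁ * ‖Q₀‖ + C₂ * ‖v‖ := by
    rintro ⟨x, t, ht⟩
    have ht' : (0 : ℝ) < t := ht
    have ht1 : (0 : ℝ) < (t + 1) ^ (2 : ℝ) := by positivity
    have e1 := h1 Q₀ ‖Q₀‖ (norm_nonneg _) Q₀.aestronglyMeasurable Q₀.norm_ae_le 1 le_rfl t ht' x
    have e2 := (h2 v).2 t ht' x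
    rw [Real.one_rpow, mul_one] at e1
    have e3 : U (x, ⟨t, ht⟩) - heatKernelShifted x t • A =
        (heatFlow t Q₀ x - heatKernel (t + 1) x • ∫ y, Q₀ y) +
        (duhamel a heatKer (extend (unweightSq δ v)) x t -
          heatKernel (t + 1) x • totalMass a (extend (unweightSq δ v))) := by
      rw [← U.eval_of_pos x ht', h.eval_eq x ht', heatKernelShifted_eq, hA, coefficient,
        dataMass_apply, weightedMass_apply, smul_add, hv]
      abel
    change timeWeight δ 2 x t * ‖U (x, ⟨t, ht⟩) - heatKernelShifted x t • A‖ ≤ _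
    rw [e3, timeWeight]
    set N := ‖(heatFlow t Q₀ x - heatKernel (t + 1) x • ∫ y, Q₀ y) +
        (duhamel a heatKer (extend (unweightSq δ v)) x t -
          heatKernel (t + 1) x • totalMass a (extend (unweightSq δ v)))‖ with hN
    have e4 : (1 + ‖x‖ / Real.sqrt (t + 1)) ^ (4 + δ / 2) * N ≤
        (C₁ * ‖Q₀‖ + C₂ * ‖v‖) * (t + 1) ^ (-2 : ℝ) := by
      refine (mul_le_mul_of_nonneg_left (norm_add_le _ _) (by positivity)).trans ?_
      rw [mul_add, add_mul]
      exact add_le_add e1 e2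
    rw [Real.rpow_neg (by positivity), ← div_eq_mul_inv, le_div_iff₀ ht1] at e4
    calc _ = (1 + ‖x‖ / Real.sqrt (t + 1)) ^ (4 + δ / 2) * N * (t + 1) ^ (2 : ℝ) := by ring
      _ ≤ _ := e4
  set V : RemainderSpace δ := Weighted.of (fun p => U p - heatKernelShifted p.1 p.2 • A)
    (U.continuous.sub (continuous_heatKernelShifted.smul continuous_const)) _ hbound with hV
  refine ⟨V, fun x t ht => ?_⟩
  have h3 : V.eval x t = U.eval x t - heatKernelShifted x t • A := by
    rw [U.eval_of_pos x ht]
    exact V.eval_of_pos x ht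
  rw [eval_damp ha U x ht, h3]
  module

lemma IsMildSolution.hasCoefficient_iff {hδ : 0 < δ} {ha : 0 < a} {Q₀ : Data δ} {U : XSpace δ}
    (h : IsMildSolution hδ ha b c Q₀ U) (A : Sym0) :
    HasCoefficient a δ (damp δ (3 / 2) ha U).eval A ↔ A = coefficient hδ ha b c Q₀ U :=
  ⟨fun hA => hA.unique h.hasCoefficient, fun hA => hA ▸ h.hasCoefficient⟩

end Coefficient

/-! ### A datum with nonzero integral. -/

section NonzeroMass

lemma exists_sym0_ne_zero : ∃ A : Sym0, A ≠ 0 := by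
  refine ⟨⟨Matrix.diagonal ![1, -1, 0], Matrix.diagonal_transpose _, by
    simp [Matrix.trace_diagonal, Fin.sum_univ_three]⟩, fun h => ?_⟩
  have h1 : (Matrix.diagonal ![1, -1, 0] : Matrix (Fin 3) (Fin 3) ℝ) = 0 := congrArg Subtype.val h
  simpa using congrFun (congrFun h1 0) 0

/-- The indicator of the unit ball times a nonzero matrix. It shows that the derivative of the
coefficient at the origin is not zero. -/
lemma exists_dataMass_ne_zero {δ : ℝ} (hδ : 0 < δ) : ∃ Q : Data δ, dataMass hδ Q ≠ 0 := by
  obtain ⟨A, hA⟩ := exists_sym0_ne_zero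
  have hB : MeasurableSet (Metric.ball (0 : E) 1) := measurableSet_ball
  have hv : (volume : Measure E) (Metric.ball (0 : E) 1) ≠ ⊤ := measure_ball_lt_top.ne
  have hind := indicatorConstLp_coeFn (p := ∞) (hs := hB) (hμs := hv) (c := A)
  have hcont : Continuous (spaceWeight δ) :=
    Continuous.rpow_const (by fun_prop) fun x => Or.inr (by linarith)
  have hmem : MemLp (fun x => spaceWeight δ x • indicatorConstLp ∞ hB hv A x) ∞
      (volume : Measure E) := by
    refine memLp_top_of_bound (hcont.aestronglyMeasurable.smul (Lp.aestronglyMeasurable _))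
      (2 ^ (8 + δ) * ‖A‖) ?_
    filter_upwards [hind] with x hx
    rw [hx, norm_smul, Real.norm_of_nonneg (spaceWeight_pos δ x).le]
    by_cases hxB : x ∈ Metric.ball (0 : E) 1
    · rw [indicator_of_mem hxB]
      rw [mem_ball_zero_iff] at hxB
      exact mul_le_mul_of_nonneg_right
        (Real.rpow_le_rpow (by positivity) (by linarith) (by linarith)) (norm_nonneg _)
    · rw [indicator_of_notMem hxB, norm_zero, mul_zero]
      positivity
  refine ⟨(⟨indicatorConstLp ∞ hB hv A, hmem⟩ : dataSubmodule δ), ?_⟩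
  change (∫ y, indicatorConstLp ∞ hB hv A y) ≠ 0
  rw [integral_congr_ae hind, integral_indicator_const A hB]
  refine smul_ne_zero ?_ hA
  rw [measureReal_def]
  exact (ENNReal.toReal_pos (Metric.measure_ball_pos _ _ one_pos).ne' hv).ne'

end NonzeroMass

/-! ### The zero set of the coefficient has empty interior. -/

section SolutionMaps

variable {δ a b c : ℝ}

/-- A linear map vanishes if a quadratically small perturbation of it vanishes near `0`. -/
lemma ContinuousLinearMap.eq_zero_of_eventually_add_eq_zero {X Y : Type*} [NormedAddCommGroup X]
    [NormedSpace ℝ X] [NormedAddCommGroup Y] [NormedSpace ℝ Y] {M : X →L[ℝ] Y} {N : X → Y} {C : ℝ}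
    (hN : ∀ᶠ x in 𝓝 0, ‖N x‖ ≤ C * ‖x‖ ^ 2) (h : ∀ᶠ x in 𝓝 0, M x + N x = 0) : M = 0 := by
  have h1 : HasFDerivAt (fun x => M x + N x) (M + 0) 0 :=
    M.hasFDerivAt.add (fderiv_eq_zero_of_norm_le_sq hN)
  have h2 : HasFDerivAt (fun x => M x + N x) (0 : X →L[ℝ] Y) 0 :=
    (hasFDerivAt_const (0 : Y) (0 : X)).congr_of_eventuallyEq h
  rw [add_zero] at h1
  exact h1.unique h2

/-- The solution is of first order in the datum and the reaction of second order in the solution, so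
`dataMass` is the linear part of the coefficient at zero. -/
lemma exists_weightedMass_weightedReaction_le (hδ : 0 < δ) (ha : 0 < a) (b c : ℝ)
    {S : Data δ → XSpace δ} (hS : AnalyticAt ℝ S 0) (hS0 : S 0 = 0) :
    ∃ C : ℝ, ∀ᶠ Q in 𝓝 0,
      ‖weightedMass hδ ha (weightedReaction hδ ha b c (S Q))‖ ≤ C * ‖Q‖ ^ 2 := by
  set K := |b| * ‖devBilin‖ + |c| * ‖dampWeight hδ ha‖ with hK
  obtain ⟨L, hL⟩ := hS.differentiableAt.isBigO_sub.bound
  have hlim : Tendsto S (𝓝 0) (𝓝 0) := by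
    have := hS.continuousAt.tendsto
    rwa [hS0] at this
  refine ⟨‖weightedMass hδ ha‖ * (K * L ^ 2), ?_⟩
  filter_upwards [hL, hlim.eventually (Metric.closedBall_mem_nhds 0 one_pos)] with Q h1 h2
  rw [hS0, sub_zero, sub_zero] at h1
  have h2' : ‖S Q‖ ≤ 1 := by simpa using h2
  have h3 := norm_weightedReaction_le hδ ha b c h2'
  have hK0 : 0 ≤ K := by positivity
  calc ‖weightedMass hδ ha (weightedReaction hδ ha b c (S Q))‖
      ≤ ‖weightedMass hδ ha‖ * (K * ‖S Q‖ ^ 2) :=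
        ((weightedMass hδ ha).le_opNorm _).trans
          (mul_le_mul_of_nonneg_left h3 (norm_nonneg _))
    _ ≤ ‖weightedMass hδ ha‖ * (K * (L * ‖Q‖) ^ 2) := by gcongr
    _ = _ := by ring

/-- Vanishing near one datum spreads over the connected ball by the identity theorem, in particular
to a neighbourhood of the origin; there the linear part `dataMass` would be zero. -/
lemma interior_zeros_eq_empty (hδ : 0 < δ) (ha : 0 < a) (b c : ℝ)
    {S : Data δ → XSpace δ} (hS : AnalyticAt ℝ S 0) (hS0 : S 0 = 0) {η : ℝ} (hη : 0 < η)
    (hA : AnalyticOnNhd ℝ (fun Q => coefficient hδ ha b c Q (S Q)) (Metric.ball 0 η)) :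
    interior {Q : Data δ | Q ∈ Metric.ball 0 η ∧ coefficient hδ ha b c Q (S Q) = 0} = ∅ := by
  by_contra hne
  obtain ⟨Q, hQ⟩ := nonempty_iff_ne_empty.2 hne
  have hev : (fun Q => coefficient hδ ha b c Q (S Q)) =ᶠ[𝓝 Q] 0 := by
    filter_upwards [mem_interior_iff_mem_nhds.1 hQ] with P hP using hP.2
  have hzero := hA.eqOn_zero_of_preconnected_of_eventuallyEq_zero
    (convex_ball (0 : Data δ) η).isPreconnected (interior_subset hQ).1 hev
  obtain ⟨C, hC⟩ := exists_weightedMass_weightedReaction_le hδ ha b c hS hS0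
  have hM : dataMass hδ = 0 :=
    ContinuousLinearMap.eq_zero_of_eventually_add_eq_zero hC
      (by filter_upwards [Metric.ball_mem_nhds (0 : Data δ) hη] with P hP using hzero hP)
  obtain ⟨P, hP⟩ := exists_dataMass_ne_zero hδ
  exact hP (by rw [hM, _root_.zero_apply])

end SolutionMaps

end QTensor

end

/-! ### The theorem: a common radius for all conclusions. -/

open QTensor in
theorem theorem4p2 (δ a b c : ℝ) (hδ : 0 < δ) (ha : 0 < a) (hb : 0 < b) (hc : 0 < c)
    (hbist : 27 * a * c < b ^ 2) :
    ∃ η : ℝ, 0 < η ∧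
      ∃ (solQ solR : Data δ → XSpace δ) (coeffA : Data δ → Sym0),
        (∀ Q₀ ∈ Metric.ball (0 : Data δ) η,
          IsSolution a b c Q₀ (solQ Q₀).eval ∧
          (∀ Q : E → ℝ → Sym0, IsSolution a b c Q₀ Q →
            ∀ (x : E) (t : ℝ), 0 < t → Q x t = (solQ Q₀).eval x t) ∧
          (∀ (x : E) (t : ℝ), 0 < t →
            (solR Q₀).eval x t = Real.exp (a * t) • (solQ Q₀).eval x t) ∧
          (∀ A : Sym0, HasCoefficient a δ (solQ Q₀).eval A ↔ A = coeffA Q₀)) ∧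
        AnalyticOnNhd ℝ solQ (Metric.ball 0 η) ∧
        AnalyticOnNhd ℝ solR (Metric.ball 0 η) ∧
        AnalyticOnNhd ℝ coeffA (Metric.ball 0 η) ∧
        IsClosed {Q₀ : Metric.ball (0 : Data δ) η | coeffA Q₀ = 0} ∧
        interior {Q₀ : Data δ | Q₀ ∈ Metric.ball 0 η ∧ coeffA Q₀ = 0} = ∅ := by
  obtain ⟨S, hS, hS0, hmild⟩ := exists_solution_map hδ ha b c
  obtain ⟨ε, hε, hsmooth⟩ := exists_smooth_radius hδ ha b c
  have hlim : Tendsto S (𝓝 0) (𝓝 0) := by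
    have := hS.continuousAt.tendsto
    rwa [hS0] at this
  -- A single ball on which the integral equation holds, the solution map is analytic at every
  -- point, and both the datum and the solution are small enough for smoothness.
  obtain ⟨η, hη, hball⟩ := Metric.eventually_nhds_iff_ball.1
    (((hmild.and hS.eventually_analyticAt).and
      (hlim.eventually (Metric.ball_mem_nhds 0 hε))).and (Metric.ball_mem_nhds (0 : Data δ) hε))
  have hU : ∀ Q₀ ∈ Metric.ball (0 : Data δ) η, IsMildSolution hδ ha b c Q₀ (S Q₀) :=
    fun Q₀ hQ₀ => (hball Q₀ hQ₀).1.1.1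
  have hSan : AnalyticOnNhd ℝ S (Metric.ball 0 η) := fun Q₀ hQ₀ => (hball Q₀ hQ₀).1.1.2
  have hA : AnalyticOnNhd ℝ (fun Q => coefficient hδ ha b c Q (S Q)) (Metric.ball 0 η) :=
    fun Q₀ hQ₀ => ((dataMass hδ).analyticAt Q₀).add (((weightedMass hδ ha).analyticAt _).comp
      ((analyticAt_weightedReaction hδ ha b c _).comp (hSan Q₀ hQ₀)))
  have hsol : ∀ Q₀ ∈ Metric.ball (0 : Data δ) η,
      IsSolution a b c Q₀ (damp δ (3 / 2) ha (S Q₀)).eval := fun Q₀ hQ₀ =>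
    (hU Q₀ hQ₀).isSolution (hsmooth Q₀ _ (hU Q₀ hQ₀)
      (mem_ball_zero_iff.1 (hball Q₀ hQ₀).1.2) (mem_ball_zero_iff.1 (hball Q₀ hQ₀).2))
  -- The integral equation was posed for `e^{at} Q`, so `S` itself is the map to `R`, and damping it
  -- gives the map to `Q`.
  refine ⟨η, hη, fun Q₀ => damp δ (3 / 2) ha (S Q₀), S,
    fun Q₀ => coefficient hδ ha b c Q₀ (S Q₀), fun Q₀ hQ₀ => ⟨hsol Q₀ hQ₀, ?_, ?_,
      (hU Q₀ hQ₀).hasCoefficient_iff⟩,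
    fun Q₀ hQ₀ => ((damp δ (3 / 2) ha).analyticAt _).comp (hSan Q₀ hQ₀), hSan, hA, ?_,
    interior_zeros_eq_empty hδ ha b c hS hS0 hη hA⟩
  · intro Q hQ x t ht
    exact IsSolution.eq ha hb hc Q₀.aestronglyMeasurable (hsol Q₀ hQ₀) hQ x ht
  · intro x t ht
    rw [eval_damp ha _ x ht, smul_smul, ← Real.exp_add, neg_mul, add_neg_cancel, Real.exp_zero,
      one_smul]
  · exact isClosed_singleton.preimage hA.continuousOn.domRestrict
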